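/- Let $R$ be an associative ring with identity, $\mathrm{Mod}R$ the category of left $R$-modules and $\mathrm{D}(R)$ its unbounded derived category. For a class $\mathsf{X}$ of $R$-modules put $$\mathcal{X}_{\mathsf P}=\{X\in \mathrm{D}(R) : \text{some semi-projective resolution } P\simeq X \text{ has } \mathrm{coker}(P^{s-1}\to P^s)\in\mathsf{X} \text{ for all } s\in\mathbb{Z}\},$$ $$\mathcal{X}_{\mathsf I}=\{Y\in \mathrm{D}(R) : \text{some semi-injective resolution } Y\simeq I \text{ has } \ker(I^{s}\to I^{s+1})\in\mathsf{X} \text{ for all } s\in\mathbb{Z}\}.$$ Let $\langle\mathsf P\rangle_1$ be the class of retracts in $\mathrm{D}(R)$ of coproducts of shifts of projective $R$-modules, and let $\xi$ be the class of exact triangles $X\to Y\to Z\to X[1]$ in $\mathrm{D}(R)$ such that $0\to\mathrm{Hom}(P,X)\to\mathrm{Hom}(P,Y)\to\mathrm{Hom}(P,Z)\to 0$ is exact for all $P\in\langle\mathsf P\rangle_1$. An object $P$ is $\xi$-projective if $\mathrm{Hom}(P,-)$ turns every triangle of $\xi$ into such a short exact sequence. A $\xi$-projective resolution of $X$ is a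 sequence $\cdots\to P_1\to P_0\to X$ spliced from triangles $K_{n+1}\to P_n\to K_n\to K_{n+1}[1]$ in $\xi$ with $P_n$ $\xi$-projective and $K_0\simeq X$, and $\xi xt^1_\xi(X,Y)$ is the first cohomology of $\mathrm{Hom}_{\mathrm{D}(R)}(P_\bullet,Y)$, that is, the first right $\xi$-derived functor of $\mathrm{Hom}_{\mathrm{D}(R)}(-,Y)$ at $X$. A pair $(\mathcal{A},\mathcal{B})$ of classes of objects of $\mathrm{D}(R)$ is a cotorsion pair with respect to $\xi$ if $\mathcal{B}=\{U : \xi xt^1_\xi(A,U)=0\ \forall A\in\mathcal{A}\}$ and $\mathcal{A}=\{V : \xi xt^1_\xi(V,B)=0\ \forall B\in\mathcal{B}\}$. It is complete if every $X$ has triangles $B\to A\to X\to B[1]$ and $X\to B'\to A'\to X[1]$ in $\xi$ with $A,A'\in\mathcal{A}$ and $B,B'\in\mathcal{B}$. It is hereditary if, for all triangles $A_1\to A_2\to A_3\to A_1[1]$ and $B_1\to B_2\to B_3\to B_1[1]$ in $\xi$, $A_2,A_3\in\mathcal{A}$ implies $A_1\in\mathcal{A}$, and $B_1,B_2\in\mathcal{B}$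 implies $B_3\in\mathcal{B}$. Complete hereditary cotorsion pairs in $\mathrm{Mod}R$ are defined in the same way, with $\mathrm{Ext}^1_R$ and short exact sequences. Let $\mathsf{A},\mathsf{B},\mathsf{C}$ be classes of $R$-modules closed under isomorphisms and direct summands. Then $(\mathsf{A},\mathsf{C})$ and $(\mathsf{C},\mathsf{B})$ are complete hereditary cotorsion pairs in $\mathrm{Mod}R$ if and only if $(\mathcal{A}_{\mathsf P},\mathcal{C}_{\mathsf I})$ and $(\mathcal{C}_{\mathsf I},\mathcal{B}_{\mathsf I})$ are complete hereditary cotorsion pairs in $\mathrm{D}(R)$ with respect to $\xi$. Moreover, in this case $\mathcal{C}_{\mathsf P}=\mathcal{C}_{\mathsf I}$. -/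

import Mathlib

open CategoryTheory Limits Pretriangulated

universe w u

noncomputable section

/-! ### Cotorsion pairs in an abelian category -/

namespace AbelianCotorsion

variable {C : Type*} [Category* C] [Abelian C] [HasExt.{w} C]

/-- `A^⊥ = {M | Ext¹(X, M) = 0 for all X ∈ A}`. -/
def rightPerp (A : ObjectProperty C) : ObjectProperty C :=
  fun M => ∀ X, A X → Subsingleton (Abelian.Ext X M 1)

/-- `^⊥B = {N | Ext¹(N, Y) = 0 for all Y ∈ B}`. -/
def leftPerp (B : ObjectProperty C) : ObjectProperty C :=
  fun N => ∀ Y, B Y → Subsingleton (Abelian.Ext N Y 1)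

/-- `(A, B)` is a complete hereditary cotorsion pair. -/
structure IsCompleteHereditary (A B : ObjectProperty C) : Prop where
  right_eq : rightPerp A = B
  left_eq : leftPerp B = A
  /-- `0 → B → A → M → 0`. -/
  exists_precover (M : C) : ∃ (Y X : C) (i : Y ⟶ X) (p : X ⟶ M) (h : i ≫ p = 0),
    B Y ∧ A X ∧ (ShortComplex.mk i p h).ShortExact
  /-- `0 → M → B' → A' → 0`. -/
  exists_preenvelope (M : C) : ∃ (Y X : C) (i : M ⟶ Y) (p : Y ⟶ X) (h : i ≫ p = 0),
    B Y ∧ A X ∧ (ShortComplex.mk i p h).ShortExact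
  /-- `A` is closed under kernels of epimorphisms. -/
  kernel_mem (S : ShortComplex C) : S.ShortExact → A S.X₂ → A S.X₃ → A S.X₁
  /-- `B` is closed under cokernels of monomorphisms. -/
  cokernel_mem (S : ShortComplex C) : S.ShortExact → B S.X₁ → B S.X₂ → B S.X₃

end AbelianCotorsion

/-! ### Homological algebra relative to a class `ξ` of triangles -/

namespace RelTriangulated

variable {T : Type*} [Category* T] [Preadditive T] [HasZeroObject T] [HasShift T ℤ]
  [∀ n : ℤ, (shiftFunctor T n).Additive] [Pretriangulated T]

/-- For a triangle `X ⟶ Y ⟶ Z ⟶ X⟦1⟧`, the sequence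
`0 → Hom(P, X) → Hom(P, Y) → Hom(P, Z) → 0` is exact. -/
structure HomShortExact (P : T) (Δ : Triangle T) : Prop where
  injective : Function.Injective (Preadditive.rightComp P Δ.mor₁)
  exact : Function.Exact (Preadditive.rightComp P Δ.mor₁) (Preadditive.rightComp P Δ.mor₂)
  surjective : Function.Surjective (Preadditive.rightComp P Δ.mor₂)

/-- The class `ξ(𝒳)` of distinguished triangles on which `Hom(P, -)` is short exact for every
`P` in `𝒳`. -/
def properClass (𝒳 : ObjectProperty T) : Set (Triangle T) :=
  {Δ | Δ ∈ distTriang T ∧ ∀ P, 𝒳 P → HomShortExact P Δ}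

/-- `ξ`-projective objects. -/
def IsProjective (ξ : Set (Triangle T)) : ObjectProperty T :=
  fun P => ∀ Δ ∈ ξ, HomShortExact P Δ

/-- A `ξ`-projective resolution `⋯ ⟶ P₂ ⟶ P₁ ⟶ P₀ ⟶ X`, spliced from triangles
`K (n + 1) ⟶ P n ⟶ K n ⟶ (K (n + 1))⟦1⟧` in `ξ` with `K 0 ≅ X`. -/
structure ProjResolution (ξ : Set (Triangle T)) (X : T) where
  K : ℕ → T
  P : ℕ → T
  i (n : ℕ) : K (n + 1) ⟶ P n
  p (n : ℕ) : P n ⟶ K n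
  δ (n : ℕ) : K n ⟶ (K (n + 1))⟦(1 : ℤ)⟧
  mem (n : ℕ) : Triangle.mk (i n) (p n) (δ n) ∈ ξ
  projective (n : ℕ) : IsProjective ξ (P n)
  iso : K 0 ≅ X

namespace ProjResolution

variable {ξ : Set (Triangle T)} {X : T} (ρ : ProjResolution ξ X)

/-- The differential `P (n + 1) ⟶ P n`. -/
def d (n : ℕ) : ρ.P (n + 1) ⟶ ρ.P n := ρ.p (n + 1) ≫ ρ.i n

/-- The `(n + 1)`-st cohomology group of the complex `Hom(P₀, Y) → Hom(P₁, Y) → ⋯`. -/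
abbrev HomCohomologySucc (Y : T) (n : ℕ) : Type _ :=
  (Preadditive.leftComp Y (ρ.d (n + 1))).ker ⧸
    (Preadditive.leftComp Y (ρ.d n)).range.addSubgroupOf
      (Preadditive.leftComp Y (ρ.d (n + 1))).ker

end ProjResolution

/-- `ξxt¹(X, Y) = 0`, where `ξxt¹(-, Y)` is the first right `ξ`-derived functor of `Hom(-, Y)`,
computed by `ξ`-projective resolutions of `X`. -/
def XiExtOneVanishes (ξ : Set (Triangle T)) (X Y : T) : Prop :=
  ∀ ρ : ProjResolution ξ X, Subsingleton (ρ.HomCohomologySucc Y 0)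

/-- `𝒜^{⊥_ξ}`. -/
def rightPerp (ξ : Set (Triangle T)) (𝒜 : ObjectProperty T) : ObjectProperty T :=
  fun U => ∀ X, 𝒜 X → XiExtOneVanishes ξ X U

/-- `^{⊥_ξ}ℬ`. -/
def leftPerp (ξ : Set (Triangle T)) (ℬ : ObjectProperty T) : ObjectProperty T :=
  fun V => ∀ Y, ℬ Y → XiExtOneVanishes ξ V Y

/-- `(𝒜, ℬ)` is a complete hereditary cotorsion pair with respect to `ξ`. -/
structure IsCompleteHereditary (ξ : Set (Triangle T)) (𝒜 ℬ : ObjectProperty T) : Prop where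
  right_eq : rightPerp ξ 𝒜 = ℬ
  left_eq : leftPerp ξ ℬ = 𝒜
  /-- `B ⟶ A ⟶ X ⟶ B⟦1⟧`. -/
  exists_precover (X : T) : ∃ (B A : T) (f : B ⟶ A) (g : A ⟶ X) (h : X ⟶ B⟦(1 : ℤ)⟧),
    ℬ B ∧ 𝒜 A ∧ Triangle.mk f g h ∈ ξ
  /-- `X ⟶ B' ⟶ A' ⟶ X⟦1⟧`. -/
  exists_preenvelope (X : T) : ∃ (B A : T) (f : X ⟶ B) (g : B ⟶ A) (h : A ⟶ X⟦(1 : ℤ)⟧),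
    ℬ B ∧ 𝒜 A ∧ Triangle.mk f g h ∈ ξ
  left_mem (Δ : Triangle T) : Δ ∈ ξ → 𝒜 Δ.obj₂ → 𝒜 Δ.obj₃ → 𝒜 Δ.obj₁
  right_mem (Δ : Triangle T) : Δ ∈ ξ → ℬ Δ.obj₁ → ℬ Δ.obj₂ → ℬ Δ.obj₃

end RelTriangulated

/-! ### The derived category of `R`-modules -/

namespace DerivedMod

variable {R : Type u} [Ring R]

/-- Semi-projective (dg-projective) complexes: all terms are projective, and every map to an
acyclic complex is null-homotopic. -/
structure IsSemiProjective (P : CochainComplex (ModuleCat.{u} R) ℤ) : Prop where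
  projective (s : ℤ) : Projective (P.X s)
  isKProjective : P.IsKProjective

/-- Semi-injective (dg-injective) complexes: all terms are injective, and every map from an
acyclic complex is null-homotopic. -/
structure IsSemiInjective (I : CochainComplex (ModuleCat.{u} R) ℤ) : Prop where
  injective (s : ℤ) : Injective (I.X s)
  isKInjective : I.IsKInjective

variable [HasDerivedCategory.{w} (ModuleCat.{u} R)]

/-- `𝒳_P`: the objects `X` of `D(R)` with a semi-projective resolution `P ≃ X` such that
`coker(P^{s-1} ⟶ P^s)` lies in `S` for all `s`. -/
def projLift (S : ObjectProperty (ModuleCat.{u} R)) :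
    ObjectProperty (DerivedCategory (ModuleCat.{u} R)) :=
  fun X => ∃ P : CochainComplex (ModuleCat.{u} R) ℤ, IsSemiProjective P ∧
    Nonempty (DerivedCategory.Q.obj P ≅ X) ∧ ∀ s : ℤ, S (cokernel (P.d (s - 1) s))

/-- `𝒳_I`: the objects `Y` of `D(R)` with a semi-injective resolution `Y ≃ I` such that
`ker(I^s ⟶ I^{s+1})` lies in `S` for all `s`. -/
def injLift (S : ObjectProperty (ModuleCat.{u} R)) :
    ObjectProperty (DerivedCategory (ModuleCat.{u} R)) :=
  fun Y => ∃ I : CochainComplex (ModuleCat.{u} R) ℤ, IsSemiInjective I ∧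
    Nonempty (Y ≅ DerivedCategory.Q.obj I) ∧ ∀ s : ℤ, S (kernel (I.d s (s + 1)))

/-- `⟨S⟩₁`: retracts in `D(R)` of coproducts of shifts of modules in `S`. -/
def angleOne (S : ObjectProperty (ModuleCat.{u} R)) :
    ObjectProperty (DerivedCategory (ModuleCat.{u} R)) :=
  fun X => ∃ (ι : Type u) (M : ι → ModuleCat.{u} R) (n : ι → ℤ)
    (c : Cofan fun j => ((DerivedCategory.singleFunctor (ModuleCat.{u} R) 0).obj (M j))⟦n j⟧),
    (∀ j, S (M j)) ∧ Nonempty (IsColimit c) ∧ Nonempty (Retract X c.pt)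

variable (R) in
/-- The class `ξ = ξ(⟨P⟩₁)` of cohomologically ghost triangles in `D(R)`, where `P` is the class
of projective modules. -/
def xi : Set (Triangle (DerivedCategory (ModuleCat.{u} R))) :=
  RelTriangulated.properClass (angleOne fun M : ModuleCat.{u} R => Projective M)

end DerivedMod

end

noncomputable section

/-! ### Lifting and extension properties from the vanishing of `Ext¹` -/

namespace AbelianCotorsion

open Abelian

variable {C : Type*} [Category* C] [Abelian C] [HasExt.{w} C]

/-! Everything is governed by cohomology. A distinguished triangle lies in `ξ` exactly when it
induces short exact sequences of cohomology modules in every degree (`mem_xi_iff`), and the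
`ξ`-projectives are the objects with projective cohomology whose outgoing morphisms are the graded
morphisms out of that cohomology. Hence `ξxt¹(X, Y)` vanishes if and only if `Ext¹(Hˢ X, Hˢ Y)` does
for every `s` (`xiExtOneVanishes_iff`).

Let `cohLift S` be the class of objects whose cohomology lies in `S`. A complete hereditary pair of
module classes lifts to a pair of classes `cohLift`, with stalk complexes testing orthogonality, and
stalks in degree zero give the descent. The hard part of lifting is completeness: preenvelopes of
boundaries and cohomology are assembled by `exists_horseshoe` into a map of complexes inducing
special preenvelopes in cohomology, and precovers follow by Salce's trick.

It remains to identify `projLift` and `injLift` with `cohLift`. For a module pair, heredity carries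
cokernels in `A` to cohomology in `A`. Conversely, for K-projective `P` with cohomology in `A`, a
map from the boundaries of `P` to `Y` in `B` yields a map from `P` to a coaugmented injective
resolution of `Y`; a null-homotopy of it supplies the extension to the terms of `P`
(`exists_factorization`). Resolutions themselves are built as colimits of cell attachments, or
dually as limits of towers.

If only the pairs in `D(R)` are given, both classes of a pair are still detected one cohomology
module at a time, so stalks decide. A stalk in `projLift A` is a retract of a cokernel in `A`
(`mem_of_projLift_single`), and each module of `A` is a cohomology module of some object of
`projLift A` (`exists_projLift_of_mem`). Finally `projLift C` and `injLift C` agree since `C` is the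
left class of one pair and the right class of the other. -/

theorem subsingleton_ext_of_iso {X X' Y Y' : C} (e : X ≅ X') (f : Y ≅ Y')
    [h : Subsingleton (Ext X Y 1)] : Subsingleton (Ext X' Y' 1) := by
  refine subsingleton_of_forall_eq 0 fun x => ?_
  have h1 : (Ext.mk₀ e.inv).comp (((Ext.mk₀ e.hom).comp (x.comp (Ext.mk₀ f.inv) (add_zero 1))
      (zero_add 1)).comp (Ext.mk₀ f.hom) (add_zero 1)) (zero_add 1) = x := by
    simp [Ext.comp_assoc_of_second_deg_zero, Ext.comp_assoc_of_third_deg_zero]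
  rw [← h1, Subsingleton.elim ((Ext.mk₀ e.hom).comp (x.comp (Ext.mk₀ f.inv) (add_zero 1))
    (zero_add 1)) 0]
  simp

theorem exists_lift_of_subsingleton_ext {S : ShortComplex C} (hS : S.ShortExact) {X : C}
    [Subsingleton (Ext X S.X₁ 1)] (φ : X ⟶ S.X₃) : ∃ ψ : X ⟶ S.X₂, ψ ≫ S.g = φ := by
  obtain ⟨x, hx⟩ := Ext.covariant_sequence_exact₃ X hS (Ext.mk₀ φ) (zero_add 1)
    (Subsingleton.elim _ _)
  obtain ⟨ψ, rfl⟩ := Ext.homEquiv₀.symm.surjective x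
  refine ⟨ψ, Ext.homEquiv₀.symm.injective ?_⟩
  simpa using hx

theorem exists_extension_of_subsingleton_ext {S : ShortComplex C} (hS : S.ShortExact) {Y : C}
    [Subsingleton (Ext S.X₃ Y 1)] (φ : S.X₁ ⟶ Y) : ∃ ψ : S.X₂ ⟶ Y, S.f ≫ ψ = φ := by
  obtain ⟨x, hx⟩ := Ext.contravariant_sequence_exact₁ hS Y (Ext.mk₀ φ) (add_zero 1)
    (Subsingleton.elim _ _)
  obtain ⟨ψ, rfl⟩ := Ext.homEquiv₀.symm.surjective x
  refine ⟨ψ, Ext.homEquiv₀.symm.injective ?_⟩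
  simpa using hx

theorem subsingleton_ext_of_exists_lift {S : ShortComplex C} (hS : S.ShortExact) {X : C}
    [Subsingleton (Ext X S.X₂ 1)] (h : ∀ φ : X ⟶ S.X₃, ∃ ψ : X ⟶ S.X₂, ψ ≫ S.g = φ) :
    Subsingleton (Ext X S.X₁ 1) := by
  refine subsingleton_of_forall_eq 0 fun x => ?_
  obtain ⟨y, rfl⟩ := Ext.covariant_sequence_exact₁ X hS x (Subsingleton.elim _ _) (zero_add 1)
  obtain ⟨φ, rfl⟩ := Ext.homEquiv₀.symm.surjective y
  obtain ⟨ψ, rfl⟩ := h φ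
  have : (Ext.mk₀ (ψ ≫ S.g)) = (Ext.mk₀ ψ).comp (Ext.mk₀ S.g) (add_zero 0) := by simp
  change (Ext.mk₀ (ψ ≫ S.g)).comp _ _ = 0
  rw [this, Ext.comp_assoc_of_second_deg_zero]
  simp

theorem subsingleton_ext_of_exists_extension {S : ShortComplex C} (hS : S.ShortExact) {Y : C}
    [Subsingleton (Ext S.X₂ Y 1)] (h : ∀ φ : S.X₁ ⟶ Y, ∃ ψ : S.X₂ ⟶ Y, S.f ≫ ψ = φ) :
    Subsingleton (Ext S.X₃ Y 1) := by
  refine subsingleton_of_forall_eq 0 fun x => ?_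
  obtain ⟨y, rfl⟩ := Ext.contravariant_sequence_exact₃ hS Y x (Subsingleton.elim _ _) (add_zero 1)
  obtain ⟨φ, rfl⟩ := Ext.homEquiv₀.symm.surjective y
  obtain ⟨ψ, rfl⟩ := h φ
  change hS.extClass.comp (Ext.mk₀ (S.f ≫ ψ)) _ = 0
  rw [← Ext.mk₀_comp_mk₀, ← Ext.comp_assoc_of_second_deg_zero]
  simp

theorem subsingleton_ext_right_of_shortExact {S : ShortComplex C} (hS : S.ShortExact) {X : C}
    [Subsingleton (Ext X S.X₁ 1)] [Subsingleton (Ext X S.X₃ 1)] :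
    Subsingleton (Ext X S.X₂ 1) := by
  refine subsingleton_of_forall_eq 0 fun x => ?_
  obtain ⟨y, rfl⟩ := Ext.covariant_sequence_exact₂ X hS x (Subsingleton.elim _ _)
  rw [Subsingleton.elim y 0, Ext.zero_comp]

theorem subsingleton_ext_left_of_shortExact {S : ShortComplex C} (hS : S.ShortExact) {Y : C}
    [Subsingleton (Ext S.X₁ Y 1)] [Subsingleton (Ext S.X₃ Y 1)] :
    Subsingleton (Ext S.X₂ Y 1) := by
  refine subsingleton_of_forall_eq 0 fun x => ?_
  obtain ⟨y, rfl⟩ := Ext.contravariant_sequence_exact₂ hS Y x (Subsingleton.elim _ _)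
  rw [Subsingleton.elim y 0, Ext.comp_zero]

instance (B : ObjectProperty C) : (leftPerp B).IsClosedUnderIsomorphisms where
  of_iso e h Y hY := by
    have := h Y hY
    exact subsingleton_ext_of_iso e (Iso.refl Y)

instance (A : ObjectProperty C) : (rightPerp A).IsClosedUnderIsomorphisms where
  of_iso e h X hX := by
    have := h X hX
    exact subsingleton_ext_of_iso (Iso.refl X) e

namespace IsCompleteHereditary

variable {A B : ObjectProperty C} (h : IsCompleteHereditary A B)

include h

theorem subsingleton_ext {X Y : C} (hX : A X) (hY : B Y) : Subsingleton (Ext X Y 1) := by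
  rw [← h.right_eq] at hY
  exact hY X hX

theorem isClosedUnderIsomorphisms_left : A.IsClosedUnderIsomorphisms := by
  rw [← h.left_eq]
  infer_instance

theorem isClosedUnderIsomorphisms_right : B.IsClosedUnderIsomorphisms := by
  rw [← h.right_eq]
  infer_instance

theorem mem_left_of_projective (X : C) [Projective X] : A X := by
  rw [← h.left_eq]
  exact fun Y _ => Ext.subsingleton_of_projective X Y 0

theorem mem_right_of_injective (Y : C) [Injective Y] : B Y := by
  rw [← h.right_eq]
  exact fun X _ => Ext.subsingleton_of_injective X Y 0

theorem extension_mem_left {S : ShortComplex C} (hS : S.ShortExact) (h₁ : A S.X₁) (h₃ : A S.X₃) :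
    A S.X₂ := by
  rw [← h.left_eq]
  intro Y hY
  have := h.subsingleton_ext h₁ hY
  have := h.subsingleton_ext h₃ hY
  exact subsingleton_ext_left_of_shortExact hS

theorem extension_mem_right {S : ShortComplex C} (hS : S.ShortExact) (h₁ : B S.X₁)
    (h₃ : B S.X₃) : B S.X₂ := by
  rw [← h.right_eq]
  intro X hX
  have := h.subsingleton_ext hX h₁
  have := h.subsingleton_ext hX h₃
  exact subsingleton_ext_right_of_shortExact hS

end IsCompleteHereditary

end AbelianCotorsion

/-! ### Complexes of projective objects with zero differential -/

section FormalComplex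

variable {C : Type*} [Category* C] [Abelian C]

namespace CochainComplex

/-- The complex with terms `F s` and zero differential. -/
@[simps]
def zeroDiff (F : ℤ → C) : CochainComplex C ℤ where
  X := F
  d _ _ := 0

variable {F Y : CochainComplex C ℤ}

theorem isIso_iCycles_of_d_eq_zero (hF : ∀ i j, F.d i j = 0) (s : ℤ) : IsIso (F.iCycles s) :=
  F.isIso_iCycles s (s + 1) (by simp) (hF _ _)

theorem isIso_homologyπ_of_d_eq_zero (hF : ∀ i j, F.d i j = 0) (s : ℤ) :
    IsIso (F.homologyπ s) :=
  F.isIso_homologyπ (s - 1) s (by simp) (hF _ _)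

/-- With zero differential, `F.X s` is its own cohomology, so projectivity lifts `φ s` to the cycles
of `Y`. Any such degreewise lift is a chain map, since both composites with the differentials
vanish. -/
theorem exists_hom_of_homology_of_projective (hF : ∀ i j, F.d i j = 0)
    [∀ s, Projective (F.X s)] (φ : ∀ s, F.homology s ⟶ Y.homology s) :
    ∃ f : F ⟶ Y, ∀ s, HomologicalComplex.homologyMap f s = φ s := by
  have := isIso_iCycles_of_d_eq_zero hF
  have := isIso_homologyπ_of_d_eq_zero hF
  let f : F ⟶ Y :=
    { f s := Projective.factorThru (inv (F.iCycles s) ≫ F.homologyπ s ≫ φ s) (Y.homologyπ s) ≫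
        Y.iCycles s
      comm' i j _ := by simp [hF] }
  refine ⟨f, fun s => ?_⟩
  have h : HomologicalComplex.cyclesMap f s = F.iCycles s ≫
      Projective.factorThru (inv (F.iCycles s) ≫ F.homologyπ s ≫ φ s) (Y.homologyπ s) := by
    simp [← cancel_mono (Y.iCycles s), f]
  rw [← cancel_epi (F.homologyπ s), HomologicalComplex.homologyπ_naturality, h]
  simp

/-- A map that is zero in cohomology lands in the boundaries, and projectivity lifts it through the
differential of `Y`. The other summand of the homotopy formula is zero because `F` has no
differential. -/
theorem nonempty_homotopy_zero_of_projective (hF : ∀ i j, F.d i j = 0)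
    [∀ s, Projective (F.X s)] (f : F ⟶ Y)
    (hf : ∀ s, HomologicalComplex.homologyMap f s = 0) : Nonempty (Homotopy f 0) := by
  have := isIso_iCycles_of_d_eq_zero hF
  have key : ∀ i j (_ : (ComplexShape.up ℤ).Rel j i),
      ∃ k : F.X i ⟶ Y.X j, k ≫ Y.d j i = f.f i := by
    intro i j hij
    let S : ShortComplex C := ShortComplex.mk (Y.toCycles j i) (Y.homologyπ i) (by simp)
    have hS : S.Exact := ShortComplex.exact_of_g_is_cokernel _ (Y.homologyIsCokernel j i
      (by simpa using (ComplexShape.prev_eq' _ hij)))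
    have h0 : (inv (F.iCycles i) ≫ HomologicalComplex.cyclesMap f i) ≫ S.g = 0 := by
      have := HomologicalComplex.homologyπ_naturality f i
      rw [hf, comp_zero] at this
      simp [S, ← this]
    refine ⟨hS.liftFromProjective _ h0, ?_⟩
    have h1 := hS.liftFromProjective_comp _ h0
    dsimp [S] at h1
    rw [← Y.toCycles_i j i, reassoc_of% h1]
    simp
  choose k hk using key
  have : f = Homotopy.nullHomotopicMap' k := by
    ext i
    rw [Homotopy.nullHomotopicMap'_f (k₂ := i - 1) (k₁ := i) (k₀ := i + 1) (by simp) (by simp),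
      hk, hF]
    simp
  exact ⟨(Homotopy.ofEq this).trans (Homotopy.nullHomotopy' k)⟩

end CochainComplex

end FormalComplex

/-! ### Objects of the derived category detected by cohomology -/

namespace DerivedCategory

variable {C : Type*} [Category* C] [Abelian C] [HasDerivedCategory.{w} C]

/-- The cohomology of the image in the derived category of a complex. -/
def homologyQIso (K : CochainComplex C ℤ) (s : ℤ) :
    (homologyFunctor C s).obj (Q.obj K) ≅ K.homology s :=
  (homologyFunctorFactors C s).app K

theorem homologyQIso_hom_naturality {K L : CochainComplex C ℤ} (f : K ⟶ L) (s : ℤ) :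
    (homologyFunctor C s).map (Q.map f) ≫ (homologyQIso L s).hom =
      (homologyQIso K s).hom ≫ HomologicalComplex.homologyMap f s :=
  (homologyFunctorFactors C s).hom.naturality f

/-- Objects `P` with projective cohomology such that morphisms out of `P` are the same as
graded morphisms out of the cohomology of `P`. -/
structure IsFormalProjective (P : DerivedCategory C) : Prop where
  projective (s : ℤ) : Projective ((homologyFunctor C s).obj P)
  eq_zero {Y : DerivedCategory C} (g : P ⟶ Y) : (∀ s, (homologyFunctor C s).map g = 0) → g = 0
  exists_map {Y : DerivedCategory C}
    (φ : ∀ s, (homologyFunctor C s).obj P ⟶ (homologyFunctor C s).obj Y) :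
    ∃ g : P ⟶ Y, ∀ s, (homologyFunctor C s).map g = φ s

instance (s : ℤ) : (homologyFunctor C s).Additive :=
  Functor.additive_of_iso
    (Iso.refl _ : (homologyFunctor C 0).shift s ≅ homologyFunctor C s)

namespace IsFormalProjective

theorem of_retract {P P' : DerivedCategory C} (hP : IsFormalProjective P) (r : Retract P' P) :
    IsFormalProjective P' where
  projective s := by
    have := hP.projective s
    exact Retract.projective (r.map (homologyFunctor C s))
  eq_zero g hg := by
    have : r.r ≫ g = 0 := hP.eq_zero _ fun s => by rw [Functor.map_comp, hg, comp_zero]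
    rw [← Category.id_comp g, ← r.retract, Category.assoc, this, comp_zero]
  exists_map φ := by
    obtain ⟨g, hg⟩ := hP.exists_map fun s => (homologyFunctor C s).map r.r ≫ φ s
    refine ⟨r.i ≫ g, fun s => ?_⟩
    rw [Functor.map_comp, hg, ← Functor.map_comp_assoc, r.retract, CategoryTheory.Functor.map_id,
      Category.id_comp]

theorem of_iso {P P' : DerivedCategory C} (hP : IsFormalProjective P) (e : P' ≅ P) :
    IsFormalProjective P' :=
  hP.of_retract (Retract.ofIso e)

theorem ext {P Y : DerivedCategory C} (hP : IsFormalProjective P) {g g' : P ⟶ Y}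
    (h : ∀ s, (homologyFunctor C s).map g = (homologyFunctor C s).map g') : g = g' := by
  rw [← sub_eq_zero]
  exact hP.eq_zero _ fun s => by rw [Functor.map_sub, h, sub_self]

/-- Isolates one degree, so that a morphism between single cohomology modules can be treated as a
morphism in the derived category. -/
theorem exists_map_degree {P Y : DerivedCategory C} (hP : IsFormalProjective P) (s : ℤ)
    (φ : (homologyFunctor C s).obj P ⟶ (homologyFunctor C s).obj Y) :
    ∃ g : P ⟶ Y, (homologyFunctor C s).map g = φ ∧
      ∀ j, j ≠ s → (homologyFunctor C j).map g = 0 := by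
  obtain ⟨g, hg⟩ := hP.exists_map (Y := Y) (fun j => if h : j = s then
    eqToHom (by rw [h]) ≫ φ ≫ eqToHom (by rw [h]) else 0)
  refine ⟨g, ?_, fun j hj => ?_⟩
  · simp [hg s]
  · simp [hg j, hj]

end IsFormalProjective

theorem isFormalProjective_Q_obj {F : CochainComplex C ℤ} (hF : ∀ i j, F.d i j = 0)
    [∀ s, Projective (F.X s)] : IsFormalProjective (Q.obj F) where
  projective s := by
    have := CochainComplex.isIso_iCycles_of_d_eq_zero hF s
    have := CochainComplex.isIso_homologyπ_of_d_eq_zero hF s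
    exact Projective.of_iso ((asIso (F.iCycles s)).symm ≪≫ asIso (F.homologyπ s) ≪≫
      (homologyQIso F s).symm) inferInstance
  eq_zero {Y} g hg := by
    obtain ⟨K, ⟨e⟩⟩ : ∃ K, Nonempty (Q.obj K ≅ Y) := ⟨_, ⟨Q.objObjPreimageIso Y⟩⟩
    -- In a left fraction the quasi-isomorphism sits on the target side, so the source is still `F`
    -- and the null-homotopy lemma applies to the numerator.
    obtain ⟨L, f, s, hs, hfs⟩ := left_fac (g ≫ e.inv)
    have hf : Nonempty (Homotopy f 0) := by
      refine CochainComplex.nonempty_homotopy_zero_of_projective hF f fun n => ?_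
      have : Q.map f = g ≫ e.inv ≫ Q.map s := by rw [← Category.assoc, hfs]; simp
      rw [← cancel_epi (homologyQIso F n).hom, ← homologyQIso_hom_naturality, this,
        Functor.map_comp, hg]
      simp
    have h0 : Q.map f = 0 := by rw [Q_map_eq_of_homotopy _ hf.some, Functor.map_zero]
    rw [h0, zero_comp] at hfs
    rw [← cancel_mono e.inv, hfs, zero_comp]
  exists_map {Y} φ := by
    obtain ⟨K, ⟨e⟩⟩ : ∃ K, Nonempty (Q.obj K ≅ Y) := ⟨_, ⟨Q.objObjPreimageIso Y⟩⟩
    obtain ⟨f, hf⟩ := CochainComplex.exists_hom_of_homology_of_projective hF (Y := K) fun s =>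
      (homologyQIso F s).inv ≫ φ s ≫ (homologyFunctor C s).map e.inv ≫
        (homologyQIso K s).hom
    refine ⟨Q.map f ≫ e.hom, fun s => ?_⟩
    have h1 := homologyQIso_hom_naturality f s
    rw [hf, Iso.hom_inv_id_assoc] at h1
    simp only [← Category.assoc, cancel_mono] at h1
    rw [Functor.map_comp, h1, Category.assoc, ← Functor.map_comp, e.inv_hom_id,
      CategoryTheory.Functor.map_id,
      Category.comp_id]

theorem isFormalProjective_singleFunctor_obj (M : C) [Projective M] (n : ℤ) :
    IsFormalProjective ((singleFunctor C n).obj M) := by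
  have : ∀ s, Projective (((HomologicalComplex.single C (ComplexShape.up ℤ) n).obj M).X s) := by
    intro s
    by_cases h : s = n
    · subst h
      exact Projective.of_iso
        (HomologicalComplex.singleObjXSelf (ComplexShape.up ℤ) s M).symm inferInstance
    · exact (HomologicalComplex.isZero_single_obj_X _ _ _ _ h).projective
  exact isFormalProjective_Q_obj (F := (HomologicalComplex.single C (ComplexShape.up ℤ) n).obj M)
    (by simp)

theorem isFormalProjective_shift_singleFunctor_obj (M : C) [Projective M] (n : ℤ) :
    IsFormalProjective (((singleFunctor C 0).obj M)⟦n⟧) :=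
  (isFormalProjective_singleFunctor_obj M (-n)).of_iso
    (((singleFunctors C).shiftIso n (-n) 0 (by simp)).app M)

end DerivedCategory

/-! ### The class `ξ` and its derived functor in terms of cohomology -/

namespace RelTriangulated

variable {T : Type*} [Category* T] [Preadditive T] [HasZeroObject T] [HasShift T ℤ]
  [∀ n : ℤ, (shiftFunctor T n).Additive] [Pretriangulated T]

theorem homShortExact_iff {Δ : Triangle T} (hΔ : Δ ∈ distTriang T) (P : T) :
    HomShortExact P Δ ↔ (∀ g : P ⟶ Δ.obj₁, g ≫ Δ.mor₁ = 0 → g = 0) ∧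
      ∀ g : P ⟶ Δ.obj₃, ∃ f : P ⟶ Δ.obj₂, f ≫ Δ.mor₂ = g := by
  constructor
  · intro h
    exact ⟨fun g hg => (injective_iff_map_eq_zero _).1 h.injective g hg, fun g => h.surjective g⟩
  · rintro ⟨h₁, h₂⟩
    refine ⟨(injective_iff_map_eq_zero _).2 h₁, fun g => ⟨fun hg => ?_, ?_⟩, h₂⟩
    · obtain ⟨f, hf⟩ := Triangle.coyoneda_exact₂ Δ hΔ g hg
      exact ⟨f, hf.symm⟩
    · rintro ⟨f, rfl⟩
      change (f ≫ Δ.mor₁) ≫ Δ.mor₂ = 0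
      rw [Category.assoc, comp_distTriang_mor_zero₁₂ Δ hΔ, comp_zero]

theorem HomShortExact.of_retract {Δ : Triangle T} (hΔ : Δ ∈ distTriang T) {P P' : T}
    (h : HomShortExact P Δ) (r : Retract P' P) : HomShortExact P' Δ := by
  rw [homShortExact_iff hΔ] at h ⊢
  refine ⟨fun g hg => ?_, fun g => ?_⟩
  · have := h.1 (r.r ≫ g) (by rw [Category.assoc, hg, comp_zero])
    rw [← Category.id_comp g, ← r.retract, Category.assoc, this, comp_zero]
  · obtain ⟨f, hf⟩ := h.2 (r.r ≫ g)
    exact ⟨r.i ≫ f, by rw [Category.assoc, hf, r.retract_assoc]⟩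

theorem HomShortExact.of_isColimit {Δ : Triangle T} (hΔ : Δ ∈ distTriang T) {ι : Type*}
    {X : ι → T} {c : Cofan X} (hc : IsColimit c) (h : ∀ j, HomShortExact (X j) Δ) :
    HomShortExact c.pt Δ := by
  simp only [homShortExact_iff hΔ] at h ⊢
  refine ⟨fun g hg => ?_, fun g => ?_⟩
  · refine Cofan.IsColimit.hom_ext hc _ _ fun j => ?_
    rw [comp_zero]
    exact (h j).1 _ (by rw [Category.assoc, hg, comp_zero])
  · choose f hf using fun j => (h j).2 (c.inj j ≫ g)
    refine ⟨Cofan.IsColimit.desc hc f, Cofan.IsColimit.hom_ext hc _ _ fun j => ?_⟩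
    simp [hf]

omit [HasZeroObject T] [∀ n : ℤ, (shiftFunctor T n).Additive] [Pretriangulated T] in
theorem subsingleton_homCohomologySucc_iff {ξ : Set (Triangle T)} {X : T}
    (ρ : ProjResolution ξ X) (Y : T) : Subsingleton (ρ.HomCohomologySucc Y 0) ↔
      ∀ f : ρ.P 1 ⟶ Y, ρ.d 1 ≫ f = 0 → ∃ g : ρ.P 0 ⟶ Y, ρ.d 0 ≫ g = f := by
  rw [QuotientAddGroup.subsingleton_iff, AddSubgroup.addSubgroupOf_eq_top]
  exact ⟨fun h f hf => h (show f ∈ (Preadditive.leftComp Y (ρ.d 1)).ker from hf),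
    fun h f hf => h f hf⟩

end RelTriangulated

namespace DerivedMod

open DerivedCategory RelTriangulated

variable {R : Type u} [Ring R] [HasDerivedCategory.{w} (ModuleCat.{u} R)]

/-- The `s`-th cohomology functor on `D(R)`. -/
local notation "H" => DerivedCategory.homologyFunctor (ModuleCat R)

/-- In the long exact sequence both conditions say that the connecting map from degree `s - 1` to
degree `s` is zero. -/
theorem mono_homology_of_epi {Δ : Triangle (DerivedCategory (ModuleCat.{u} R))}
    (hΔ : Δ ∈ distTriang _) (h : ∀ s, Epi ((H s).map Δ.mor₂)) (s : ℤ) :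
    Mono ((H s).map Δ.mor₁) := by
  rw [HomologySequence.mono_homologyMap_mor₁_iff Δ hΔ (s - 1) s,
    ← HomologySequence.epi_homologyMap_mor₂_iff Δ hΔ (s - 1) s]
  exact h _

theorem IsFormalProjective.homShortExact {P : DerivedCategory (ModuleCat.{u} R)}
    (hP : DerivedCategory.IsFormalProjective P)
    {Δ : Triangle (DerivedCategory (ModuleCat.{u} R))} (hΔ : Δ ∈ distTriang _)
    (h : ∀ s, Epi ((H s).map Δ.mor₂)) : HomShortExact P Δ := by
  have := mono_homology_of_epi hΔ h
  have := hP.projective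
  rw [homShortExact_iff hΔ]
  refine ⟨fun g hg => hP.eq_zero _ fun s => ?_, fun g => ?_⟩
  · rw [← cancel_mono ((H s).map Δ.mor₁), ← Functor.map_comp, hg, Functor.map_zero, zero_comp]
  · obtain ⟨f, hf⟩ := hP.exists_map fun s =>
      Projective.factorThru ((H s).map g) ((H s).map Δ.mor₂)
    exact ⟨f, hP.ext fun s => by rw [Functor.map_comp, hf, Projective.factorThru_comp]⟩

theorem angleOne_shift_single {S : ObjectProperty (ModuleCat.{u} R)} {M : ModuleCat.{u} R}
    (hM : S M) (n : ℤ) :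
    angleOne S (((DerivedCategory.singleFunctor (ModuleCat.{u} R) 0).obj M)⟦n⟧) := by
  refine ⟨PUnit, fun _ => M, fun _ => n, Cofan.mk _ fun _ => 𝟙 _, fun _ => hM, ⟨?_⟩,
    ⟨Retract.refl _⟩⟩
  exact Cofan.IsColimit.mk _ (fun t => t.inj PUnit.unit) (fun _ _ => by simp)
    (fun t m hm => by simpa using hm PUnit.unit)

/-- A distinguished triangle lies in `ξ` if and only if it induces epimorphisms onto the
cohomology of its third term. -/
theorem mem_xi_iff (Δ : Triangle (DerivedCategory (ModuleCat.{u} R))) :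
    Δ ∈ xi R ↔ Δ ∈ distTriang _ ∧ ∀ s, Epi ((H s).map Δ.mor₂) := by
  constructor
  · rintro ⟨hΔ, h⟩
    refine ⟨hΔ, fun s => ?_⟩
    let M := Projective.over ((H s).obj Δ.obj₃)
    -- Shifting by `-s` places `M` in degree `s`. The resulting map from `P` to the third term is
    -- onto in `Hˢ`, and lifting it through `Δ.mor₂` forces `Hˢ(Δ.mor₂)` to be onto.
    let P := ((DerivedCategory.singleFunctor (ModuleCat.{u} R) 0).obj M)⟦-s⟧
    have hP : DerivedCategory.IsFormalProjective P :=
      isFormalProjective_shift_singleFunctor_obj M (-s)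
    let e : (H s).obj P ≅ M := (H s).mapIso
      (((singleFunctors (ModuleCat.{u} R)).shiftIso (-s) s 0 (by simp)).app M) ≪≫
      homologyQIso ((HomologicalComplex.single _ _ s).obj M) s ≪≫
      (HomologicalComplex.homologyFunctorSingleIso _ (ComplexShape.up ℤ) s).app M
    obtain ⟨g, hg, -⟩ := hP.exists_map_degree s (e.hom ≫ Projective.π ((H s).obj Δ.obj₃))
    obtain ⟨f, rfl⟩ := ((homShortExact_iff hΔ _).1
      (h P (angleOne_shift_single (S := fun M => Projective M) inferInstance _))).2 g
    rw [Functor.map_comp] at hg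
    have : Epi ((H s).map f ≫ (H s).map Δ.mor₂) := by
      rw [hg]
      infer_instance
    exact epi_of_epi ((H s).map f) _
  · rintro ⟨hΔ, h⟩
    refine ⟨hΔ, ?_⟩
    rintro P ⟨ι, M, n, c, hM, ⟨hc⟩, ⟨r⟩⟩
    refine HomShortExact.of_retract hΔ (HomShortExact.of_isColimit hΔ hc fun j => ?_) r
    have : Projective (M j) := hM j
    exact IsFormalProjective.homShortExact
      (isFormalProjective_shift_singleFunctor_obj (M j) (n j)) hΔ h

theorem shortExact_homology_of_mem_xi {Δ : Triangle (DerivedCategory (ModuleCat.{u} R))}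
    (hΔ : Δ ∈ xi R) (s : ℤ) :
    (ShortComplex.mk ((H s).map Δ.mor₁) ((H s).map Δ.mor₂)
      (by rw [← Functor.map_comp, comp_distTriang_mor_zero₁₂ _ hΔ.1,
        Functor.map_zero])).ShortExact := by
  rw [mem_xi_iff] at hΔ
  have := mono_homology_of_epi hΔ.1 hΔ.2 s
  have := hΔ.2 s
  exact ShortComplex.ShortExact.mk (HomologySequence.exact₂ Δ hΔ.1 s)

theorem shortExact_homology_of_mk_mem_xi {X Y Z : DerivedCategory (ModuleCat.{u} R)}
    {f : X ⟶ Y} {g : Y ⟶ Z} {h : Z ⟶ X⟦(1 : ℤ)⟧} (hΔ : Triangle.mk f g h ∈ xi R) (s : ℤ) :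
    ∃ w, (ShortComplex.mk ((H s).map f) ((H s).map g) w).ShortExact :=
  ⟨_, shortExact_homology_of_mem_xi hΔ s⟩

theorem mem_xi_of_mono {Δ : Triangle (DerivedCategory (ModuleCat.{u} R))}
    (hΔ : Δ ∈ distTriang _) (h : ∀ s, Mono ((H s).map Δ.mor₁)) : Δ ∈ xi R := by
  refine (mem_xi_iff Δ).2 ⟨hΔ, fun s => ?_⟩
  rw [HomologySequence.epi_homologyMap_mor₂_iff Δ hΔ s (s + 1),
    ← HomologySequence.mono_homologyMap_mor₁_iff Δ hΔ s (s + 1)]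
  exact h _

theorem IsFormalProjective.isProjective {P : DerivedCategory (ModuleCat.{u} R)}
    (hP : DerivedCategory.IsFormalProjective P) : IsProjective (xi R) P := fun Δ hΔ =>
  IsFormalProjective.homShortExact hP hΔ.1 ((mem_xi_iff Δ).1 hΔ).2

/-- There are enough `ξ`-projectives: projectives mapping onto the individual cohomology modules
form a complex with zero differential, and formality realizes these surjections by one morphism. -/
theorem exists_xi_cover (X : DerivedCategory (ModuleCat.{u} R)) :
    ∃ (K P : DerivedCategory (ModuleCat.{u} R)) (f : K ⟶ P) (g : P ⟶ X)
      (h : X ⟶ K⟦(1 : ℤ)⟧), DerivedCategory.IsFormalProjective P ∧ Triangle.mk f g h ∈ xi R := by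
  let F := CochainComplex.zeroDiff fun s => Projective.over ((H s).obj X)
  have hF : ∀ i j, F.d i j = 0 := fun _ _ => rfl
  have : ∀ s, Projective (F.X s) := fun s => Projective.projective_over ((H s).obj X)
  have hP : DerivedCategory.IsFormalProjective (Q.obj F) := isFormalProjective_Q_obj hF
  have := CochainComplex.isIso_iCycles_of_d_eq_zero hF
  have := CochainComplex.isIso_homologyπ_of_d_eq_zero hF
  let π (s : ℤ) : F.X s ⟶ (H s).obj X := Projective.π ((H s).obj X)
  have hπ (s : ℤ) : Epi (π s) := Projective.π_epi ((H s).obj X)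
  obtain ⟨g, hg⟩ := hP.exists_map (Y := X) fun s => (homologyQIso F s).hom ≫
    inv (F.homologyπ s) ≫ F.iCycles s ≫ π s
  obtain ⟨K, f, h, hT⟩ := distinguished_cocone_triangle₁ g
  refine ⟨K, _, f, g, h, hP, (mem_xi_iff _).2 ⟨hT, fun s => ?_⟩⟩
  change Epi ((H s).map g)
  rw [hg]
  infer_instance

/-- A `ξ`-projective lifts its identity through a cover, hence is a retract of a formal object. -/
theorem isFormalProjective_of_isProjective {P : DerivedCategory (ModuleCat.{u} R)}
    (hP : IsProjective (xi R) P) : DerivedCategory.IsFormalProjective P := by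
  obtain ⟨K, P', f, g, h, hP', hT⟩ := exists_xi_cover P
  obtain ⟨i, hi⟩ := (hP _ hT).surjective (𝟙 P)
  exact hP'.of_retract { i := i, r := g, retract := hi }

theorem nonempty_projResolution (X : DerivedCategory (ModuleCat.{u} R)) :
    Nonempty (ProjResolution (xi R) X) := by
  choose K P f g h hP hT using exists_xi_cover (R := R)
  let L : ℕ → DerivedCategory (ModuleCat.{u} R) := Nat.rec X fun _ => K
  exact ⟨{
    K := L
    P n := P (L n)
    i n := f (L n)
    p n := g (L n)
    δ n := h (L n)
    mem n := hT (L n)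
    projective n := IsFormalProjective.isProjective (hP (L n))
    iso := Iso.refl _ }⟩

/-- `ξxt¹(X, Y)` vanishes if and only if all the groups `Ext¹(Hˢ X, Hˢ Y)` do. -/
theorem xiExtOneVanishes_iff (X Y : DerivedCategory (ModuleCat.{u} R)) :
    XiExtOneVanishes (xi R) X Y ↔
      ∀ s, Subsingleton (Abelian.Ext ((H s).obj X) ((H s).obj Y) 1) := by
  simp only [XiExtOneVanishes, subsingleton_homCohomologySucc_iff]
  constructor
  · intro h s
    obtain ⟨ρ⟩ := nonempty_projResolution X
    have hP n := isFormalProjective_of_isProjective (ρ.projective n)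
    have := (hP 0).projective s
    choose w hS using fun n => shortExact_homology_of_mk_mem_xi (ρ.mem n) s
    have : Epi ((H s).map (ρ.p 1)) := (hS 1).epi_g
    have : Subsingleton (Abelian.Ext ((H s).obj (ρ.K 0)) ((H s).obj Y) 1) := by
      have : Subsingleton (Abelian.Ext ((H s).obj (ρ.P 0)) ((H s).obj Y) 1) :=
        Abelian.Ext.subsingleton_of_projective _ _ 0
      refine AbelianCotorsion.subsingleton_ext_of_exists_extension (hS 0) fun φ => ?_
      -- Concentrated in degree `s`, this `f` is a cocycle because `φ` factors out of `K 1`. Writing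
      -- `f` as a coboundary of `g` makes `Hˢ g` the desired extension of `φ` to `Hˢ(P 0)`.
      obtain ⟨f, hf, hf'⟩ := (hP 1).exists_map_degree s ((H s).map (ρ.p 1) ≫ φ)
      have hd : ρ.d 1 ≫ f = 0 := by
        refine (hP 2).eq_zero _ fun j => ?_
        rw [Functor.map_comp]
        by_cases hj : j = s
        · subst hj
          have : ρ.i 1 ≫ ρ.p 1 = 0 := comp_distTriang_mor_zero₁₂ _ (ρ.mem 1).1
          rw [hf, ProjResolution.d, Functor.map_comp, Category.assoc,
            ← Functor.map_comp_assoc _ (ρ.i 1), this]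
          simp
        · rw [hf' j hj, comp_zero]
      obtain ⟨g, hg⟩ := h ρ f hd
      refine ⟨(H s).map g, ?_⟩
      rw [← cancel_epi ((H s).map (ρ.p 1))]
      dsimp
      rw [← hf, ← hg, ProjResolution.d, Functor.map_comp, Functor.map_comp, Category.assoc]
    exact AbelianCotorsion.subsingleton_ext_of_iso ((H s).mapIso ρ.iso) (Iso.refl _)
  · intro h ρ f hf
    have hP n := isFormalProjective_of_isProjective (ρ.projective n)
    have key : ∀ s, ∃ ψ : (H s).obj (ρ.P 0) ⟶ (H s).obj Y,
        (H s).map (ρ.d 0) ≫ ψ = (H s).map f := by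
      intro s
      choose w hS using fun n => shortExact_homology_of_mk_mem_xi (ρ.mem n) s
      have : Epi ((H s).map (ρ.p 2)) := (hS 2).epi_g
      have : Epi ((H s).map (ρ.p 1)) := (hS 1).epi_g
      -- A cocycle kills the image of `P 2`, which in cohomology is all of `K 2`; so `Hˢ f` descends
      -- to `Hˢ(K 1)`, and `Ext¹`-vanishing extends it to `Hˢ(P 0)`.
      have h0 : (H s).map (ρ.i 1) ≫ (H s).map f = 0 := by
        rw [← cancel_epi ((H s).map (ρ.p 2)), ← Functor.map_comp, ← Functor.map_comp, comp_zero,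
          ← Category.assoc]
        exact (congrArg (H s).map hf).trans (Functor.map_zero _ _ _)
      let φ : (H s).obj (ρ.K 1) ⟶ (H s).obj Y := (hS 1).exact.desc ((H s).map f) h0
      have hφ : (H s).map (ρ.p 1) ≫ φ = (H s).map f := (hS 1).exact.g_desc _ h0
      have := h s
      have : Subsingleton (Abelian.Ext ((H s).obj (ρ.K 0)) ((H s).obj Y) 1) :=
        AbelianCotorsion.subsingleton_ext_of_iso ((H s).mapIso ρ.iso.symm) (Iso.refl _)
      obtain ⟨ψ, hψ⟩ := AbelianCotorsion.exists_extension_of_subsingleton_ext (hS 0) φ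
      refine ⟨ψ, ?_⟩
      dsimp at hψ
      rw [ProjResolution.d, Functor.map_comp, Category.assoc, hψ, hφ]
    choose ψ hψ using key
    obtain ⟨g, hg⟩ := (hP 0).exists_map ψ
    exact ⟨g, (hP 1).ext fun s => by rw [Functor.map_comp, hg, hψ]⟩

end DerivedMod

/-! ### The horseshoe construction for special preenvelopes -/

section Horseshoe

variable {C : Type*} [Category* C] [Abelian C]

namespace AbelianCotorsion.IsCompleteHereditary

variable [HasExt.{w} C] [EnoughInjectives C] {A B : ObjectProperty C}
  (h : IsCompleteHereditary A B)

include h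

/-- Embed `Y₁` in an injective `E`. By heredity `E / Y₁` lies in `B`, so the map `S.X₃ ⟶ E / Y₁`
induced by an extension `S.X₂ ⟶ E` extends along `i₃` to `Y₃`, whose quotient `W` is in `A`. The
middle term is the pullback of `E` and `Y₃` over `E / Y₁`. -/
theorem exists_horseshoe {S : ShortComplex C} (hS : S.ShortExact) {Y₁ Y₃ : C}
    (i₁ : S.X₁ ⟶ Y₁) (hY₁ : B Y₁) {W : C} (i₃ : S.X₃ ⟶ Y₃) (p : Y₃ ⟶ W) (w : i₃ ≫ p = 0)
    (hi₃ : (ShortComplex.mk i₃ p w).ShortExact) (hW : A W) :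
    ∃ (Y₂ : C) (f : Y₁ ⟶ Y₂) (g : Y₂ ⟶ Y₃) (i₂ : S.X₂ ⟶ Y₂) (w' : f ≫ g = 0),
      (ShortComplex.mk f g w').ShortExact ∧ S.f ≫ i₂ = i₁ ≫ f ∧ i₂ ≫ g = S.g ≫ i₃ := by
  have := hS.mono_f
  have := hS.epi_g
  let ι := Injective.ι Y₁
  let q := cokernel.π ι
  have wT : ι ≫ q = 0 := cokernel.condition ι
  have hT : (ShortComplex.mk ι q wT).ShortExact := .mk (ShortComplex.exact_cokernel _)
  have hF : B (cokernel ι) := h.cokernel_mem _ hT hY₁ (h.mem_right_of_injective _)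
  let e : S.X₂ ⟶ Injective.under Y₁ := Injective.factorThru (i₁ ≫ ι) S.f
  have he : S.f ≫ e = i₁ ≫ ι := Injective.comp_factorThru _ _
  have he' : S.f ≫ e ≫ q = 0 := by rw [reassoc_of% he, wT, comp_zero]
  let e' : S.X₃ ⟶ cokernel ι := hS.exact.desc (e ≫ q) he'
  have hee' : S.g ≫ e' = e ≫ q := hS.exact.g_desc _ _
  have := h.subsingleton_ext hW hF
  obtain ⟨c, hc⟩ : ∃ c : Y₃ ⟶ cokernel ι, i₃ ≫ c = e' :=
    exists_extension_of_subsingleton_ext hi₃ e'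
  let f : Y₁ ⟶ pullback q c := pullback.lift ι 0 (by rw [wT, zero_comp])
  have hf₁ : f ≫ pullback.fst q c = ι := pullback.lift_fst _ _ _
  have hf₂ : f ≫ pullback.snd q c = 0 := pullback.lift_snd _ _ _
  refine ⟨pullback q c, f, pullback.snd q c,
    pullback.lift e (S.g ≫ i₃) (by rw [Category.assoc, hc, hee']), hf₂, ?_, ?_,
    pullback.lift_snd _ _ _⟩
  · have : Mono (f ≫ pullback.fst q c) := by
      rw [hf₁]
      infer_instance
    have : Mono f := mono_of_mono f (pullback.fst q c)
    refine .mk (ShortComplex.exact_of_f_is_kernel _ ?_)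
    refine KernelFork.IsLimit.ofι' _ _ fun {Z} k hk =>
      ⟨hT.exact.lift (k ≫ pullback.fst q c) ?_, ?_⟩
    · change (k ≫ pullback.fst q c) ≫ q = 0
      rw [Category.assoc, pullback.condition, reassoc_of% hk, zero_comp]
    · apply pullback.hom_ext
      · rw [Category.assoc, hf₁]
        exact hT.exact.lift_f _ _
      · rw [Category.assoc, hf₂, comp_zero]
        exact hk.symm
  · apply pullback.hom_ext
    · rw [Category.assoc, pullback.lift_fst, Category.assoc, hf₁, he]
    · rw [Category.assoc, pullback.lift_snd, Category.assoc, hf₂, S.zero_assoc, zero_comp,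
        comp_zero]

end AbelianCotorsion.IsCompleteHereditary

namespace CochainComplex

/-- Reads off cohomology when a differential is given as an epimorphism onto `B` followed by
monomorphisms `B ⟶ Z ⟶ K.X j`, with `Z` the kernel of the next differential: `Z` plays the cycles,
`B` the boundaries and `H = Z / B`. -/
theorem exists_homologyIso (K : CochainComplex C ℤ) {i j k : ℤ} (hij : i + 1 = j)
    (hjk : j + 1 = k) {B Z H : C} (q : K.X i ⟶ B) [Epi q] {b : B ⟶ Z} {π : Z ⟶ H}
    {w : b ≫ π = 0} (hS : (ShortComplex.mk b π w).ShortExact) (ι : Z ⟶ K.X j) [Mono ι]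
    (hd : K.d i j = q ≫ b ≫ ι) {w' : ι ≫ K.d j k = 0}
    (hι : (ShortComplex.mk ι (K.d j k) w').Exact) :
    ∃ (c : K.cycles j ≅ Z) (e : K.homology j ≅ H), c.hom ≫ ι = K.iCycles j ∧
      K.homologyπ j ≫ e.hom = c.hom ≫ π := by
  have hπ : (ShortComplex.mk (q ≫ b) π (by simp [w])).Exact := by
    let φ : ShortComplex.mk (q ≫ b) π (by simp [w]) ⟶ ShortComplex.mk b π w :=
      { τ₁ := q, τ₂ := 𝟙 _, τ₃ := 𝟙 _ }
    exact (ShortComplex.exact_iff_of_epi_of_isIso_of_mono φ).2 hS.exact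
  have : Epi π := hS.epi_g
  let c : K.cycles j ≅ Z := IsLimit.conePointUniqueUpToIso
    (K.cyclesIsKernel j k ((ComplexShape.up ℤ).next_eq' hjk)) hι.fIsKernel
  have hc : c.hom ≫ ι = K.iCycles j := IsLimit.conePointUniqueUpToIso_hom_comp _ _
    WalkingParallelPair.zero
  have ht : K.toCycles i j ≫ c.hom = q ≫ b := by
    rw [← cancel_mono ι, Category.assoc, hc, K.toCycles_i, hd, Category.assoc]
  have hK : (ShortComplex.mk (K.toCycles i j) (K.homologyπ j) (by simp)).Exact :=
    ShortComplex.exact_of_g_is_cokernel _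
      (K.homologyIsCokernel i j ((ComplexShape.up ℤ).prev_eq' hij))
  have h₁ : K.toCycles i j ≫ c.hom ≫ π = 0 := by
    rw [reassoc_of% ht, w, comp_zero]
  have h₂ : (q ≫ b) ≫ c.inv ≫ K.homologyπ j = 0 := by
    rw [← ht]
    simp
  refine ⟨c, ⟨hK.desc _ h₁, hπ.desc _ h₂, ?_, ?_⟩, hc, hK.g_desc _ h₁⟩
  · rw [← cancel_epi (K.homologyπ j)]
    have e₁ := hK.g_desc _ h₁
    have e₂ := hπ.g_desc _ h₂
    dsimp at e₁ e₂
    rw [reassoc_of% e₁, e₂]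
    simp
  · rw [← cancel_epi π]
    have e₁ := hK.g_desc _ h₁
    have e₂ := hπ.g_desc _ h₂
    dsimp at e₁ e₂
    rw [reassoc_of% e₂, e₁]
    simp

/-- The sequence `0 → Bˢ → Zˢ → Hˢ → 0`. -/
theorem shortExact_boundaries_cycles (K : CochainComplex C ℤ) (s : ℤ) :
    (ShortComplex.mk (kernel.ι (K.homologyπ s)) (K.homologyπ s) (by simp)).ShortExact :=
  .mk (ShortComplex.exact_kernel _)

/-- The map from the `s`-th term onto the boundaries of degree `s + 1`. -/
def toBoundaries (K : CochainComplex C ℤ) (s : ℤ) : K.X s ⟶ kernel (K.homologyπ (s + 1)) :=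
  kernel.lift _ (K.toCycles s (s + 1)) (by simp)

@[simp]
theorem toBoundaries_ι (K : CochainComplex C ℤ) (s : ℤ) :
    toBoundaries K s ≫ kernel.ι (K.homologyπ (s + 1)) = K.toCycles s (s + 1) :=
  kernel.lift_ι _ _ _

theorem iCycles_toBoundaries (K : CochainComplex C ℤ) (s : ℤ) :
    K.iCycles s ≫ toBoundaries K s = 0 := by
  simp [← cancel_mono (kernel.ι (K.homologyπ (s + 1))), ← cancel_mono (K.iCycles (s + 1))]

/-- The sequence `0 → Zˢ → Kˢ → Bˢ⁺¹ → 0`. -/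
theorem shortExact_cycles_boundaries (K : CochainComplex C ℤ) (s : ℤ) :
    (ShortComplex.mk (K.iCycles s) (toBoundaries K s) (iCycles_toBoundaries K s)).ShortExact := by
  have hK : (ShortComplex.mk (K.toCycles s (s + 1)) (K.homologyπ (s + 1)) (by simp)).Exact :=
    ShortComplex.exact_of_g_is_cokernel _
      (K.homologyIsCokernel s (s + 1) ((ComplexShape.up ℤ).prev_eq' rfl))
  have : Epi (toBoundaries K s) := hK.epi_kernelLift
  refine .mk (ShortComplex.exact_of_f_is_kernel _ ?_)
  refine KernelFork.IsLimit.ofι' _ _ fun {Z} k hk =>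
    ⟨K.liftCycles k (s + 1) (by simp) ?_, K.liftCycles_i _ _ _ _⟩
  dsimp at hk
  rw [← K.toCycles_i s (s + 1), ← toBoundaries_ι, Category.assoc, reassoc_of% hk, zero_comp]

end CochainComplex

open CochainComplex in
/-- Every complex maps to a complex such that the induced maps in cohomology are special
preenvelopes. -/
theorem AbelianCotorsion.IsCompleteHereditary.exists_complex_preenvelope [HasExt.{w} C]
    [EnoughInjectives C] {A B : ObjectProperty C} (h : IsCompleteHereditary A B)
    (K : CochainComplex C ℤ) : ∃ (L : CochainComplex C ℤ) (f : K ⟶ L),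
      ∀ s, B (L.homology s) ∧ Mono (HomologicalComplex.homologyMap f s) ∧
        A (cokernel (HomologicalComplex.homologyMap f s)) := by
  choose CB AB iB pB wB hCB hAB hB using fun s =>
    h.exists_preenvelope (kernel (K.homologyπ s))
  choose CH AH iH pH wH hCH hAH hH using fun s => h.exists_preenvelope (K.homology s)
  choose CZ bZ πZ iZ wZ hZ hZ₁ hZ₂ using fun s =>
    h.exists_horseshoe (K.shortExact_boundaries_cycles s) (iB s) (hCB s) (iH s) (pH s) (wH s)
      (hH s) (hAH s)
  have hCZ s : B (CZ s) := h.extension_mem_right (hZ s) (hCB s) (hCH s)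
  -- The preenvelope of the boundaries in degree `s + 1` is the one already used for the cycles in
  -- that degree. This common choice lets the two families of horseshoes be spliced.
  choose Y ι q f wY hY hY₁ hY₂ using fun s =>
    h.exists_horseshoe (K.shortExact_cycles_boundaries s) (iZ s) (hCZ s) (iB (s + 1)) (pB (s + 1))
      (wB (s + 1)) (hB (s + 1)) (hAB (s + 1))
  dsimp at hZ₁ hZ₂ hY₁ hY₂
  -- The differential runs through the enlarged boundaries and the enlarged cycles of the next
  -- degree, so the cohomology of `L` is the family `CH` of preenvelopes of the cohomology of `K`.
  let d (s : ℤ) : Y s ⟶ Y (s + 1) := q s ≫ bZ (s + 1) ≫ ι (s + 1)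
  have hd (s : ℤ) : d s ≫ d (s + 1) = 0 := by simp [d, reassoc_of% (wY (s + 1))]
  let L : CochainComplex C ℤ := CochainComplex.of Y d hd
  have hLd (s : ℤ) : L.d s (s + 1) = d s := CochainComplex.of_d ..
  let F : K ⟶ L :=
    { f := f
      comm' := by
        rintro i j (rfl : i + 1 = j)
        rw [hLd, ← K.toCycles_i i (i + 1), ← toBoundaries_ι, Category.assoc, Category.assoc,
          hY₁, reassoc_of% (hZ₁ (i + 1)), reassoc_of% (hY₂ i)] }
  refine ⟨L, F, fun s => ?_⟩
  obtain ⟨s, rfl⟩ : ∃ t, s = t + 1 := ⟨s - 1, by simp⟩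
  have (s : ℤ) : Mono (ι s) := (hY s).mono_f
  have (s : ℤ) : Epi (q s) := (hY s).epi_g
  have (s : ℤ) : Mono (bZ s) := (hZ s).mono_f
  have w' : ι (s + 1) ≫ L.d (s + 1) (s + 1 + 1) = 0 := by
    rw [hLd]
    simp [d, reassoc_of% (wY (s + 1))]
  have hι : (ShortComplex.mk (ι (s + 1)) (L.d (s + 1) (s + 1 + 1)) w').Exact := by
    let φ : ShortComplex.mk (ι (s + 1)) (q (s + 1)) (wY (s + 1)) ⟶
        ShortComplex.mk (ι (s + 1)) (L.d (s + 1) (s + 1 + 1)) w' :=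
      { τ₁ := 𝟙 _, τ₂ := 𝟙 _, τ₃ := bZ _ ≫ ι _, comm₂₃ := by simp [hLd, d] }
    have : Mono φ.τ₃ := mono_comp _ _
    exact (ShortComplex.exact_iff_of_epi_of_isIso_of_mono φ).1 (hY _).exact
  obtain ⟨c, e, hc, he⟩ := L.exists_homologyIso rfl rfl (q s) (hZ (s + 1)) (ι (s + 1))
    (hLd s) hι
  have key : HomologicalComplex.homologyMap F (s + 1) ≫ e.hom = iH (s + 1) := by
    have h₁ : HomologicalComplex.cyclesMap F (s + 1) ≫ c.hom = iZ (s + 1) := by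
      rw [← cancel_mono (ι (s + 1)), Category.assoc, hc, ← hY₁, HomologicalComplex.cyclesMap_i]
    rw [← cancel_epi (K.homologyπ (s + 1)), HomologicalComplex.homologyπ_naturality_assoc, he,
      reassoc_of% h₁, hZ₂]
  have key' : HomologicalComplex.homologyMap F (s + 1) = iH (s + 1) ≫ e.inv := by
    rw [← key, Category.assoc, e.hom_inv_id, Category.comp_id]
  have := h.isClosedUnderIsomorphisms_left
  have := h.isClosedUnderIsomorphisms_right
  have : Mono (iH (s + 1)) := (hH (s + 1)).mono_f
  have : Epi (pH (s + 1)) := (hH (s + 1)).epi_g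
  refine ⟨B.prop_of_iso e.symm (hCH _), ?_, ?_⟩
  · rw [key']
    infer_instance
  · refine A.prop_of_iso ?_ (hAH (s + 1))
    exact (IsColimit.coconePointUniqueUpToIso (hH (s + 1)).gIsCokernel (colimit.isColimit _)) ≪≫
      (cokernelCompIsIso (iH (s + 1)) e.inv).symm ≪≫ cokernelIsoOfEq key'.symm

end Horseshoe

/-! ### Classes of objects of `D(R)` defined by cohomology -/

section CokernelMap

variable {R : Type u} [Ring R]

/-- The part of the snake lemma in which the kernel and cokernel of `φ.τ₃` vanish. -/
theorem isIso_cokernelMap_of_shortExact {S₁ S₂ : ShortComplex (ModuleCat.{u} R)} (φ : S₁ ⟶ S₂)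
    (h₁ : S₁.ShortExact) (h₂ : S₂.ShortExact) [IsIso φ.τ₃] :
    IsIso (cokernel.map φ.τ₁ φ.τ₂ S₁.f S₂.f φ.comm₁₂) := by
  have := h₁.epi_g
  have := h₂.epi_g
  have := h₂.mono_f
  have hmono : Mono (cokernel.map φ.τ₁ φ.τ₂ S₁.f S₂.f φ.comm₁₂) := by
    rw [ModuleCat.mono_iff_injective, injective_iff_map_eq_zero]
    intro x hx
    obtain ⟨y, rfl⟩ := (ModuleCat.epi_iff_surjective (cokernel.π φ.τ₁)).1 inferInstance x
    rw [← ConcreteCategory.comp_apply, cokernel.π_desc, ConcreteCategory.comp_apply] at hx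
    obtain ⟨p, hp⟩ := (ShortComplex.moduleCat_exact_iff _).1
      (ShortComplex.exact_cokernel φ.τ₂) _ hx
    dsimp at hp
    have hp' : S₁.g p = 0 := by
      apply (ModuleCat.mono_iff_injective φ.τ₃).1 inferInstance
      rw [← ConcreteCategory.comp_apply, ← φ.comm₂₃, ConcreteCategory.comp_apply, hp,
        ← ConcreteCategory.comp_apply, S₂.zero, map_zero]
      rfl
    obtain ⟨k, rfl⟩ := (ShortComplex.moduleCat_exact_iff _).1 h₁.exact p hp'
    have : y = φ.τ₁ k := by
      apply (ModuleCat.mono_iff_injective S₂.f).1 inferInstance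
      rw [← hp, ← ConcreteCategory.comp_apply, ← ConcreteCategory.comp_apply, φ.comm₁₂]
    rw [this, ← ConcreteCategory.comp_apply, cokernel.condition]
    rfl
  have hepi : Epi (cokernel.map φ.τ₁ φ.τ₂ S₁.f S₂.f φ.comm₁₂) := by
    refine Preadditive.epi_of_cancel_zero _ fun g hg => ?_
    have h0 : S₂.f ≫ cokernel.π φ.τ₂ ≫ g = 0 := by
      rw [← comp_zero (f := cokernel.π φ.τ₁), ← hg]
      simp
    obtain ⟨k, hk⟩ : ∃ k, S₂.g ≫ k = cokernel.π φ.τ₂ ≫ g :=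
      ⟨h₂.exact.desc _ h0, h₂.exact.g_desc _ h0⟩
    have hk' : S₁.g ≫ φ.τ₃ ≫ k = 0 := by
      rw [← φ.comm₂₃_assoc, hk, cokernel.condition_assoc, zero_comp]
    have hk₀ : k = 0 := by
      rwa [← comp_zero (f := S₁.g), cancel_epi, ← comp_zero (f := φ.τ₃), cancel_epi] at hk'
    rw [← cancel_epi (cokernel.π φ.τ₂), ← hk, comp_zero, hk₀, comp_zero]
  exact isIso_of_mono_of_epi _

end CokernelMap

namespace DerivedMod

open DerivedCategory RelTriangulated

variable {R : Type u} [Ring R] [HasDerivedCategory.{w} (ModuleCat.{u} R)]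

/-- The `s`-th cohomology functor on `D(R)`. -/
local notation "H" => DerivedCategory.homologyFunctor (ModuleCat R)

/-- The objects of `D(R)` all of whose cohomology modules lie in `S`. -/
def cohLift (S : ObjectProperty (ModuleCat.{u} R)) :
    ObjectProperty (DerivedCategory (ModuleCat.{u} R)) :=
  fun X => ∀ s, S ((H s).obj X)

/-- The cohomology in degree `s` of a module placed in degree `s`. -/
def homologySingleIso (M : ModuleCat.{u} R) (s : ℤ) :
    (H s).obj ((singleFunctor (ModuleCat.{u} R) s).obj M) ≅ M :=
  homologyQIso ((HomologicalComplex.single _ _ s).obj M) s ≪≫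
    (HomologicalComplex.homologyFunctorSingleIso _ (ComplexShape.up ℤ) s).app M

theorem homologySingleIso_hom_naturality {M N : ModuleCat.{u} R} (f : M ⟶ N) (s : ℤ) :
    (H s).map ((singleFunctor (ModuleCat.{u} R) s).map f) ≫ (homologySingleIso N s).hom =
      (homologySingleIso M s).hom ≫ f := by
  have key {K L : CochainComplex (ModuleCat.{u} R) ℤ} (g : K ⟶ L) (a : K.homology s ⟶ M)
      (b : L.homology s ⟶ N) (h : HomologicalComplex.homologyMap g s ≫ b = a ≫ f) :
      (H s).map (Q.map g) ≫ (homologyQIso L s).hom ≫ b = ((homologyQIso K s).hom ≫ a) ≫ f := by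
    rw [Category.assoc, ← h, ← Category.assoc, homologyQIso_hom_naturality, Category.assoc]
  exact key ((HomologicalComplex.single _ (ComplexShape.up ℤ) s).map f) _ _
    ((HomologicalComplex.homologyFunctorSingleIso _ (ComplexShape.up ℤ) s).hom.naturality f)

theorem isZero_homology_single (M : ModuleCat.{u} R) {s j : ℤ} (h : j ≠ s) :
    IsZero ((H j).obj ((singleFunctor (ModuleCat.{u} R) s).obj M)) :=
  (HomologicalComplex.isZero_single_obj_homology (ComplexShape.up ℤ) s M j h).of_iso
    (homologyQIso ((HomologicalComplex.single _ _ s).obj M) j)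

theorem cohLift_single_iff {S : ObjectProperty (ModuleCat.{u} R)} [S.IsClosedUnderIsomorphisms]
    (h0 : ∀ M : ModuleCat.{u} R, IsZero M → S M) (M : ModuleCat.{u} R) (s : ℤ) :
    cohLift S ((singleFunctor (ModuleCat.{u} R) s).obj M) ↔ S M := by
  refine ⟨fun h => S.prop_of_iso (homologySingleIso M s) (h s), fun h j => ?_⟩
  by_cases hj : j = s
  · subst hj
    exact S.prop_of_iso (homologySingleIso M j).symm h
  · exact h0 _ (isZero_homology_single M hj)

/-- Since the complex-level map is mono in cohomology, its triangle lies in `ξ`, and the cohomology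
of the cone is the cokernel in cohomology, already known to lie in `A`. -/
theorem exists_preenvelope_cohLift {A B : ObjectProperty (ModuleCat.{u} R)}
    (h : AbelianCotorsion.IsCompleteHereditary A B) (X : DerivedCategory (ModuleCat.{u} R)) :
    ∃ (Y Z : DerivedCategory (ModuleCat.{u} R)) (f : X ⟶ Y) (g : Y ⟶ Z) (k : Z ⟶ X⟦(1 : ℤ)⟧),
      cohLift B Y ∧ cohLift A Z ∧ Triangle.mk f g k ∈ xi R := by
  have := h.isClosedUnderIsomorphisms_left
  have := h.isClosedUnderIsomorphisms_right
  obtain ⟨K, ⟨e⟩⟩ : ∃ K, Nonempty (Q.obj K ≅ X) := ⟨_, ⟨Q.objObjPreimageIso X⟩⟩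
  obtain ⟨L, f, hf⟩ := h.exists_complex_preenvelope K
  obtain ⟨Z, g, k, hT⟩ := distinguished_cocone_triangle (e.inv ≫ Q.map f)
  have hmap (s : ℤ) : (H s).map (e.inv ≫ Q.map f) = ((H s).map e.inv ≫ (homologyQIso K s).hom) ≫
      HomologicalComplex.homologyMap f s ≫ (homologyQIso L s).inv := by
    rw [Category.assoc, ← Category.assoc (homologyQIso K s).hom, ← homologyQIso_hom_naturality]
    simp
  have hmem : Triangle.mk (e.inv ≫ Q.map f) g k ∈ xi R := by
    refine mem_xi_of_mono hT fun s => ?_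
    change Mono ((H s).map (e.inv ≫ Q.map f))
    have := (hf s).2.1
    rw [hmap]
    infer_instance
  refine ⟨Q.obj L, Z, _, g, k, fun s => ?_, fun s => ?_, hmem⟩
  · exact B.prop_of_iso (homologyQIso L s).symm (hf s).1
  · obtain ⟨w, hw⟩ := shortExact_homology_of_mk_mem_xi hmem s
    have := hw.epi_g
    refine A.prop_of_iso ?_ (hf s).2.2
    exact (cokernelCompIsIso _ _).symm ≪≫ (cokernelEpiComp _ _).symm ≪≫
      cokernelIsoOfEq (hmap s).symm ≪≫
      IsColimit.coconePointUniqueUpToIso (colimit.isColimit _) hw.gIsCokernel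

/-- Salce's trick: cover `X` by a `ξ`-projective `P` with kernel `K`, take a preenvelope `Y` of `K`,
and push the triangle out along `K ⟶ Y`. The cohomology of the new middle term is an extension of a
module in `A` by a projective. -/
theorem exists_precover_cohLift {A B : ObjectProperty (ModuleCat.{u} R)}
    (h : AbelianCotorsion.IsCompleteHereditary A B) (X : DerivedCategory (ModuleCat.{u} R)) :
    ∃ (Y W : DerivedCategory (ModuleCat.{u} R)) (f : Y ⟶ W) (g : W ⟶ X) (k : X ⟶ Y⟦(1 : ℤ)⟧),
      cohLift B Y ∧ cohLift A W ∧ Triangle.mk f g k ∈ xi R := by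
  have := h.isClosedUnderIsomorphisms_left
  obtain ⟨K, P, i, p, δ, hP, hT⟩ := exists_xi_cover X
  obtain ⟨Y, Z, f, g, k, hY, hZ, hT'⟩ := exists_preenvelope_cohLift h K
  -- Pushing out along `f` amounts to composing the connecting morphism with the shift of `f`; `W`
  -- completes it to a triangle.
  obtain ⟨W, a, b, hW⟩ := distinguished_cocone_triangle₂ (δ ≫ f⟦(1 : ℤ)⟧')
  obtain ⟨t, ht₁, ht₂⟩ : ∃ t : P ⟶ W, i ≫ t = f ≫ a ∧ p ≫ 𝟙 X = t ≫ b :=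
    complete_distinguished_triangle_morphism₂ _ _ hT.1 hW f (𝟙 X) (Category.id_comp _).symm
  have hmem : Triangle.mk a b (δ ≫ f⟦(1 : ℤ)⟧') ∈ xi R := by
    refine (mem_xi_iff _).2 ⟨hW, fun s => ?_⟩
    have h₁ := ((mem_xi_iff _).1 hT).2 s
    have h₂ : (H s).map p = (H s).map t ≫ (H s).map b := by
      rw [← Functor.map_comp, ← ht₂, Category.comp_id]
    change Epi ((H s).map p) at h₁
    change Epi ((H s).map b)
    rw [h₂] at h₁
    exact epi_of_epi ((H s).map t) _
  refine ⟨Y, W, a, b, _, hY, fun s => ?_, hmem⟩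
  obtain ⟨w₁, hS₁⟩ := shortExact_homology_of_mk_mem_xi hT s
  obtain ⟨w₂, hS₂⟩ := shortExact_homology_of_mk_mem_xi hmem s
  obtain ⟨w₃, hS₃⟩ := shortExact_homology_of_mk_mem_xi hT' s
  let φ : ShortComplex.mk _ _ w₁ ⟶ ShortComplex.mk _ _ w₂ :=
    { τ₁ := (H s).map f
      τ₂ := (H s).map t
      τ₃ := 𝟙 _
      comm₁₂ := by
        dsimp
        rw [← Functor.map_comp, ← Functor.map_comp, ht₁]
      comm₂₃ := by
        dsimp
        rw [← Functor.map_comp, ← ht₂, Category.comp_id, Category.comp_id] }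
  have : IsIso φ.τ₃ := inferInstanceAs (IsIso (𝟙 _))
  have : Mono φ.τ₁ := hS₃.mono_f
  have : Mono φ.τ₂ := by
    have := hS₁.mono_f
    have := hS₂.mono_f
    have : Mono φ.τ₃ := inferInstance
    exact ShortComplex.mono_τ₂_of_exact_of_mono φ hS₁.exact
  have := isIso_cokernelMap_of_shortExact φ hS₁ hS₂
  have : Epi ((H s).map g) := hS₃.epi_g
  have hcok : A (cokernel φ.τ₂) :=
    A.prop_of_iso (IsColimit.coconePointUniqueUpToIso hS₃.gIsCokernel (colimit.isColimit _) ≪≫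
      asIso (cokernel.map φ.τ₁ φ.τ₂ _ _ φ.comm₁₂)) (hZ s)
  have := hP.projective s
  exact h.extension_mem_left (S := ShortComplex.mk φ.τ₂ (cokernel.π φ.τ₂) (by simp))
    (.mk (ShortComplex.exact_cokernel _)) (h.mem_left_of_projective ((H s).obj P)) hcok

theorem isCompleteHereditary_cohLift {A B : ObjectProperty (ModuleCat.{u} R)}
    (h : AbelianCotorsion.IsCompleteHereditary A B) :
    RelTriangulated.IsCompleteHereditary (xi R) (cohLift A) (cohLift B) where
  right_eq := by
    have := h.isClosedUnderIsomorphisms_left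
    ext U
    refine ⟨fun hU s => ?_, fun hU X hX =>
      (xiExtOneVanishes_iff X U).2 fun s => h.subsingleton_ext (hX s) (hU s)⟩
    rw [← h.right_eq]
    intro M hM
    have := (xiExtOneVanishes_iff _ U).1 (hU _ ((cohLift_single_iff (fun N hN => by
      have := hN.projective
      exact h.mem_left_of_projective N) M s).2 hM)) s
    exact AbelianCotorsion.subsingleton_ext_of_iso (homologySingleIso M s) (Iso.refl _)
  left_eq := by
    have := h.isClosedUnderIsomorphisms_right
    ext V
    refine ⟨fun hV s => ?_, fun hV Y hY =>
      (xiExtOneVanishes_iff V Y).2 fun s => h.subsingleton_ext (hV s) (hY s)⟩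
    rw [← h.left_eq]
    intro M hM
    have := (xiExtOneVanishes_iff V _).1 (hV _ ((cohLift_single_iff (fun N hN => by
      have := hN.injective
      exact h.mem_right_of_injective N) M s).2 hM)) s
    exact AbelianCotorsion.subsingleton_ext_of_iso (Iso.refl _) (homologySingleIso M s)
  exists_precover := exists_precover_cohLift h
  exists_preenvelope := exists_preenvelope_cohLift h
  left_mem _ hΔ h₂ h₃ s := h.kernel_mem _ (shortExact_homology_of_mem_xi hΔ s) (h₂ s) (h₃ s)
  right_mem _ hΔ h₁ h₂ s := h.cokernel_mem _ (shortExact_homology_of_mem_xi hΔ s) (h₁ s) (h₂ s)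

theorem singleTriangle_mem_xi {S : ShortComplex (ModuleCat.{u} R)} (hS : S.ShortExact) :
    hS.singleTriangle ∈ xi R := by
  refine (mem_xi_iff _).2 ⟨hS.singleTriangle_distinguished, fun s => ?_⟩
  change Epi ((H s).map ((singleFunctor (ModuleCat.{u} R) 0).map S.g))
  by_cases hs : s = 0
  · subst hs
    have := hS.epi_g
    have h : (H 0).map ((singleFunctor (ModuleCat.{u} R) 0).map S.g) =
        (homologySingleIso S.X₂ 0).hom ≫ S.g ≫ (homologySingleIso S.X₃ 0).inv := by
      rw [← Category.assoc, ← homologySingleIso_hom_naturality, Category.assoc, Iso.hom_inv_id,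
        Category.comp_id]
    rw [h]
    infer_instance
  · exact (isZero_homology_single S.X₃ hs).epi _

/-- Restrict to stalks in degree zero and apply `H⁰` to the approximation triangles. The hypotheses
`hA` and `hB` account for the zero cohomology of a stalk in all other degrees. -/
theorem isCompleteHereditary_of_cohLift {A B : ObjectProperty (ModuleCat.{u} R)}
    [A.IsClosedUnderIsomorphisms] [B.IsClosedUnderIsomorphisms]
    (hA : ∀ M : ModuleCat.{u} R, IsZero M → A M) (hB : ∀ M : ModuleCat.{u} R, IsZero M → B M)
    (h : RelTriangulated.IsCompleteHereditary (xi R) (cohLift A) (cohLift B)) :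
    AbelianCotorsion.IsCompleteHereditary A B where
  right_eq := by
    ext M
    rw [← cohLift_single_iff hB M 0, ← h.right_eq]
    constructor
    · intro hM X hX
      refine (xiExtOneVanishes_iff _ _).2 fun s => ?_
      by_cases hs : s = 0
      · subst hs
        have := hM _ (hX 0)
        exact AbelianCotorsion.subsingleton_ext_of_iso (Iso.refl _) (homologySingleIso M 0).symm
      · have := (isZero_homology_single M hs).injective
        exact Abelian.Ext.subsingleton_of_injective _ _ 0
    · intro hM N hN
      have := (xiExtOneVanishes_iff _ _).1 (hM _ ((cohLift_single_iff hA N 0).2 hN)) 0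
      exact AbelianCotorsion.subsingleton_ext_of_iso (homologySingleIso N 0)
        (homologySingleIso M 0)
  left_eq := by
    ext M
    rw [← cohLift_single_iff hA M 0, ← h.left_eq]
    constructor
    · intro hM X hX
      refine (xiExtOneVanishes_iff _ _).2 fun s => ?_
      by_cases hs : s = 0
      · subst hs
        have := hM _ (hX 0)
        exact AbelianCotorsion.subsingleton_ext_of_iso (homologySingleIso M 0).symm (Iso.refl _)
      · have := (isZero_homology_single M hs).projective
        exact Abelian.Ext.subsingleton_of_projective _ _ 0
    · intro hM N hN
      have := (xiExtOneVanishes_iff _ _).1 (hM _ ((cohLift_single_iff hB N 0).2 hN)) 0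
      exact AbelianCotorsion.subsingleton_ext_of_iso (homologySingleIso M 0)
        (homologySingleIso N 0)
  exists_precover M := by
    obtain ⟨Y, X, f, g, k, hY, hX, hT⟩ :=
      h.exists_precover ((singleFunctor (ModuleCat.{u} R) 0).obj M)
    obtain ⟨w, hw⟩ := shortExact_homology_of_mk_mem_xi hT 0
    refine ⟨_, _, (H 0).map f, (H 0).map g ≫ (homologySingleIso M 0).hom,
      by rw [reassoc_of% w, zero_comp], hY 0, hX 0, ?_⟩
    refine ShortComplex.shortExact_of_iso ?_ hw
    exact ShortComplex.isoMk (Iso.refl _) (Iso.refl _) (homologySingleIso M 0)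
  exists_preenvelope M := by
    obtain ⟨Y, X, f, g, k, hY, hX, hT⟩ :=
      h.exists_preenvelope ((singleFunctor (ModuleCat.{u} R) 0).obj M)
    obtain ⟨w, hw⟩ := shortExact_homology_of_mk_mem_xi hT 0
    refine ⟨_, _, (homologySingleIso M 0).inv ≫ (H 0).map f, (H 0).map g,
      by rw [Category.assoc, w, comp_zero], hY 0, hX 0, ?_⟩
    refine ShortComplex.shortExact_of_iso ?_ hw
    exact ShortComplex.isoMk (homologySingleIso M 0) (Iso.refl _) (Iso.refl _)
  kernel_mem S hS h₂ h₃ := by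
    simp only [← cohLift_single_iff hA _ 0] at h₂ h₃ ⊢
    exact h.left_mem _ (singleTriangle_mem_xi hS) h₂ h₃
  cokernel_mem S hS h₁ h₂ := by
    simp only [← cohLift_single_iff hB _ 0] at h₁ h₂ ⊢
    exact h.right_mem _ (singleTriangle_mem_xi hS) h₁ h₂

end DerivedMod

/-! ### Splicing short exact sequences -/

namespace CochainComplex

open scoped ZeroObject

section Splice

variable {C : Type*} [Category* C] [Abelian C]

theorem exactAt_of_d_eq (K : CochainComplex C ℤ) {s : ℤ} {f : K.X s ⟶ K.X (s + 1)}
    {g : K.X (s + 1) ⟶ K.X (s + 1 + 1)} (hf : K.d s (s + 1) = f)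
    (hg : K.d (s + 1) (s + 1 + 1) = g) {w : f ≫ g = 0} (h : (ShortComplex.mk f g w).Exact) :
    K.ExactAt (s + 1) := by
  subst hf hg
  rw [HomologicalComplex.exactAt_iff' _ s (s + 1) (s + 1 + 1) (by simp) (by simp)]
  exact h

theorem exact_comp_of_shortExact {X₁ X₂ X₃ X₄ X₀ : C} {i : X₁ ⟶ X₂} {p : X₂ ⟶ X₃} {w : i ≫ p = 0}
    (hS : (ShortComplex.mk i p w).ShortExact) (e : X₀ ⟶ X₁) [Epi e] (m : X₃ ⟶ X₄) [Mono m]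
    {w' : (e ≫ i) ≫ p ≫ m = 0} : (ShortComplex.mk (e ≫ i) (p ≫ m) w').Exact := by
  have w₁ : (e ≫ i) ≫ p = 0 := by rw [Category.assoc, w, comp_zero]
  let φ : ShortComplex.mk (e ≫ i) p w₁ ⟶ ShortComplex.mk i p w :=
    { τ₁ := e, τ₂ := 𝟙 _, τ₃ := 𝟙 _ }
  let ψ : ShortComplex.mk (e ≫ i) p w₁ ⟶ ShortComplex.mk (e ≫ i) (p ≫ m) w' :=
    { τ₁ := 𝟙 _, τ₂ := 𝟙 _, τ₃ := m }
  exact (ShortComplex.exact_iff_of_epi_of_isIso_of_mono ψ).1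
    ((ShortComplex.exact_iff_of_epi_of_isIso_of_mono φ).2 hS.exact)

section Right

variable (M E : ℕ → C) (i : ∀ n, M n ⟶ E n) (p : ∀ n, E n ⟶ M (n + 1))
  (w : ∀ n, i n ≫ p n = 0)

/-- The terms of `rightSplice`. -/
def rightSpliceX : ℤ → C
  | .ofNat 0 => M 0
  | .ofNat (n + 1) => E n
  | .negSucc _ => 0

/-- The differentials of `rightSplice`. -/
def rightSpliceD : ∀ s : ℤ, rightSpliceX M E s ⟶ rightSpliceX M E (s + 1)
  | .ofNat 0 => i 0
  | .ofNat (n + 1) => p n ≫ i (n + 1)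
  | .negSucc _ => 0

/-- The complex `0 ⟶ M 0 ⟶ E 0 ⟶ E 1 ⟶ ⋯` with `M 0` in degree zero obtained by splicing
the sequences `0 ⟶ M n ⟶ E n ⟶ M (n + 1) ⟶ 0`. -/
def rightSplice : CochainComplex C ℤ :=
  CochainComplex.of (rightSpliceX M E) (rightSpliceD M E i p) (by
    rintro ((_ | n) | n)
    · change i 0 ≫ p 0 ≫ i 1 = 0
      rw [← Category.assoc, w, zero_comp]
    · change (p n ≫ i (n + 1)) ≫ p (n + 1) ≫ i (n + 1 + 1) = 0
      rw [Category.assoc, ← Category.assoc (i (n + 1)), w, zero_comp, comp_zero]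
    · exact zero_comp)

theorem rightSplice_d (s : ℤ) :
    (rightSplice M E i p w).d s (s + 1) = rightSpliceD M E i p s :=
  CochainComplex.of_d ..

theorem acyclic_rightSplice (hS : ∀ n, (ShortComplex.mk (i n) (p n) (w n)).ShortExact) :
    (rightSplice M E i p w).Acyclic := by
  have hi (n : ℕ) : Mono (i n) := (hS n).mono_f
  have hp (n : ℕ) : Epi (p n) := (hS n).epi_g
  have hd := rightSplice_d M E i p w
  rintro ((_ | _ | n) | n)
  · refine exactAt_of_d_eq _ (s := Int.negSucc 0) (hd _) (hd _) (w := zero_comp) ?_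
    exact (ShortComplex.exact_iff_mono (ShortComplex.mk (0 : (0 : C) ⟶ M 0) (i 0) zero_comp)
      rfl).2 (hi 0)
  · refine exactAt_of_d_eq _ (s := Int.ofNat 0) (hd _) (hd _)
      (w := by rw [← hd, ← hd, HomologicalComplex.d_comp_d]) ?_
    have := exact_comp_of_shortExact (hS 0) (𝟙 _) (i 1)
      (w' := by rw [Category.assoc, ← Category.assoc (i 0), w, zero_comp, comp_zero])
    simp only [Category.id_comp] at this
    exact this
  · refine exactAt_of_d_eq _ (s := Int.ofNat (n + 1)) (hd _) (hd _)
      (w := by rw [← hd, ← hd, HomologicalComplex.d_comp_d]) ?_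
    exact exact_comp_of_shortExact (hS (n + 1)) (p n) (i (n + 2))
      (w' := by rw [Category.assoc, ← Category.assoc (i (n + 1)), w, zero_comp, comp_zero])
  · exact ShortComplex.exact_of_isZero_X₂ _ (isZero_zero C)

variable {M E i p w} in
-- Degree `n + 1` of the splice is `E n`, hence the index of `h n`. The splice vanishes in negative
-- degrees, and `h₀` is the one compatibility left at that edge.
theorem exists_hom_rightSplice {P : CochainComplex C ℤ} (φ : ∀ n : ℕ, P.X n ⟶ M n)
    (h : ∀ n : ℕ, P.X (n + 1) ⟶ E n) (h₀ : P.d (-1) 0 ≫ φ 0 = 0)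
    (h₁ : ∀ n : ℕ, P.d n (n + 1) ≫ h n = φ n ≫ i n)
    (h₂ : ∀ n : ℕ, h n ≫ p n = φ (n + 1)) :
    ∃ f : P ⟶ rightSplice M E i p w, f.f 0 = φ 0 := by
  refine ⟨{
    f := fun
      | .ofNat 0 => φ 0
      | .ofNat (n + 1) => h n
      | .negSucc _ => 0
    comm' := ?_ }, rfl⟩
  rintro s _ rfl
  rw [rightSplice_d]
  obtain ((_ | n) | (_ | n)) := s
  · exact (h₁ 0).symm
  · change h n ≫ p n ≫ i (n + 1) = P.d (n + 1 : ℕ) ((n + 1 : ℕ) + 1) ≫ h (n + 1)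
    rw [h₁, ← Category.assoc, h₂]
  · exact zero_comp.trans h₀.symm
  · exact zero_comp.trans comp_zero.symm

end Right

section Left

variable (M L : ℕ → C) (i : ∀ n, M (n + 1) ⟶ L n) (p : ∀ n, L n ⟶ M n)
  (w : ∀ n, i n ≫ p n = 0)

/-- The terms of `leftSplice`. -/
def leftSpliceX : ℤ → C
  | .ofNat 0 => M 0
  | .ofNat (_ + 1) => 0
  | .negSucc n => L n

/-- The differentials of `leftSplice`. -/
def leftSpliceD : ∀ s : ℤ, leftSpliceX M L s ⟶ leftSpliceX M L (s + 1)
  | .ofNat _ => 0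
  | .negSucc 0 => p 0
  | .negSucc (n + 1) => p (n + 1) ≫ i n

/-- The complex `⋯ ⟶ L 1 ⟶ L 0 ⟶ M 0 ⟶ 0` with `M 0` in degree zero obtained by splicing
the sequences `0 ⟶ M (n + 1) ⟶ L n ⟶ M n ⟶ 0`. -/
def leftSplice : CochainComplex C ℤ :=
  CochainComplex.of (leftSpliceX M L) (leftSpliceD M L i p) (by
    rintro (n | _ | _ | n)
    · exact zero_comp
    · exact comp_zero
    · change (p 1 ≫ i 0) ≫ p 0 = 0
      rw [Category.assoc, w, comp_zero]
    · change (p (n + 2) ≫ i (n + 1)) ≫ p (n + 1) ≫ i n = 0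
      rw [Category.assoc, ← Category.assoc (i (n + 1)), w, zero_comp, comp_zero])

theorem leftSplice_d (s : ℤ) :
    (leftSplice M L i p w).d s (s + 1) = leftSpliceD M L i p s :=
  CochainComplex.of_d ..

theorem acyclic_leftSplice (hS : ∀ n, (ShortComplex.mk (i n) (p n) (w n)).ShortExact) :
    (leftSplice M L i p w).Acyclic := by
  have hi (n : ℕ) : Mono (i n) := (hS n).mono_f
  have hp (n : ℕ) : Epi (p n) := (hS n).epi_g
  have hd := leftSplice_d M L i p w
  rintro ((_ | n) | (_ | n))
  · refine exactAt_of_d_eq _ (s := Int.negSucc 0) (hd _) (hd _) (w := comp_zero) ?_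
    exact (ShortComplex.exact_iff_epi (ShortComplex.mk (p 0) (0 : M 0 ⟶ (0 : C)) comp_zero)
      rfl).2 (hp 0)
  · exact ShortComplex.exact_of_isZero_X₂ _ (isZero_zero C)
  · refine exactAt_of_d_eq _ (s := Int.negSucc 1) (hd _) (hd _)
      (w := by rw [← hd, ← hd, HomologicalComplex.d_comp_d]) ?_
    have := exact_comp_of_shortExact (hS 0) (p 1) (𝟙 _)
      (w' := by rw [Category.assoc, ← Category.assoc (i 0), w, zero_comp, comp_zero])
    simp only [Category.comp_id] at this
    exact this
  · refine exactAt_of_d_eq _ (s := Int.negSucc (n + 2)) (hd _) (hd _)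
      (w := by rw [← hd, ← hd, HomologicalComplex.d_comp_d]) ?_
    exact exact_comp_of_shortExact (hS (n + 1)) (p (n + 2)) (i n)
      (w' := by rw [Category.assoc, ← Category.assoc (i (n + 1)), w, zero_comp, comp_zero])

variable {M L i p w} in
theorem exists_hom_leftSplice {I : CochainComplex C ℤ} (φ : ∀ n : ℕ, M n ⟶ I.X (-n))
    (h : ∀ n : ℕ, L n ⟶ I.X (-(n + 1 : ℕ))) (h₀ : φ 0 ≫ I.d 0 1 = 0)
    (h₁ : ∀ n : ℕ, h n ≫ I.d (-(n + 1 : ℕ)) (-n) = p n ≫ φ n)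
    (h₂ : ∀ n : ℕ, i n ≫ h n = φ (n + 1)) :
    ∃ f : leftSplice M L i p w ⟶ I, f.f 0 = φ 0 := by
  refine ⟨{
    f := fun
      | .ofNat 0 => φ 0
      | .ofNat (_ + 1) => 0
      | .negSucc n => h n
    comm' := ?_ }, rfl⟩
  rintro s _ rfl
  rw [leftSplice_d]
  obtain ((_ | n) | (_ | n)) := s
  · exact h₀.trans zero_comp.symm
  · exact zero_comp.trans comp_zero.symm
  · exact h₁ 0
  · change h (n + 1) ≫ I.d (-(n + 1 + 1 : ℕ)) (-(n + 1 : ℕ)) = (p (n + 1) ≫ i n) ≫ h n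
    rw [h₁, Category.assoc, h₂]

end Left

end Splice

end CochainComplex

/-! ### Semi-projective and semi-injective complexes with prescribed cohomology -/

section Factorization

open CochainComplex

variable {C : Type*} [Category* C] [Abelian C] [HasExt.{w} C]

namespace AbelianCotorsion.IsCompleteHereditary

variable {A B : ObjectProperty C} (h : IsCompleteHereditary A B)

include h

/-- As `φ` kills cycles, it is a map on the boundaries of degree `s'`, and injectivity extends it to
`k₀` on the whole term. The failure of `k₀` to send cycles into `M` is a map from cohomology to the
cosyzygy of `M`. It lifts to the injective since `Ext¹` of the cohomology into `M` vanishes, and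
subtracting an extension `k₁` of that lift repairs `k₀` without changing it on boundaries. -/
theorem exists_extension_step [EnoughInjectives C] {P : CochainComplex C ℤ}
    (hP : ∀ s, A (P.homology s)) {s s' : ℤ} (hs : s + 1 = s') {M : C} (hM : B M)
    (φ : P.X s ⟶ M) (hφ : P.iCycles s ≫ φ = 0) :
    ∃ k : P.X s' ⟶ Injective.under M, P.d s s' ≫ k = φ ≫ Injective.ι M ∧
      P.iCycles s' ≫ k ≫ cokernel.π (Injective.ι M) = 0 := by
  subst hs
  have hS := P.shortExact_cycles_boundaries s
  have : Epi (toBoundaries P s) := hS.epi_g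
  obtain ⟨φ', hφ'⟩ : ∃ φ', toBoundaries P s ≫ φ' = φ :=
    ⟨hS.exact.desc _ hφ, hS.exact.g_desc _ hφ⟩
  have hd : P.d s (s + 1) = toBoundaries P s ≫ kernel.ι (P.homologyπ (s + 1)) ≫
      P.iCycles (s + 1) := by
    rw [← Category.assoc, toBoundaries_ι, P.toCycles_i]
  obtain ⟨k₀, hk₀⟩ : ∃ k₀ : P.X (s + 1) ⟶ Injective.under M,
      (kernel.ι (P.homologyπ (s + 1)) ≫ P.iCycles (s + 1)) ≫ k₀ = φ' ≫ Injective.ι M :=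
    ⟨Injective.factorThru _ _, Injective.comp_factorThru _ _⟩
  rw [Category.assoc] at hk₀
  have hT : (ShortComplex.mk (Injective.ι M) (cokernel.π (Injective.ι M))
    (cokernel.condition _)).ShortExact := .mk (ShortComplex.exact_cokernel _)
  have hχ₀ : kernel.ι (P.homologyπ (s + 1)) ≫ P.iCycles (s + 1) ≫ k₀ ≫
      cokernel.π (Injective.ι M) = 0 := by
    rw [reassoc_of% hk₀, cokernel.condition, comp_zero]
  have hS' := P.shortExact_boundaries_cycles (s + 1)
  obtain ⟨χ, hχ⟩ : ∃ χ, P.homologyπ (s + 1) ≫ χ = P.iCycles (s + 1) ≫ k₀ ≫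
      cokernel.π (Injective.ι M) := ⟨hS'.exact.desc _ hχ₀, hS'.exact.g_desc _ hχ₀⟩
  have := h.subsingleton_ext (hP (s + 1)) hM
  obtain ⟨χ', hχ'⟩ : ∃ χ', χ' ≫ cokernel.π (Injective.ι M) = χ :=
    exists_lift_of_subsingleton_ext hT χ
  obtain ⟨k₁, hk₁⟩ : ∃ k₁ : P.X (s + 1) ⟶ Injective.under M,
      P.iCycles (s + 1) ≫ k₁ = P.homologyπ (s + 1) ≫ χ' :=
    ⟨Injective.factorThru _ _, Injective.comp_factorThru _ _⟩
  refine ⟨k₀ - k₁, ?_, ?_⟩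
  · rw [Preadditive.comp_sub, hd, Category.assoc, Category.assoc, Category.assoc, Category.assoc,
      hk₀, hk₁, kernel.condition_assoc, zero_comp, comp_zero, sub_zero, ← Category.assoc, hφ']
  · rw [Preadditive.sub_comp, Preadditive.comp_sub, ← hχ, ← Category.assoc _ k₁, hk₁,
      Category.assoc, hχ', sub_self]

/-- Iterating the extension step maps `P` to the acyclic complex formed by `Y` and an injective
resolution of it; heredity keeps every cosyzygy in `B`. K-projectivity makes this map
null-homotopic, and the degree-zero component of the homotopy is the factorization. -/
theorem exists_factorization_zero [EnoughInjectives C] {P : CochainComplex C ℤ}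
    [P.IsKProjective] (hP : ∀ s, A (P.homology s)) {Y : C} (hY : B Y) (g : P.X 0 ⟶ Y)
    (hg : P.iCycles 0 ≫ g = 0) : ∃ ψ : P.X 1 ⟶ Y, P.d 0 1 ≫ ψ = g := by
  let Stage (n : ℕ) := { x : Σ M : C, (P.X n ⟶ M) // B x.1 ∧ P.iCycles n ≫ x.2 = 0 }
  have step (n : ℕ) (x : Stage n) := h.exists_extension_step hP (s := n) (s' := (n + 1 : ℕ))
    (by simp) x.2.1 x.1.2 x.2.2
  choose k hk₁ hk₂ using step
  let next (n : ℕ) (x : Stage n) : Stage (n + 1) :=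
    ⟨⟨cokernel (Injective.ι x.1.1), k n x ≫ cokernel.π _⟩,
      h.cokernel_mem (ShortComplex.mk (Injective.ι x.1.1) (cokernel.π _) (cokernel.condition _))
        (.mk (ShortComplex.exact_cokernel _)) x.2.1 (h.mem_right_of_injective _), hk₂ n x⟩
  let stage (n : ℕ) : Stage n := Nat.rec ⟨⟨Y, g⟩, hY, hg⟩ next n
  let M (n : ℕ) : C := (stage n).1.1
  let E (n : ℕ) : C := Injective.under (M n)
  let i (n : ℕ) : M n ⟶ E n := Injective.ι (M n)
  let p (n : ℕ) : E n ⟶ M (n + 1) := cokernel.π (i n)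
  have w (n : ℕ) : i n ≫ p n = 0 := cokernel.condition _
  have hS (n : ℕ) : (ShortComplex.mk (i n) (p n) (w n)).ShortExact :=
    .mk (ShortComplex.exact_cokernel _)
  obtain ⟨f, hf⟩ := exists_hom_rightSplice (P := P) (M := M) (E := E) (i := i) (p := p) (w := w)
    (fun n => (stage n).1.2) (fun n => k n (stage n))
    (by
      change P.d (-1) 0 ≫ g = 0
      rw [← P.toCycles_i (-1) 0, Category.assoc, hg, comp_zero])
    (fun n => hk₁ n (stage n)) (fun n => rfl)
  let H := IsKProjective.homotopyZero f (acyclic_rightSplice M E i p w hS)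
  have hH := H.comm 0
  rw [dNext_eq H.hom (show (ComplexShape.up ℤ).Rel 0 1 by simp),
    prevD_eq H.hom (show (ComplexShape.up ℤ).Rel (-1) 0 by simp), HomologicalComplex.zero_f,
    add_zero] at hH
  -- The splice is zero in degree `-1`, so only the term through `P.d 0 1` survives.
  have hz : H.hom 0 (-1) = 0 := (isZero_zero C).eq_of_tgt _ _
  rw [hz, zero_comp, add_zero] at hH
  exact ⟨H.hom 1 0, hH.symm.trans hf⟩

end AbelianCotorsion.IsCompleteHereditary

end Factorization

/-! ### The dual factorization -/

namespace CochainComplex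

variable {C : Type*} [Category* C] [Abelian C]

/-- The sequence `0 → Hˢ → Kˢ / Bˢ → Bˢ⁺¹ → 0`. -/
theorem shortExact_homology_opcycles (K : CochainComplex C ℤ) (s : ℤ) :
    (ShortComplex.mk (K.homologyι s) (cokernel.π (K.homologyι s)) (by simp)).ShortExact :=
  .mk (ShortComplex.exact_cokernel _)

/-- The inclusion of the boundaries of degree `s + 1`, as a quotient of the `s`-th term. -/
def fromCoboundaries (K : CochainComplex C ℤ) (s : ℤ) :
    cokernel (K.homologyι s) ⟶ K.X (s + 1) :=
  cokernel.desc _ (K.fromOpcycles s (s + 1)) (by simp)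

@[simp]
theorem π_fromCoboundaries (K : CochainComplex C ℤ) (s : ℤ) :
    cokernel.π (K.homologyι s) ≫ fromCoboundaries K s = K.fromOpcycles s (s + 1) :=
  cokernel.π_desc _ _ _

theorem fromCoboundaries_pOpcycles (K : CochainComplex C ℤ) (s : ℤ) :
    fromCoboundaries K s ≫ K.pOpcycles (s + 1) = 0 := by
  rw [← cancel_epi (cokernel.π (K.homologyι s)), ← cancel_epi (K.pOpcycles s), ← Category.assoc
    (cokernel.π _), π_fromCoboundaries]
  simp

/-- The sequence `0 → Bˢ⁺¹ → Kˢ⁺¹ → Kˢ⁺¹ / Bˢ⁺¹ → 0`. -/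
theorem shortExact_coboundaries_opcycles (K : CochainComplex C ℤ) (s : ℤ) :
    (ShortComplex.mk (fromCoboundaries K s) (K.pOpcycles (s + 1))
      (fromCoboundaries_pOpcycles K s)).ShortExact := by
  have hK : (ShortComplex.mk (K.homologyι s) (K.fromOpcycles s (s + 1)) (by simp)).Exact :=
    ShortComplex.exact_of_f_is_kernel _
      (K.homologyIsKernel s (s + 1) ((ComplexShape.up ℤ).next_eq' rfl))
  have : Mono (fromCoboundaries K s) := hK.mono_cokernelDesc
  refine .mk (ShortComplex.exact_of_g_is_cokernel _ ?_)
  refine CokernelCofork.IsColimit.ofπ' _ _ fun {Z} k hk =>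
    ⟨K.descOpcycles k s (by simp) ?_, K.p_descOpcycles _ _ _ _⟩
  dsimp at hk
  rw [← K.p_fromOpcycles s (s + 1), ← π_fromCoboundaries, Category.assoc, Category.assoc, hk,
    comp_zero, comp_zero]

theorem exists_shift_iso (K : CochainComplex C ℤ) (t i j : ℤ) {i' j' : ℤ} (hi : i + t = i')
    (hj : j + t = j') : ∃ (a : (K⟦t⟧).X i ≅ K.X i') (b : (K⟦t⟧).X j ≅ K.X j'),
      a.hom ≫ K.d i' j' = (K⟦t⟧).d i j ≫ b.hom := by
  subst hi hj
  obtain ⟨b, hb⟩ : ∃ b : K.X (j + t) ≅ K.X (j + t),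
      K.d (i + t) (j + t) = t.negOnePow • K.d (i + t) (j + t) ≫ b.hom := by
    -- The shift multiplies the differential by a sign, which is absorbed into `b`.
    obtain ht | ht := Int.units_eq_one_or t.negOnePow
    · exact ⟨Iso.refl _, by simp [ht]⟩
    · exact ⟨-Iso.refl _, by simp [ht, Units.smul_def]⟩
  refine ⟨Iso.refl _, b, (Category.id_comp _).trans (hb.trans ?_)⟩
  rw [← Linear.units_smul_comp]
  rfl

end CochainComplex

section Factorization

open CochainComplex

variable {C : Type*} [Category* C] [Abelian C] [HasExt.{w} C]

namespace AbelianCotorsion.IsCompleteHereditary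

variable {A B : ObjectProperty C} (h : IsCompleteHereditary A B)

include h

/-- Dual correction: `k₀` lifts the given map through the differential, its restriction to the
syzygy of `M` defines a map to cohomology modulo boundaries, and `Ext¹`-vanishing extends that map
over the projective so it can be subtracted. -/
theorem exists_coextension_step [EnoughProjectives C] {I : CochainComplex C ℤ}
    (hI : ∀ s, B (I.homology s)) {s' s : ℤ} (hs : s' + 1 = s) {M : C} (hM : A M)
    (φ : M ⟶ I.X s) (hφ : φ ≫ I.pOpcycles s = 0) :
    ∃ k : Projective.over M ⟶ I.X s', k ≫ I.d s' s = Projective.π M ≫ φ ∧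
      (kernel.ι (Projective.π M) ≫ k) ≫ I.pOpcycles s' = 0 := by
  subst hs
  have hS := I.shortExact_coboundaries_opcycles s'
  have : Mono (fromCoboundaries I s') := hS.mono_f
  obtain ⟨φ', hφ'⟩ : ∃ φ', φ' ≫ fromCoboundaries I s' = φ :=
    ⟨hS.exact.lift _ hφ, hS.exact.lift_f _ hφ⟩
  have hd : I.d s' (s' + 1) = I.pOpcycles s' ≫ cokernel.π (I.homologyι s') ≫
      fromCoboundaries I s' := by
    rw [π_fromCoboundaries, I.p_fromOpcycles]
  obtain ⟨k₀, hk₀⟩ : ∃ k₀ : Projective.over M ⟶ I.X s',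
      k₀ ≫ I.pOpcycles s' ≫ cokernel.π (I.homologyι s') = Projective.π M ≫ φ' :=
    ⟨Projective.factorThru _ _, Projective.factorThru_comp _ _⟩
  have hT : (ShortComplex.mk (kernel.ι (Projective.π M)) (Projective.π M)
    (kernel.condition _)).ShortExact := .mk (ShortComplex.exact_kernel _)
  have hχ₀ : (kernel.ι (Projective.π M) ≫ k₀ ≫ I.pOpcycles s') ≫
      cokernel.π (I.homologyι s') = 0 := by
    rw [Category.assoc, Category.assoc, hk₀, kernel.condition_assoc, zero_comp]
  have hS' := I.shortExact_homology_opcycles s'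
  obtain ⟨χ, hχ⟩ : ∃ χ, χ ≫ I.homologyι s' = kernel.ι (Projective.π M) ≫ k₀ ≫
      I.pOpcycles s' := ⟨hS'.exact.lift _ hχ₀, hS'.exact.lift_f _ hχ₀⟩
  have := h.subsingleton_ext hM (hI s')
  obtain ⟨χ', hχ'⟩ : ∃ χ', kernel.ι (Projective.π M) ≫ χ' = χ :=
    exists_extension_of_subsingleton_ext hT χ
  obtain ⟨k₁, hk₁⟩ : ∃ k₁ : Projective.over M ⟶ I.X s',
      k₁ ≫ I.pOpcycles s' = χ' ≫ I.homologyι s' :=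
    ⟨Projective.factorThru _ _, Projective.factorThru_comp _ _⟩
  refine ⟨k₀ - k₁, ?_, ?_⟩
  · rw [Preadditive.sub_comp, hd, reassoc_of% hk₀, reassoc_of% hk₁, cokernel.condition_assoc,
      zero_comp, comp_zero, sub_zero, hφ']
  · rw [Category.assoc, Preadditive.sub_comp, Preadditive.comp_sub, ← hχ, hk₁, reassoc_of% hχ',
      sub_self]

/-- A projective resolution of `X`, augmented by `X` in degree zero, maps to `I`. It is acyclic and
vanishes in degree `1`, so K-injectivity leaves a factorization through `I.X (-1)`. -/
theorem exists_cofactorization_zero [EnoughProjectives C] {I : CochainComplex C ℤ}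
    [I.IsKInjective] (hI : ∀ s, B (I.homology s)) {X : C} (hX : A X) (g : X ⟶ I.X 0)
    (hg : g ≫ I.pOpcycles 0 = 0) : ∃ ψ : X ⟶ I.X (-1), ψ ≫ I.d (-1) 0 = g := by
  let Stage (n : ℕ) := { x : Σ M : C, (M ⟶ I.X (-n)) // A x.1 ∧ x.2 ≫ I.pOpcycles (-n) = 0 }
  have step (n : ℕ) (x : Stage n) := h.exists_coextension_step hI (s := -n)
    (s' := -(n + 1 : ℕ)) (by simp) x.2.1 x.1.2 x.2.2
  choose k hk₁ hk₂ using step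
  let next (n : ℕ) (x : Stage n) : Stage (n + 1) :=
    ⟨⟨kernel (Projective.π x.1.1), kernel.ι _ ≫ k n x⟩,
      h.kernel_mem (ShortComplex.mk (kernel.ι _) (Projective.π x.1.1) (kernel.condition _))
        (.mk (ShortComplex.exact_kernel _)) (h.mem_left_of_projective _) x.2.1, hk₂ n x⟩
  let stage (n : ℕ) : Stage n := Nat.rec ⟨⟨X, g⟩, hX, hg⟩ next n
  let M (n : ℕ) : C := (stage n).1.1
  let E (n : ℕ) : C := Projective.over (M n)
  let p (n : ℕ) : E n ⟶ M n := Projective.π (M n)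
  let i (n : ℕ) : M (n + 1) ⟶ E n := kernel.ι (p n)
  have w (n : ℕ) : i n ≫ p n = 0 := kernel.condition _
  have hS (n : ℕ) : (ShortComplex.mk (i n) (p n) (w n)).ShortExact :=
    .mk (ShortComplex.exact_kernel _)
  obtain ⟨f, hf⟩ := exists_hom_leftSplice (I := I) (M := M) (L := E) (i := i) (p := p) (w := w)
    (fun n => (stage n).1.2) (fun n => k n (stage n))
    (by
      change g ≫ I.d 0 1 = 0
      rw [← I.p_fromOpcycles 0 1, ← Category.assoc, hg, zero_comp])
    (fun n => hk₁ n (stage n)) (fun n => rfl)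
  let H := IsKInjective.homotopyZero f (acyclic_leftSplice M E i p w hS)
  have hH := H.comm 0
  rw [dNext_eq H.hom (show (ComplexShape.up ℤ).Rel 0 1 by simp),
    prevD_eq H.hom (show (ComplexShape.up ℤ).Rel (-1) 0 by simp), HomologicalComplex.zero_f,
    add_zero] at hH
  have hz : H.hom 1 0 = 0 := (isZero_zero C).eq_of_src _ _
  rw [hz, comp_zero, zero_add] at hH
  exact ⟨H.hom 0 (-1), hH.symm.trans hf⟩

theorem exists_factorization [EnoughInjectives C] {P : CochainComplex C ℤ}
    [P.IsKProjective] (hP : ∀ s, A (P.homology s)) {Y : C} (hY : B Y) {t t' : ℤ} (ht : t + 1 = t')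
    (g : P.X t ⟶ Y) (hg : P.iCycles t ≫ g = 0) : ∃ ψ : P.X t' ⟶ Y, P.d t t' ≫ ψ = g := by
  have := h.isClosedUnderIsomorphisms_left
  have hH (s : ℤ) : A ((P⟦t⟧).homology s) :=
    A.prop_of_iso ((ShiftSequence.shiftIso C t s (t + s) rfl).app P).symm (hP _)
  have hK : (P⟦t⟧).IsKProjective := inferInstance
  obtain ⟨a, b, hab⟩ := exists_shift_iso P t 0 1 (i' := t) (j' := t') (by lia) (by lia)
  generalize P⟦t⟧ = P' at *
  have hc : (P'.iCycles 0 ≫ a.hom) ≫ P.d t t' = 0 := by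
    rw [Category.assoc, hab, P'.iCycles_d_assoc, zero_comp]
  obtain ⟨ψ, hψ⟩ := h.exists_factorization_zero hH hY (a.hom ≫ g) (by
    rw [← Category.assoc, ← P.liftCycles_i _ t' ((ComplexShape.up ℤ).next_eq' ht) hc,
      Category.assoc, hg, comp_zero])
  refine ⟨b.inv ≫ ψ, ?_⟩
  rw [← cancel_epi a.hom, reassoc_of% hab, b.hom_inv_id_assoc, hψ]

theorem exists_cofactorization [EnoughProjectives C] {I : CochainComplex C ℤ}
    [I.IsKInjective] (hI : ∀ s, B (I.homology s)) {X : C} (hX : A X) {t' t : ℤ} (ht : t' + 1 = t)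
    (g : X ⟶ I.X t) (hg : g ≫ I.pOpcycles t = 0) : ∃ ψ : X ⟶ I.X t', ψ ≫ I.d t' t = g := by
  have := h.isClosedUnderIsomorphisms_right
  have hH (s : ℤ) : B ((I⟦t⟧).homology s) :=
    B.prop_of_iso ((ShiftSequence.shiftIso C t s (t + s) rfl).app I).symm (hI _)
  have hK : (I⟦t⟧).IsKInjective := inferInstance
  obtain ⟨a, b, hab⟩ := exists_shift_iso I t (-1) 0 (i' := t') (j' := t) (by lia) (by lia)
  generalize I⟦t⟧ = I' at *
  have hc : I.d t' t ≫ b.inv ≫ I'.pOpcycles 0 = 0 := by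
    rw [← cancel_epi a.hom, reassoc_of% hab, b.hom_inv_id_assoc, I'.d_pOpcycles, comp_zero]
  obtain ⟨ψ, hψ⟩ := h.exists_cofactorization_zero hH hX (g ≫ b.inv) (by
    rw [Category.assoc, ← I.p_descOpcycles _ t' ((ComplexShape.up ℤ).prev_eq' ht) hc,
      reassoc_of% hg, zero_comp])
  refine ⟨ψ ≫ a.hom, ?_⟩
  rw [Category.assoc, hab, reassoc_of% hψ, b.inv_hom_id, Category.comp_id]

/-- A K-projective complex of projectives with cohomology in `A` has all its cokernels in `A`. -/
theorem opcycles_mem_of_isKProjective [EnoughInjectives C] {P : CochainComplex C ℤ}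
    [P.IsKProjective] [∀ s, Projective (P.X s)] (hP : ∀ s, A (P.homology s)) (s : ℤ) :
    A (P.opcycles s) := by
  obtain ⟨s, rfl⟩ : ∃ t, s = t + 1 := ⟨s - 1, by simp⟩
  rw [← h.left_eq]
  intro Y hY
  have : Subsingleton (Abelian.Ext (P.X (s + 1)) Y 1) := Abelian.Ext.subsingleton_of_projective _ Y 0
  -- The middle term is projective, so it is enough to extend maps off the boundaries. Pulled back
  -- to `P.X s`, such a map kills cycles and therefore factors through the differential.
  refine subsingleton_ext_of_exists_extension (P.shortExact_coboundaries_opcycles s) fun φ => ?_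
  dsimp only at φ ⊢
  obtain ⟨ψ, hψ⟩ := h.exists_factorization hP hY rfl
    (P.pOpcycles s ≫ cokernel.π (P.homologyι s) ≫ φ) (by
      rw [← P.homology_π_ι_assoc, cokernel.condition_assoc, zero_comp, comp_zero])
  refine ⟨ψ, ?_⟩
  rw [← cancel_epi (cokernel.π (P.homologyι s)), ← cancel_epi (P.pOpcycles s), ← hψ,
    ← P.p_fromOpcycles s (s + 1), ← π_fromCoboundaries]
  simp only [Category.assoc]

/-- A K-injective complex of injectives with cohomology in `B` has all its kernels in `B`. -/
theorem cycles_mem_of_isKInjective [EnoughProjectives C] {I : CochainComplex C ℤ}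
    [I.IsKInjective] [∀ s, Injective (I.X s)] (hI : ∀ s, B (I.homology s)) (s : ℤ) :
    B (I.cycles s) := by
  rw [← h.right_eq]
  intro X hX
  have : Subsingleton (Abelian.Ext X (I.X s) 1) := Abelian.Ext.subsingleton_of_injective X _ 0
  refine subsingleton_ext_of_exists_lift (I.shortExact_cycles_boundaries s) fun φ => ?_
  dsimp only at φ ⊢
  obtain ⟨ψ, hψ⟩ := h.exists_cofactorization hI hX rfl
    (φ ≫ kernel.ι (I.homologyπ (s + 1)) ≫ I.iCycles (s + 1)) (by
      simp only [Category.assoc]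
      rw [← I.homology_π_ι, kernel.condition_assoc, zero_comp, comp_zero])
  refine ⟨ψ, ?_⟩
  rw [← cancel_mono (kernel.ι (I.homologyπ (s + 1))), ← cancel_mono (I.iCycles (s + 1)),
    Category.assoc ψ, toBoundaries_ι, Category.assoc, I.toCycles_i, hψ]
  simp only [Category.assoc]

/-- Heredity is used twice: boundaries are the kernel of a term onto its opcycles, and cohomology is
the kernel of opcycles onto the next boundaries. -/
theorem homology_mem_of_opcycles_mem {P : CochainComplex C ℤ} [∀ s, Projective (P.X s)]
    (hP : ∀ s, A (P.opcycles s)) (s : ℤ) : A (P.homology s) :=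
  h.kernel_mem _ (P.shortExact_homology_opcycles s) (hP s)
    (h.kernel_mem _ (P.shortExact_coboundaries_opcycles s) (h.mem_left_of_projective _) (hP _))

theorem homology_mem_of_cycles_mem {I : CochainComplex C ℤ} [∀ s, Injective (I.X s)]
    (hI : ∀ s, B (I.cycles s)) (s : ℤ) : B (I.homology s) := by
  obtain ⟨s, rfl⟩ : ∃ t, s = t + 1 := ⟨s - 1, by simp⟩
  exact h.cokernel_mem _ (I.shortExact_boundaries_cycles (s + 1))
    (h.cokernel_mem _ (I.shortExact_cycles_boundaries s) (hI _) (h.mem_right_of_injective _)) (hI _)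

end AbelianCotorsion.IsCompleteHereditary

end Factorization

/-! ### Attaching cells to complexes -/

namespace CochainComplex

variable {C : Type*} [Category* C] [Abelian C]

/-- A family `h s : K.X (s + 1) ⟶ L.X s` with `f = d h + h d` is a null-homotopy of `f`. -/
theorem nonempty_homotopy_zero_of_family {K L : CochainComplex C ℤ} {f : K ⟶ L}
    (h : ∀ s, K.X (s + 1) ⟶ L.X s)
    (hf : ∀ s, f.f (s + 1) = K.d (s + 1) (s + 1 + 1) ≫ h (s + 1) + h s ≫ L.d s (s + 1)) :
    Nonempty (Homotopy f 0) := by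
  refine ⟨{
    hom := fun i j => if hij : j + 1 = i then (K.XIsoOfEq hij.symm).hom ≫ h j else 0
    zero := fun i j hij => dif_neg hij
    comm := fun i => ?_ }⟩
  obtain ⟨s, rfl⟩ : ∃ t, i = t + 1 := ⟨i - 1, by simp⟩
  rw [dNext_eq _ (show (ComplexShape.up ℤ).Rel (s + 1) (s + 1 + 1) by simp),
    prevD_eq _ (show (ComplexShape.up ℤ).Rel s (s + 1) by simp), HomologicalComplex.zero_f,
    add_zero, dif_pos rfl, dif_pos rfl, hf]
  simp

/-- `P'` is obtained from `P` by attaching the projective objects `F s` along maps `φ s` to the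
cycles. -/
structure CellAttachment {P P' : CochainComplex C ℤ} (ι : P ⟶ P') (F : ℤ → C)
    (φ : ∀ s, F s ⟶ P.X (s + 1)) where
  projective (s : ℤ) : Projective (F s)
  /-- the inclusion of the attached objects -/
  j (s : ℤ) : F s ⟶ P'.X s
  j_d (s : ℤ) : j s ≫ P'.d s (s + 1) = φ s ≫ ι.f (s + 1)
  /-- the projection onto the first summand -/
  r (s : ℤ) : P'.X s ⟶ P.X s
  /-- the projection onto the second summand -/
  q (s : ℤ) : P'.X s ⟶ F s
  ι_r (s : ℤ) : ι.f s ≫ r s = 𝟙 _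
  ι_q (s : ℤ) : ι.f s ≫ q s = 0
  j_r (s : ℤ) : j s ≫ r s = 0
  j_q (s : ℤ) : j s ≫ q s = 𝟙 _
  total (s : ℤ) : r s ≫ ι.f s + q s ≫ j s = 𝟙 _

theorem exists_cellAttachment (P : CochainComplex C ℤ) (F : ℤ → C) (hF : ∀ s, Projective (F s))
    (φ : ∀ s, F s ⟶ P.X (s + 1)) (hφ : ∀ s, φ s ≫ P.d (s + 1) (s + 1 + 1) = 0) :
    ∃ (P' : CochainComplex C ℤ) (ι : P ⟶ P'), Nonempty (CellAttachment ι F φ) := by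
  let d (s : ℤ) : (P.X s ⊞ F s) ⟶ P.X (s + 1) ⊞ F (s + 1) :=
    biprod.desc (P.d s (s + 1) ≫ biprod.inl) (φ s ≫ biprod.inl)
  have hd (s : ℤ) : d s ≫ d (s + 1) = 0 := by
    apply biprod.hom_ext'
    · simp [d]
    · simp [d, reassoc_of% (hφ s)]
  let P' : CochainComplex C ℤ := CochainComplex.of (fun s => P.X s ⊞ F s) d hd
  have hP' (s : ℤ) : P'.d s (s + 1) = d s :=
    CochainComplex.of_d (fun s => P.X s ⊞ F s) d s
  let ι : P ⟶ P' :=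
    { f := fun s => biprod.inl
      comm' := by
        rintro i _ rfl
        rw [hP']
        exact biprod.inl_desc _ _ }
  exact ⟨P', ι, ⟨{
    projective := hF
    j := fun s => biprod.inr
    j_d := fun s => by
      rw [hP']
      exact biprod.inr_desc _ _
    r := fun s => biprod.fst
    q := fun s => biprod.snd
    ι_r := fun s => biprod.inl_fst
    ι_q := fun s => biprod.inl_snd
    j_r := fun s => biprod.inr_fst
    j_q := fun s => biprod.inr_snd
    total := fun s => biprod.total }⟩⟩

namespace CellAttachment

variable {P P' : CochainComplex C ℤ} {ι : P ⟶ P'} {F : ℤ → C}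
  {φ : ∀ s, F s ⟶ P.X (s + 1)} (c : CellAttachment ι F φ)

include c

theorem hom_ext {s : ℤ} {M : C} {a b : P'.X s ⟶ M} (h₁ : ι.f s ≫ a = ι.f s ≫ b)
    (h₂ : c.j s ≫ a = c.j s ≫ b) : a = b := by
  rw [← Category.id_comp a, ← Category.id_comp b, ← c.total, Preadditive.add_comp,
    Preadditive.add_comp, Category.assoc, Category.assoc, h₁, h₂, Category.assoc, Category.assoc]

theorem exists_desc {s : ℤ} {M : C} (a : P.X s ⟶ M) (b : F s ⟶ M) :
    ∃ k : P'.X s ⟶ M, ι.f s ≫ k = a ∧ c.j s ≫ k = b := by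
  refine ⟨c.r s ≫ a + c.q s ≫ b, ?_, ?_⟩
  · rw [Preadditive.comp_add, ← Category.assoc, ← Category.assoc, c.ι_r, c.ι_q]
    simp
  · rw [Preadditive.comp_add, ← Category.assoc, ← Category.assoc, c.j_r, c.j_q]
    simp

theorem φ_d (s : ℤ) : φ s ≫ P.d (s + 1) (s + 1 + 1) = 0 := by
  have h : φ s ≫ P.d (s + 1) (s + 1 + 1) ≫ ι.f _ = 0 := by
    rw [← ι.comm, ← Category.assoc, ← c.j_d, Category.assoc, P'.d_comp_d, comp_zero]
  rw [← Category.comp_id (P.d _ _), ← c.ι_r, reassoc_of% h, zero_comp]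

theorem exists_lift {s : ℤ} {M M' : C} (e : M ⟶ M') [Epi e] (a : P.X s ⟶ M) (g : P'.X s ⟶ M')
    (h : ι.f s ≫ g = a ≫ e) : ∃ k : P'.X s ⟶ M, ι.f s ≫ k = a ∧ k ≫ e = g := by
  have := c.projective s
  obtain ⟨k, hk₁, hk₂⟩ := c.exists_desc a (Projective.factorThru (c.j s ≫ g) e)
  refine ⟨k, hk₁, c.hom_ext ?_ ?_⟩
  · rw [← Category.assoc, hk₁, h]
  · rw [← Category.assoc, hk₂, Projective.factorThru_comp]

/-- On a new cell, the required value of `h'` must have boundary `g` minus the homotopy already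
prescribed on the attaching map. That difference is a cycle, so acyclicity of `Y` and projectivity
of the cell supply the value. -/
theorem exists_homotopy {Y : CochainComplex C ℤ} (hY : Y.Acyclic) (g : P' ⟶ Y)
    (h : ∀ s, P.X (s + 1) ⟶ Y.X s) (hh : ∀ s, (ι ≫ g).f (s + 1) =
      P.d (s + 1) (s + 1 + 1) ≫ h (s + 1) + h s ≫ Y.d s (s + 1)) :
    ∃ h' : ∀ s, P'.X (s + 1) ⟶ Y.X s, (∀ s, ι.f (s + 1) ≫ h' s = h s) ∧
      ∀ s, g.f (s + 1) = P'.d (s + 1) (s + 1 + 1) ≫ h' (s + 1) + h' s ≫ Y.d s (s + 1) := by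
  have hb (s : ℤ) : ∃ b : F (s + 1) ⟶ Y.X s, b ≫ Y.d s (s + 1) =
      c.j (s + 1) ≫ g.f (s + 1) - φ (s + 1) ≫ h (s + 1) := by
    have := c.projective (s + 1)
    have hE := (Y.exactAt_iff' s (s + 1) (s + 1 + 1) (by simp) (by simp)).1 (hY (s + 1))
    have hz : (c.j (s + 1) ≫ g.f (s + 1) - φ (s + 1) ≫ h (s + 1)) ≫
        Y.d (s + 1) (s + 1 + 1) = 0 := by
      have e := φ (s + 1) ≫= hh (s + 1)
      rw [Preadditive.comp_add, ← Category.assoc (φ (s + 1)) (P.d _ _), c.φ_d, zero_comp,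
        zero_add, HomologicalComplex.comp_f] at e
      rw [Preadditive.sub_comp, Category.assoc, Category.assoc, ← e, g.comm, ← Category.assoc,
        c.j_d, Category.assoc, sub_self]
    exact ⟨hE.liftFromProjective _ hz, hE.liftFromProjective_comp _ hz⟩
  choose b hb using hb
  choose h' h₁ h₂ using fun s => c.exists_desc (h s) (b s)
  refine ⟨h', h₁, fun s => c.hom_ext ?_ ?_⟩
  · rw [Preadditive.comp_add, ← Category.assoc, ← Category.assoc, h₁, ι.comm, Category.assoc, h₁,
      ← hh, HomologicalComplex.comp_f]
  · rw [Preadditive.comp_add, ← Category.assoc, ← Category.assoc, h₂, c.j_d, Category.assoc, h₁,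
      hb]
    abel

end CellAttachment

/-- `J'` is the fibre of a map `θ` from `J` to injective objects with zero differential. -/
structure CocellAttachment {J' J : CochainComplex C ℤ} (π : J' ⟶ J) (E : ℤ → C)
    (θ : ∀ s, J.X s ⟶ E (s + 1)) where
  injective (s : ℤ) : Injective (E s)
  /-- the projection onto the coattached objects -/
  q (s : ℤ) : J'.X s ⟶ E s
  d_q (s : ℤ) : J'.d s (s + 1) ≫ q (s + 1) = π.f s ≫ θ s
  /-- the inclusion of the first summand -/
  i (s : ℤ) : J.X s ⟶ J'.X s
  /-- the inclusion of the second summand -/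
  j (s : ℤ) : E s ⟶ J'.X s
  i_π (s : ℤ) : i s ≫ π.f s = 𝟙 _
  i_q (s : ℤ) : i s ≫ q s = 0
  j_π (s : ℤ) : j s ≫ π.f s = 0
  j_q (s : ℤ) : j s ≫ q s = 𝟙 _
  total (s : ℤ) : π.f s ≫ i s + q s ≫ j s = 𝟙 _

theorem exists_cocellAttachment (J : CochainComplex C ℤ) (E : ℤ → C) (hE : ∀ s, Injective (E s))
    (θ : ∀ s, J.X s ⟶ E (s + 1)) (hθ : ∀ s, J.d s (s + 1) ≫ θ (s + 1) = 0) :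
    ∃ (J' : CochainComplex C ℤ) (π : J' ⟶ J), Nonempty (CocellAttachment π E θ) := by
  let d (s : ℤ) : (J.X s ⊞ E s) ⟶ J.X (s + 1) ⊞ E (s + 1) :=
    biprod.lift (biprod.fst ≫ J.d s (s + 1)) (biprod.fst ≫ θ s)
  have hd (s : ℤ) : d s ≫ d (s + 1) = 0 := by
    apply biprod.hom_ext
    · simp [d]
    · simp [d, hθ s]
  let J' : CochainComplex C ℤ := CochainComplex.of (fun s => J.X s ⊞ E s) d hd
  have hJ' (s : ℤ) : J'.d s (s + 1) = d s :=
    CochainComplex.of_d (fun s => J.X s ⊞ E s) d s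
  let π : J' ⟶ J :=
    { f := fun s => biprod.fst
      comm' := by
        rintro i _ rfl
        rw [hJ']
        exact (biprod.lift_fst _ _).symm }
  exact ⟨J', π, ⟨{
    injective := hE
    q := fun s => biprod.snd
    d_q := fun s => by
      rw [hJ']
      exact biprod.lift_snd _ _
    i := fun s => biprod.inl
    j := fun s => biprod.inr
    i_π := fun s => biprod.inl_fst
    i_q := fun s => biprod.inl_snd
    j_π := fun s => biprod.inr_fst
    j_q := fun s => biprod.inr_snd
    total := fun s => biprod.total }⟩⟩

namespace CocellAttachment

variable {J' J : CochainComplex C ℤ} {π : J' ⟶ J} {E : ℤ → C}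
  {θ : ∀ s, J.X s ⟶ E (s + 1)} (c : CocellAttachment π E θ)

include c

theorem hom_ext {s : ℤ} {M : C} {a b : M ⟶ J'.X s} (h₁ : a ≫ π.f s = b ≫ π.f s)
    (h₂ : a ≫ c.q s = b ≫ c.q s) : a = b := by
  rw [← Category.comp_id a, ← Category.comp_id b, ← c.total, Preadditive.comp_add,
    Preadditive.comp_add, reassoc_of% h₁, reassoc_of% h₂]

theorem exists_lift {s : ℤ} {M : C} (a : M ⟶ J.X s) (b : M ⟶ E s) :
    ∃ k : M ⟶ J'.X s, k ≫ π.f s = a ∧ k ≫ c.q s = b := by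
  refine ⟨a ≫ c.i s + b ≫ c.j s, ?_, ?_⟩
  · simp [c.i_π, c.j_π]
  · simp [c.i_q, c.j_q]

theorem d_θ (s : ℤ) : J.d s (s + 1) ≫ θ (s + 1) = 0 := by
  have h : π.f s ≫ J.d s (s + 1) ≫ θ (s + 1) = 0 := by
    rw [π.comm_assoc, ← c.d_q, J'.d_comp_d_assoc, zero_comp]
  rw [← Category.id_comp (J.d _ _), ← c.i_π, Category.assoc, Category.assoc, h, comp_zero]

theorem exists_extension {s : ℤ} {M M' : C} (m : M' ⟶ M) [Mono m] (a : M ⟶ J.X s)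
    (g : M' ⟶ J'.X s) (h : g ≫ π.f s = m ≫ a) :
    ∃ k : M ⟶ J'.X s, k ≫ π.f s = a ∧ m ≫ k = g := by
  have := c.injective s
  obtain ⟨k, hk₁, hk₂⟩ := c.exists_lift a (Injective.factorThru (g ≫ c.q s) m)
  refine ⟨k, hk₁, c.hom_ext ?_ ?_⟩
  · rw [Category.assoc, hk₁, h]
  · rw [Category.assoc, hk₂, Injective.comp_factorThru]

theorem exists_homotopy {K : CochainComplex C ℤ} (hK : K.Acyclic) (g : K ⟶ J')
    (h : ∀ s, K.X (s + 1) ⟶ J.X s) (hh : ∀ s, (g ≫ π).f (s + 1) =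
      K.d (s + 1) (s + 1 + 1) ≫ h (s + 1) + h s ≫ J.d s (s + 1)) :
    ∃ h' : ∀ s, K.X (s + 1) ⟶ J'.X s, (∀ s, h' s ≫ π.f s = h s) ∧
      ∀ s, g.f (s + 1) = K.d (s + 1) (s + 1 + 1) ≫ h' (s + 1) + h' s ≫ J'.d s (s + 1) := by
  -- The component of `h'` at index `t` lands in `E t`, while its correction term uses `h` and `θ`
  -- at index `t - 1`. Quantifying over `s` with `s + 1 = t` confines the transports to this
  -- statement.
  have hb (t : ℤ) : ∃ b : K.X (t + 1) ⟶ E t, ∀ s (hs : s + 1 = t), K.d t (t + 1) ≫ b =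
      g.f t ≫ c.q t -
        (K.XIsoOfEq hs.symm).hom ≫ h s ≫ θ s ≫ eqToHom (congrArg E hs) := by
    obtain ⟨s, rfl⟩ : ∃ s, t = s + 1 := ⟨t - 1, by simp⟩
    obtain ⟨s, rfl⟩ : ∃ r, s = r + 1 := ⟨s - 1, by simp⟩
    have := c.injective (s + 1 + 1)
    have hE := (K.exactAt_iff' (s + 1) (s + 1 + 1) (s + 1 + 1 + 1) (by simp) (by simp)).1
      (hK (s + 1 + 1))
    have hz : K.d (s + 1) (s + 1 + 1) ≫
        (g.f (s + 1 + 1) ≫ c.q (s + 1 + 1) - h (s + 1) ≫ θ (s + 1)) = 0 := by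
      have e := hh s =≫ θ (s + 1)
      rw [Preadditive.add_comp, Category.assoc (h s), c.d_θ, comp_zero,
        add_zero, HomologicalComplex.comp_f, Category.assoc, Category.assoc] at e
      rw [Preadditive.comp_sub, ← e, ← g.comm_assoc, c.d_q, sub_self]
    obtain ⟨b, hb⟩ : ∃ b : K.X (s + 1 + 1 + 1) ⟶ E (s + 1 + 1),
        K.d (s + 1 + 1) (s + 1 + 1 + 1) ≫ b =
          g.f (s + 1 + 1) ≫ c.q (s + 1 + 1) - h (s + 1) ≫ θ (s + 1) :=
      ⟨hE.descToInjective _ hz, hE.comp_descToInjective _ hz⟩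
    refine ⟨b, fun s' hs' => ?_⟩
    obtain rfl : s' = s + 1 := by lia
    simpa using hb
  choose b hb using hb
  choose h' h₁ h₂ using fun s => c.exists_lift (h s) (b s)
  refine ⟨h', h₁, fun s => c.hom_ext ?_ ?_⟩
  · rw [Preadditive.add_comp, Category.assoc, Category.assoc, h₁, ← π.comm, reassoc_of% (h₁ s),
      ← hh, HomologicalComplex.comp_f]
  · rw [Preadditive.add_comp, Category.assoc, Category.assoc, h₂, c.d_q, hb _ s rfl,
      reassoc_of% (h₁ s)]
    simp

end CocellAttachment

end CochainComplex

/-! ### Sequential colimits and limits of complexes -/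

theorem exists_dependent_sequence {S : ℕ → Type*} (x₀ : S 0) {r : ∀ n, S n → S (n + 1) → Prop}
    (h : ∀ n x, ∃ y, r n x y) : ∃ x : ∀ n, S n, x 0 = x₀ ∧ ∀ n, r n (x n) (x (n + 1)) := by
  choose next hnext using h
  exact ⟨fun n => Nat.rec x₀ next n, rfl, fun n => hnext n _⟩

namespace CochainComplex

variable {C : Type*} [Category* C] [Abelian C]

section Colimit

variable {P : ℕ → CochainComplex C ℤ} {T : CochainComplex C ℤ}

/-- `T` is the degreewise colimit of the sequence `P 0 ⟶ P 1 ⟶ ⋯`. -/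
structure IsSequentialColimit (ι : ∀ n, P n ⟶ P (n + 1)) (c : ∀ n, P n ⟶ T) : Prop where
  comm (n : ℕ) : ι n ≫ c (n + 1) = c n
  exists_desc {s : ℤ} {M : C} (a : ∀ n, (P n).X s ⟶ M) :
    (∀ n, (ι n).f s ≫ a (n + 1) = a n) → ∃ b : T.X s ⟶ M, ∀ n, (c n).f s ≫ b = a n
  hom_ext {s : ℤ} {M : C} {a b : T.X s ⟶ M} : (∀ n, (c n).f s ≫ a = (c n).f s ≫ b) → a = b

namespace IsSequentialColimit

variable {ι : ∀ n, P n ⟶ P (n + 1)} {c : ∀ n, P n ⟶ T} (h : IsSequentialColimit ι c)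

include h

theorem comm_f (n : ℕ) (s : ℤ) : (ι n).f s ≫ (c (n + 1)).f s = (c n).f s := by
  rw [← HomologicalComplex.comp_f, h.comm]

theorem exists_hom {X : CochainComplex C ℤ} (f : ∀ n, P n ⟶ X)
    (hf : ∀ n, ι n ≫ f (n + 1) = f n) : ∃ g : T ⟶ X, ∀ n, c n ≫ g = f n := by
  choose g hg using fun s => h.exists_desc (s := s) (fun n => (f n).f s) fun n => by
    rw [← HomologicalComplex.comp_f, hf]
  refine ⟨⟨g, fun i j _ => h.hom_ext fun n => ?_⟩, fun n => by ext s : 1; exact hg s n⟩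
  rw [← Category.assoc, hg, (c n).comm_assoc, hg, (f n).comm]

/-- Lifts are chosen compatibly stage by stage from the zero complex, each stage adding a projective
summand, and are then glued over the colimit. -/
theorem projective (hι : ∀ n, ∃ F φ, Nonempty (CellAttachment (ι n) F φ))
    (h₀ : ∀ s, IsZero ((P 0).X s)) (s : ℤ) : Projective (T.X s) where
  factors {M' M} g e _ := by
    obtain ⟨a, -, ha⟩ := exists_dependent_sequence
      (S := fun n => { a : (P n).X s ⟶ M' // a ≫ e = (c n).f s ≫ g })
      ⟨0, (h₀ s).eq_of_src _ _⟩ (r := fun n a b => (ι n).f s ≫ b.1 = a.1) fun n a => by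
        obtain ⟨F, φ, ⟨k⟩⟩ := hι n
        obtain ⟨b, hb₁, hb₂⟩ := k.exists_lift e a.1 ((c (n + 1)).f s ≫ g) (by
          rw [← Category.assoc, h.comm_f, a.2])
        exact ⟨⟨b, hb₂⟩, hb₁⟩
    obtain ⟨b, hb⟩ := h.exists_desc (fun n => (a n).1) ha
    refine ⟨b, h.hom_ext fun n => ?_⟩
    rw [← Category.assoc, hb, (a n).2]

theorem isKProjective (hι : ∀ n, ∃ F φ, Nonempty (CellAttachment (ι n) F φ))
    (h₀ : ∀ s, IsZero ((P 0).X s)) : T.IsKProjective where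
  nonempty_homotopy_zero {Y} g hY := by
    obtain ⟨a, -, ha⟩ := exists_dependent_sequence
      (S := fun n => { a : ∀ s, (P n).X (s + 1) ⟶ Y.X s // ∀ s, (c n ≫ g).f (s + 1) =
        (P n).d (s + 1) (s + 1 + 1) ≫ a (s + 1) + a s ≫ Y.d s (s + 1) })
      ⟨fun s => 0, fun s => (h₀ _).eq_of_src _ _⟩
      (r := fun n a b => ∀ s, (ι n).f (s + 1) ≫ b.1 s = a.1 s) fun n a => by
        obtain ⟨F, φ, ⟨k⟩⟩ := hι n
        obtain ⟨b, hb₁, hb₂⟩ := k.exists_homotopy hY (c (n + 1) ≫ g) a.1 (by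
          rw [← Category.assoc, h.comm]
          exact a.2)
        exact ⟨⟨b, hb₂⟩, hb₁⟩
    choose b hb using fun s => h.exists_desc (s := s + 1) (fun n => (a n).1 s) fun n => ha n s
    refine nonempty_homotopy_zero_of_family b fun s => h.hom_ext fun n => ?_
    rw [Preadditive.comp_add, ← Category.assoc, ← Category.assoc, hb, (c n).comm, Category.assoc,
      hb, ← (a n).2, HomologicalComplex.comp_f]

end IsSequentialColimit

end Colimit

section Limit

variable {J : ℕ → CochainComplex C ℤ} {T : CochainComplex C ℤ}

/-- `T` is the degreewise limit of the sequence `⋯ ⟶ J 1 ⟶ J 0`. -/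
structure IsSequentialLimit (π : ∀ n, J (n + 1) ⟶ J n) (c : ∀ n, T ⟶ J n) : Prop where
  comm (n : ℕ) : c (n + 1) ≫ π n = c n
  exists_lift {s : ℤ} {M : C} (a : ∀ n, M ⟶ (J n).X s) :
    (∀ n, a (n + 1) ≫ (π n).f s = a n) → ∃ b : M ⟶ T.X s, ∀ n, b ≫ (c n).f s = a n
  hom_ext {s : ℤ} {M : C} {a b : M ⟶ T.X s} : (∀ n, a ≫ (c n).f s = b ≫ (c n).f s) → a = b

namespace IsSequentialLimit

variable {π : ∀ n, J (n + 1) ⟶ J n} {c : ∀ n, T ⟶ J n} (h : IsSequentialLimit π c)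

include h

theorem comm_f (n : ℕ) (s : ℤ) : (c (n + 1)).f s ≫ (π n).f s = (c n).f s := by
  rw [← HomologicalComplex.comp_f, h.comm]

theorem exists_hom {X : CochainComplex C ℤ} (f : ∀ n, X ⟶ J n)
    (hf : ∀ n, f (n + 1) ≫ π n = f n) : ∃ g : X ⟶ T, ∀ n, g ≫ c n = f n := by
  choose g hg using fun s => h.exists_lift (s := s) (fun n => (f n).f s) fun n => by
    rw [← HomologicalComplex.comp_f, hf]
  refine ⟨⟨g, fun i j _ => h.hom_ext fun n => ?_⟩, fun n => by ext s : 1; exact hg s n⟩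
  rw [Category.assoc, Category.assoc, hg, ← (c n).comm, reassoc_of% (hg i n), (f n).comm]

theorem injective (hπ : ∀ n, ∃ E θ, Nonempty (CocellAttachment (π n) E θ))
    (h₀ : ∀ s, IsZero ((J 0).X s)) (s : ℤ) : Injective (T.X s) where
  factors {M' M} g e _ := by
    obtain ⟨a, -, ha⟩ := exists_dependent_sequence
      (S := fun n => { a : M ⟶ (J n).X s // e ≫ a = g ≫ (c n).f s })
      ⟨0, (h₀ s).eq_of_tgt _ _⟩ (r := fun n a b => b.1 ≫ (π n).f s = a.1) fun n a => by
        obtain ⟨E, θ, ⟨k⟩⟩ := hπ n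
        obtain ⟨b, hb₁, hb₂⟩ := k.exists_extension e a.1 (g ≫ (c (n + 1)).f s) (by
          rw [Category.assoc, h.comm_f, a.2])
        exact ⟨⟨b, hb₂⟩, hb₁⟩
    obtain ⟨b, hb⟩ := h.exists_lift (fun n => (a n).1) ha
    refine ⟨b, h.hom_ext fun n => ?_⟩
    rw [Category.assoc, hb, (a n).2]

theorem isKInjective (hπ : ∀ n, ∃ E θ, Nonempty (CocellAttachment (π n) E θ))
    (h₀ : ∀ s, IsZero ((J 0).X s)) : T.IsKInjective where
  nonempty_homotopy_zero {K} g hK := by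
    obtain ⟨a, -, ha⟩ := exists_dependent_sequence
      (S := fun n => { a : ∀ s, K.X (s + 1) ⟶ (J n).X s // ∀ s, (g ≫ c n).f (s + 1) =
        K.d (s + 1) (s + 1 + 1) ≫ a (s + 1) + a s ≫ (J n).d s (s + 1) })
      ⟨fun s => 0, fun s => (h₀ _).eq_of_tgt _ _⟩
      (r := fun n a b => ∀ s, b.1 s ≫ (π n).f s = a.1 s) fun n a => by
        obtain ⟨E, θ, ⟨k⟩⟩ := hπ n
        obtain ⟨b, hb₁, hb₂⟩ := k.exists_homotopy hK (g ≫ c (n + 1)) a.1 (by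
          rw [Category.assoc, h.comm]
          exact a.2)
        exact ⟨⟨b, hb₂⟩, hb₁⟩
    choose b hb using fun s => h.exists_lift (s := s) (fun n => (a n).1 s) fun n => ha n s
    refine nonempty_homotopy_zero_of_family b fun s => h.hom_ext fun n => ?_
    rw [Preadditive.add_comp, Category.assoc, Category.assoc, hb, ← (c n).comm,
      reassoc_of% (hb s n), ← (a n).2, HomologicalComplex.comp_f]

end IsSequentialLimit

theorem exists_isSequentialLimit [HasLimitsOfShape ℕᵒᵖ C] (π : ∀ n, J (n + 1) ⟶ J n) :
    ∃ (T : CochainComplex C ℤ) (c : ∀ n, T ⟶ J n), IsSequentialLimit π c := by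
  let G : ℕᵒᵖ ⥤ CochainComplex C ℤ := Functor.ofOpSequence π
  have hG (n : ℕ) : G.map (homOfLE (Nat.le_add_right n 1)).op = π n :=
    Functor.ofOpSequence_map_homOfLE_succ π n
  have hlim (s : ℤ) := isLimitOfPreserves (HomologicalComplex.eval C (ComplexShape.up ℤ) s)
    (limit.isLimit G)
  refine ⟨limit G, fun n => limit.π G (.op n), ⟨fun n => ?_, fun {s M} a ha => ?_,
    fun {s M a b} hab => ?_⟩⟩
  · rw [← hG]
    exact limit.w G _
  · let t : Cone (G ⋙ HomologicalComplex.eval C (ComplexShape.up ℤ) s) :=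
      { pt := M
        π := NatTrans.ofOpSequence a fun n => by
          change 𝟙 M ≫ a n = a (n + 1) ≫ (G.map _).f s
          rw [hG]
          exact (Category.id_comp _).trans (ha n).symm }
    exact ⟨(hlim s).lift t, fun n => (hlim s).fac t (.op n)⟩
  · exact (hlim s).hom_ext fun n => hab n.unop

end Limit

theorem isSequentialColimit_colimit [HasColimitsOfShape ℕ C] {P : ℕ → CochainComplex C ℤ}
    (ι : ∀ n, P n ⟶ P (n + 1)) :
    IsSequentialColimit ι fun n => colimit.ι (Functor.ofSequence ι) n := by
  let G : ℕ ⥤ CochainComplex C ℤ := Functor.ofSequence ι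
  have hG (n : ℕ) : G.map (homOfLE (Nat.le_add_right n 1)) = ι n :=
    Functor.ofSequence_map_homOfLE_succ ι n
  have hlim (s : ℤ) := isColimitOfPreserves (HomologicalComplex.eval C (ComplexShape.up ℤ) s)
    (colimit.isColimit G)
  refine ⟨fun n => ?_, fun {s M} a ha => ?_, fun {s M a b} hab => ?_⟩
  · rw [← hG]
    exact colimit.w G _
  · let t : Cocone (G ⋙ HomologicalComplex.eval C (ComplexShape.up ℤ) s) :=
      { pt := M
        ι := NatTrans.ofSequence a fun n => by
          change (G.map _).f s ≫ a (n + 1) = a n ≫ 𝟙 M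
          rw [hG]
          exact (ha n).trans (Category.comp_id _).symm }
    exact ⟨(hlim s).desc t, fun n => (hlim s).fac t n⟩
  · exact (hlim s).hom_ext fun n => hab n

end CochainComplex

/-! ### Existence of semi-projective and semi-injective resolutions -/

namespace CochainComplex

open scoped ZeroObject

variable {R : Type u} [Ring R]

/-- Filtered colimits of modules are computed on underlying sets: every element comes from a stage,
and every element that dies does so at a later stage. -/
theorem exists_sequentialColimit_elements {P : ℕ → CochainComplex (ModuleCat.{u} R) ℤ}
    (ι : ∀ n, P n ⟶ P (n + 1)) :
    ∃ (T : CochainComplex (ModuleCat.{u} R) ℤ) (c : ∀ n, P n ⟶ T), IsSequentialColimit ι c ∧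
      (∀ s (x : T.X s), ∃ (n : ℕ) (y : (P n).X s), (c n).f s y = x) ∧
      ∀ n s (x : (P n).X s), (c n).f s x = 0 →
        ∃ (m : ℕ) (k : P n ⟶ P m), k ≫ c m = c n ∧ k.f s x = 0 := by
  let G : ℕ ⥤ CochainComplex (ModuleCat.{u} R) ℤ := Functor.ofSequence ι
  have hlim (s : ℤ) := isColimitOfPreserves
    (HomologicalComplex.eval (ModuleCat.{u} R) (ComplexShape.up ℤ) s) (colimit.isColimit G)
  have : PreservesFilteredColimitsOfSize.{0, 0} (forget (ModuleCat.{u} R)) :=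
    preservesFilteredColimitsOfSize_shrink.{0, u, 0, u} _
  refine ⟨_, _, isSequentialColimit_colimit ι, fun s x => ?_, fun n s x hx => ?_⟩
  · obtain ⟨n, y, hy⟩ := Concrete.isColimit_exists_rep _ (hlim s) x
    exact ⟨n, y, hy⟩
  · obtain ⟨m, k, hk⟩ := (IsColimit.eq_iff' (hlim s) (i := n) x 0).1 (hx.trans (map_zero _).symm)
    exact ⟨m, G.map k, colimit.w G k, hk.trans (map_zero _)⟩

theorem exists_cycles {K : CochainComplex (ModuleCat.{u} R) ℤ} {s : ℤ} (x : K.X s)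
    (hx : K.d s (s + 1) x = 0) : ∃ z : K.cycles s, K.iCycles s z = x := by
  let φ : ModuleCat.of R R ⟶ K.X s := ModuleCat.ofHom (LinearMap.toSpanSingleton R _ x)
  have hφ : φ ≫ K.d s (s + 1) = 0 := by
    ext
    simp [φ, hx]
  refine ⟨K.liftCycles φ (s + 1) (by simp) hφ (1 : R), ?_⟩
  rw [← ConcreteCategory.comp_apply, K.liftCycles_i]
  simp [φ]

theorem homologyπ_eq_zero_iff {K : CochainComplex (ModuleCat.{u} R) ℤ} {s : ℤ}
    (z : K.cycles (s + 1)) :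
    K.homologyπ (s + 1) z = 0 ↔ ∃ y, K.d s (s + 1) y = K.iCycles (s + 1) z := by
  have hK : (ShortComplex.mk (K.toCycles s (s + 1)) (K.homologyπ (s + 1)) (by simp)).Exact :=
    ShortComplex.exact_of_g_is_cokernel _
      (K.homologyIsCokernel s (s + 1) ((ComplexShape.up ℤ).prev_eq' rfl))
  refine ⟨fun h => ?_, fun ⟨y, hy⟩ => ?_⟩
  · obtain ⟨y, hy⟩ := (ShortComplex.moduleCat_exact_iff _).1 hK z h
    refine ⟨y, ?_⟩
    rw [← hy, ← K.toCycles_i s (s + 1)]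
    rfl
  · obtain rfl : K.toCycles s (s + 1) y = z := by
      apply (ModuleCat.mono_iff_injective (K.iCycles (s + 1))).1 inferInstance
      rw [← hy, ← K.toCycles_i s (s + 1)]
      rfl
    rw [← ConcreteCategory.comp_apply, K.toCycles_comp_homologyπ]
    rfl

theorem quasiIso_of_elements {K L : CochainComplex (ModuleCat.{u} R) ℤ} (f : K ⟶ L)
    (hinj : ∀ s (x : K.X (s + 1)) (y : L.X s), K.d (s + 1) (s + 1 + 1) x = 0 →
      L.d s (s + 1) y = f.f (s + 1) x → ∃ x', K.d s (s + 1) x' = x)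
    (hsurj : ∀ s (y : L.X (s + 1)), L.d (s + 1) (s + 1 + 1) y = 0 →
      ∃ x, K.d (s + 1) (s + 1 + 1) x = 0 ∧ ∃ w, y = f.f (s + 1) x + L.d s (s + 1) w) :
    QuasiIso f := by
  rw [quasiIso_iff]
  intro s
  obtain ⟨s, rfl⟩ : ∃ t, s = t + 1 := ⟨s - 1, by simp⟩
  rw [quasiIsoAt_iff_isIso_homologyMap]
  have hmap (z : K.cycles (s + 1)) : HomologicalComplex.homologyMap f (s + 1)
      (K.homologyπ (s + 1) z) = L.homologyπ (s + 1) (HomologicalComplex.cyclesMap f (s + 1) z) := by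
    rw [← ConcreteCategory.comp_apply, HomologicalComplex.homologyπ_naturality]
    rfl
  have hcyc (z : K.cycles (s + 1)) : L.iCycles (s + 1) (HomologicalComplex.cyclesMap f (s + 1) z) =
      f.f (s + 1) (K.iCycles (s + 1) z) := by
    rw [← ConcreteCategory.comp_apply, HomologicalComplex.cyclesMap_i]
    rfl
  have hd (M : CochainComplex (ModuleCat.{u} R) ℤ) (z : M.cycles (s + 1)) :
      M.d (s + 1) (s + 1 + 1) (M.iCycles (s + 1) z) = 0 := by
    rw [← ConcreteCategory.comp_apply, M.iCycles_d]
    rfl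
  have hmono : Mono (HomologicalComplex.homologyMap f (s + 1)) := by
    rw [ModuleCat.mono_iff_injective, injective_iff_map_eq_zero]
    intro a ha
    obtain ⟨z, rfl⟩ := (ModuleCat.epi_iff_surjective (K.homologyπ (s + 1))).1 inferInstance a
    rw [hmap, homologyπ_eq_zero_iff] at ha
    obtain ⟨y, hy⟩ := ha
    rw [hcyc] at hy
    exact (homologyπ_eq_zero_iff z).2 (hinj s _ y (hd K z) hy)
  have hepi : Epi (HomologicalComplex.homologyMap f (s + 1)) := by
    rw [ModuleCat.epi_iff_surjective]
    intro b
    obtain ⟨z, rfl⟩ := (ModuleCat.epi_iff_surjective (L.homologyπ (s + 1))).1 inferInstance b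
    obtain ⟨x, hx, w, hw⟩ := hsurj s _ (hd L z)
    obtain ⟨z', rfl⟩ := exists_cycles x hx
    refine ⟨K.homologyπ (s + 1) z', ?_⟩
    rw [hmap, eq_comm, ← sub_eq_zero, ← map_sub, homologyπ_eq_zero_iff]
    refine ⟨w, ?_⟩
    rw [map_sub, hcyc, hw, add_sub_cancel_left]
  exact isIso_of_mono_of_epi _

theorem d_apply_d_apply (K : CochainComplex (ModuleCat.{u} R) ℤ) (i j k : ℤ) (x : K.X i) :
    K.d j k (K.d i j x) = 0 := by
  rw [← ConcreteCategory.comp_apply, K.d_comp_d]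
  rfl

theorem d_hom_apply {K L : CochainComplex (ModuleCat.{u} R) ℤ} (f : K ⟶ L) (i j : ℤ) (x : K.X i) :
    L.d i j (f.f i x) = f.f j (K.d i j x) := by
  rw [← ConcreteCategory.comp_apply, f.comm]
  rfl

/-- One step of the construction of a semi-projective resolution. -/
theorem exists_cellAttachment_over {P X : CochainComplex (ModuleCat.{u} R) ℤ} (f : P ⟶ X) :
    ∃ (P' : CochainComplex (ModuleCat.{u} R) ℤ) (ι : P ⟶ P') (f' : P' ⟶ X), ι ≫ f' = f ∧
      (∃ F φ, Nonempty (CellAttachment ι F φ)) ∧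
      ∀ s (z : P.X (s + 1)) (y : X.X s), P.d (s + 1) (s + 1 + 1) z = 0 →
        f.f (s + 1) z = X.d s (s + 1) y →
          ∃ p, P'.d s (s + 1) p = ι.f (s + 1) z ∧ f'.f s p = y := by
  -- Pairs of a cycle `z` of `P` and an element `y` bounding its image in `X`. A cell over such a
  -- pair makes `z` a boundary and is sent to `y`.
  let N (s : ℤ) : Submodule R (P.X (s + 1) × X.X s) :=
    LinearMap.ker ((P.d (s + 1) (s + 1 + 1)).hom ∘ₗ LinearMap.fst R _ _) ⊓
      LinearMap.ker ((f.f (s + 1)).hom ∘ₗ LinearMap.fst R _ _ -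
        (X.d s (s + 1)).hom ∘ₗ LinearMap.snd R _ _)
  let F (s : ℤ) : ModuleCat.{u} R := Projective.over (ModuleCat.of R (N s))
  let φ (s : ℤ) : F s ⟶ P.X (s + 1) := Projective.π (ModuleCat.of R (N s)) ≫
    ModuleCat.ofHom (LinearMap.fst R _ _ ∘ₗ (N s).subtype)
  let ψ (s : ℤ) : F s ⟶ X.X s := Projective.π (ModuleCat.of R (N s)) ≫
    ModuleCat.ofHom (LinearMap.snd R _ _ ∘ₗ (N s).subtype)
  have hφ (s : ℤ) : φ s ≫ P.d (s + 1) (s + 1 + 1) = 0 := by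
    dsimp only [φ]
    rw [Category.assoc]
    convert comp_zero
    ext x
    exact x.2.1
  have hψ (s : ℤ) : φ s ≫ f.f (s + 1) = ψ s ≫ X.d s (s + 1) := by
    dsimp only [φ, ψ]
    rw [Category.assoc, Category.assoc]
    congr 1
    ext x
    exact sub_eq_zero.1 x.2.2
  obtain ⟨P', ι, ⟨c⟩⟩ := exists_cellAttachment P F inferInstance φ hφ
  choose f' hf₁ hf₂ using fun s => c.exists_desc (f.f s) (ψ s)
  refine ⟨P', ι, ⟨f', ?_⟩, by ext s : 1; exact hf₁ s, ⟨F, φ, ⟨c⟩⟩, fun s z y hz hy => ?_⟩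
  · rintro s _ rfl
    apply c.hom_ext
    · rw [← Category.assoc, hf₁, f.comm, ι.comm_assoc, hf₁]
    · rw [← Category.assoc, hf₂, ← Category.assoc (c.j s) (P'.d _ _), c.j_d, Category.assoc (φ s),
        hf₁, hψ]
  · obtain ⟨e, he⟩ := (ModuleCat.epi_iff_surjective (Projective.π (ModuleCat.of R (N s)))).1
      inferInstance ⟨(z, y), hz, sub_eq_zero.2 hy⟩
    have h₁ : φ s e = z := congrArg (fun x : N s => x.1.1) he
    have h₂ : ψ s e = y := congrArg (fun x : N s => x.1.2) he
    refine ⟨c.j s e, ?_, ?_⟩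
    · rw [← h₁, ← ConcreteCategory.comp_apply, c.j_d]
      rfl
    · rw [← h₂, ← hf₂]
      rfl

theorem exists_semiProjective_resolution (X : CochainComplex (ModuleCat.{u} R) ℤ) :
    ∃ (P : CochainComplex (ModuleCat.{u} R) ℤ) (f : P ⟶ X),
      DerivedMod.IsSemiProjective P ∧ QuasiIso f := by
  obtain ⟨x, hx₀, hx⟩ := exists_dependent_sequence
    (S := fun _ => Σ P : CochainComplex (ModuleCat.{u} R) ℤ, P ⟶ X) ⟨0, 0⟩
    (r := fun _ a b => ∃ ι : a.1 ⟶ b.1, ι ≫ b.2 = a.2 ∧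
      (∃ F φ, Nonempty (CellAttachment ι F φ)) ∧
      ∀ s (z : a.1.X (s + 1)) (y : X.X s), a.1.d (s + 1) (s + 1 + 1) z = 0 →
        a.2.f (s + 1) z = X.d s (s + 1) y →
          ∃ p, b.1.d s (s + 1) p = ι.f (s + 1) z ∧ b.2.f s p = y)
    fun _ a => by
      obtain ⟨P', ι, f', h⟩ := exists_cellAttachment_over a.2
      exact ⟨⟨P', f'⟩, ι, h⟩
  choose ι hι hcell hkill using hx
  have h₀ (s : ℤ) : IsZero ((x 0).1.X s) := by
    rw [hx₀]
    exact (HomologicalComplex.eval _ _ s).map_isZero (isZero_zero _)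
  obtain ⟨T, c, hc, hel₁, hel₂⟩ := exists_sequentialColimit_elements ι
  obtain ⟨f, hf⟩ := hc.exists_hom (fun n => (x n).2) hι
  have hf' (n : ℕ) (s : ℤ) (y : (x n).1.X s) : f.f s ((c n).f s y) = (x n).2.f s y := by
    rw [← hf n]
    rfl
  have hcι (n : ℕ) (s : ℤ) (y : (x n).1.X s) :
      (c (n + 1)).f s ((ι n).f s y) = (c n).f s y := by
    rw [← hc.comm n]
    rfl
  refine ⟨T, f, ⟨hc.projective hcell h₀, hc.isKProjective hcell h₀⟩,
    quasiIso_of_elements f (fun s t y ht hy => ?_) fun s y hy => ?_⟩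
  · obtain ⟨n, z, rfl⟩ := hel₁ _ t
    rw [d_hom_apply] at ht
    obtain ⟨m, k, hk₁, hk₂⟩ := hel₂ _ _ _ ht
    rw [← d_hom_apply] at hk₂
    have hz : (c m).f (s + 1) (k.f (s + 1) z) = (c n).f (s + 1) z := by
      rw [← hk₁]
      rfl
    obtain ⟨p, hp, -⟩ := hkill m s (k.f (s + 1) z) y hk₂ (by rw [← hf', hz, hy])
    refine ⟨(c (m + 1)).f s p, ?_⟩
    rw [d_hom_apply, hp, hcι, hz]
  -- The pair with `z = 0` turns an arbitrary cycle `y` of `X` into the image of a cycle, so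
  -- cohomology is already hit after the first step.
  · obtain ⟨p, hp₁, hp₂⟩ := hkill 0 (s + 1) 0 y (map_zero _) (by rw [hy, map_zero])
    rw [map_zero] at hp₁
    refine ⟨(c 1).f (s + 1) p, by rw [d_hom_apply, hp₁, map_zero], 0, ?_⟩
    rw [hf', hp₂, map_zero, add_zero]

end CochainComplex

/-! ### Semi-injective resolutions as limits of towers. -/

namespace CochainComplex

open scoped ZeroObject

variable {R : Type u} [Ring R]

theorem IsSequentialLimit.exists_element {J : ℕ → CochainComplex (ModuleCat.{u} R) ℤ}
    {T : CochainComplex (ModuleCat.{u} R) ℤ} {π : ∀ n, J (n + 1) ⟶ J n} {c : ∀ n, T ⟶ J n}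
    (h : IsSequentialLimit π c) {s : ℤ} (a : ∀ n, (J n).X s)
    (ha : ∀ n, (π n).f s (a (n + 1)) = a n) : ∃ b : T.X s, ∀ n, (c n).f s b = a n := by
  obtain ⟨b, hb⟩ := h.exists_lift
    (fun n => ModuleCat.ofHom (LinearMap.toSpanSingleton R ((J n).X s) (a n))) fun n => by
      ext
      simp [ha]
  refine ⟨b (1 : R), fun n => ?_⟩
  rw [← ConcreteCategory.comp_apply, hb]
  simp

theorem IsSequentialLimit.element_ext {J : ℕ → CochainComplex (ModuleCat.{u} R) ℤ}
    {T : CochainComplex (ModuleCat.{u} R) ℤ} {π : ∀ n, J (n + 1) ⟶ J n} {c : ∀ n, T ⟶ J n}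
    (h : IsSequentialLimit π c) {s : ℤ} {a b : T.X s} (hab : ∀ n, (c n).f s a = (c n).f s b) :
    a = b := by
  have : ModuleCat.ofHom (LinearMap.toSpanSingleton R (T.X s) a) =
      ModuleCat.ofHom (LinearMap.toSpanSingleton R (T.X s) b) := h.hom_ext fun n => by
    ext
    simp [hab]
  simpa using ConcreteCategory.congr_hom this (1 : R)

theorem exists_coattaching_maps {X J : CochainComplex (ModuleCat.{u} R) ℤ} (f : X ⟶ J) (t : ℤ) :
    ∃ (E : ModuleCat.{u} R) (h : X.X t ⟶ E) (θ : ∀ s, s + 1 = t → (J.X s ⟶ E)),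
      Injective E ∧ (∀ s hs, f.f s ≫ θ s hs = X.d s t ≫ h) ∧
      (∀ r s hs, J.d r s ≫ θ s hs = 0) ∧
      ∀ r s hs, r + 1 = s → ∀ (a : J.X s) (x : X.X t), θ s hs a + h x = 0 →
        ∃ (w : J.X r) (x' : X.X s), a = J.d r s w + f.f s x' ∧ x = -X.d s t x' := by
  obtain ⟨t, rfl⟩ : ∃ r, t = r + 1 + 1 := ⟨t - 1 - 1, by simp⟩
  -- A differential of the mapping cone of `f`, up to signs and order of the summands. Embedding its
  -- cokernel in an injective gives `θ` and `h`, whose joint kernel is exactly the image of `l`.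
  let l : (J.X t × X.X (t + 1)) →ₗ[R] J.X (t + 1) × X.X (t + 1 + 1) :=
    LinearMap.prod
      (LinearMap.coprod (J.d t (t + 1)).hom (f.f (t + 1)).hom)
      (-((X.d (t + 1) (t + 1 + 1)).hom ∘ₗ LinearMap.snd R _ _))
  let N : ModuleCat.{u} R := ModuleCat.of R (_ ⧸ LinearMap.range l)
  let E : ModuleCat.{u} R := Injective.under N
  let q : (J.X (t + 1) × X.X (t + 1 + 1)) →ₗ[R] E :=
    (Injective.ι N).hom ∘ₗ (LinearMap.range l).mkQ
  have hq (y) : q y = 0 ↔ ∃ x, l x = y := by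
    have hinj := (ModuleCat.mono_iff_injective (Injective.ι N)).1 inferInstance
    rw [← LinearMap.mem_range, ← Submodule.Quotient.mk_eq_zero]
    exact (map_eq_zero_iff _ hinj)
  let θ : J.X (t + 1) ⟶ E := ModuleCat.ofHom (q ∘ₗ LinearMap.inl R _ _)
  let h : X.X (t + 1 + 1) ⟶ E := ModuleCat.ofHom (q ∘ₗ LinearMap.inr R _ _)
  have h₁ : f.f (t + 1) ≫ θ = X.d (t + 1) (t + 1 + 1) ≫ h := by
    ext x
    change q (f.f (t + 1) x, 0) = q (0, X.d (t + 1) (t + 1 + 1) x)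
    rw [← sub_eq_zero, ← map_sub, hq]
    refine ⟨(0, x), ?_⟩
    simp [l]
  have h₂ (r : ℤ) : J.d r (t + 1) ≫ θ = 0 := by
    by_cases hr : r + 1 = t + 1
    · obtain rfl : r = t := by lia
      ext x
      change q (J.d r (r + 1) x, 0) = 0
      rw [hq]
      exact ⟨(x, 0), by simp [l]⟩
    · rw [J.shape _ _ hr, zero_comp]
  have h₃ (a : J.X (t + 1)) (x : X.X (t + 1 + 1)) (hax : θ a + h x = 0) :
      ∃ (w : J.X t) (x' : X.X (t + 1)), a = J.d t (t + 1) w + f.f (t + 1) x' ∧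
        x = -X.d (t + 1) (t + 1 + 1) x' := by
    change q (a, 0) + q (0, x) = 0 at hax
    rw [← map_add, hq] at hax
    obtain ⟨⟨w, x'⟩, hw⟩ := hax
    refine ⟨w, x', ?_, ?_⟩
    · simpa [l] using (congrArg Prod.fst hw).symm
    · simpa [l] using (congrArg Prod.snd hw).symm
  refine ⟨E, h, fun s hs => (J.XIsoOfEq (show s = t + 1 by lia)).hom ≫ θ,
    inferInstanceAs (Injective (Injective.under N)), ?_, ?_, ?_⟩
  · intro s hs
    obtain rfl : s = t + 1 := by lia
    simpa using h₁
  · intro r s hs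
    obtain rfl : s = t + 1 := by lia
    simpa using h₂ r
  · intro r s hs hr
    obtain rfl : s = t + 1 := by lia
    obtain rfl : r = t := by lia
    simpa using h₃

/-- One step of the construction of a semi-injective resolution. -/
theorem exists_cocellAttachment_under {X J : CochainComplex (ModuleCat.{u} R) ℤ} (f : X ⟶ J) :
    ∃ (J' : CochainComplex (ModuleCat.{u} R) ℤ) (π : J' ⟶ J) (f' : X ⟶ J'), f' ≫ π = f ∧
      (∃ E θ, Nonempty (CocellAttachment π E θ)) ∧
      (∀ s (z : J'.X (s + 1)), J'.d (s + 1) (s + 1 + 1) z = 0 →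
        ∃ x, X.d (s + 1) (s + 1 + 1) x = 0 ∧
          ∃ w, π.f (s + 1) z = f.f (s + 1) x + J.d s (s + 1) w) ∧
      ∀ s (x : X.X (s + 1)) (y : J'.X s), J'.d s (s + 1) y = f'.f (s + 1) x →
        ∃ x', X.d s (s + 1) x' = x := by
  choose E h θ hE h₁ h₂ h₃ using exists_coattaching_maps f
  obtain ⟨J', π, ⟨c⟩⟩ := exists_cocellAttachment J E hE (fun s => θ (s + 1) s rfl)
    fun s => h₂ _ _ _ _
  choose f' hf₁ hf₂ using fun s => c.exists_lift (f.f s) (h s)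
  have hq (s : ℤ) (z : J'.X s) :
      c.q (s + 1) (J'.d s (s + 1) z) = θ (s + 1) s rfl (π.f s z) := by
    rw [← ConcreteCategory.comp_apply, c.d_q]
    rfl
  have hf' (s : ℤ) (x : X.X s) : c.q s (f' s x) = h s x := by
    rw [← hf₂]
    rfl
  refine ⟨J', π, ⟨f', ?_⟩, by ext s : 1; exact hf₁ s, ⟨E, _, ⟨c⟩⟩, fun s z hz => ?_,
    fun s x y hy => ?_⟩
  · rintro s _ rfl
    apply c.hom_ext
    · rw [Category.assoc, ← π.comm, reassoc_of% (hf₁ s), f.comm, Category.assoc, hf₁]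
    · rw [Category.assoc, c.d_q, reassoc_of% (hf₁ s), h₁, Category.assoc, hf₂]
  -- A cycle of `J'` has its projection to `J` in the kernel of `θ`; the case of a zero
  -- `X`-component says that this projection is cohomologous to the image of a cycle of `X`.
  · obtain ⟨w, x, hx₁, hx₂⟩ := h₃ (s + 1 + 1) s (s + 1) rfl rfl (π.f (s + 1) z) 0 (by
      rw [← hq, hz, map_zero, map_zero, add_zero])
    exact ⟨x, neg_eq_zero.1 hx₂.symm, w, hx₁.trans (add_comm _ _)⟩
  · obtain ⟨s, rfl⟩ : ∃ t, s = t + 1 := ⟨s - 1, by simp⟩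
    obtain ⟨w, x', -, hx'⟩ := h₃ (s + 1 + 1) s (s + 1) rfl rfl (-π.f (s + 1) y) x (by
      rw [map_neg, ← hq, hy, hf', neg_add_cancel])
    exact ⟨-x', by rw [hx', map_neg]⟩

section Tower

variable {X : CochainComplex (ModuleCat.{u} R) ℤ} {J : ℕ → CochainComplex (ModuleCat.{u} R) ℤ}
  {T : CochainComplex (ModuleCat.{u} R) ℤ} {π : ∀ n, J (n + 1) ⟶ J n} {c : ∀ n, T ⟶ J n}

/-- A map to the limit of a tower whose transition maps are surjective and have the same image as
`X` in cohomology is a quasi-isomorphism. -/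
theorem IsSequentialLimit.quasiIso (hc : IsSequentialLimit π c) (f : ∀ n, X ⟶ J n)
    (hf : ∀ n, f (n + 1) ≫ π n = f n)
    (hπ : ∀ n s, Function.Surjective ((π n).f s))
    (himg : ∀ n s (z : (J (n + 1)).X (s + 1)), (J (n + 1)).d (s + 1) (s + 1 + 1) z = 0 →
      ∃ x, X.d (s + 1) (s + 1 + 1) x = 0 ∧
        ∃ w, (π n).f (s + 1) z = (f n).f (s + 1) x + (J n).d s (s + 1) w)
    (hinj : ∀ n s (x : X.X (s + 1)) (y : (J (n + 1)).X s),
      (J (n + 1)).d s (s + 1) y = (f (n + 1)).f (s + 1) x → ∃ x', X.d s (s + 1) x' = x)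
    (g : X ⟶ T) (hg : ∀ n, g ≫ c n = f n) : QuasiIso g := by
  have hg' (n : ℕ) (s : ℤ) (x : X.X s) : (c n).f s (g.f s x) = (f n).f s x := by
    rw [← hg n]
    rfl
  have hcπ (n : ℕ) (s : ℤ) (z : T.X s) : (π n).f s ((c (n + 1)).f s z) = (c n).f s z := by
    rw [← hc.comm n]
    rfl
  have hfπ (n : ℕ) (s : ℤ) (x : X.X s) : (π n).f s ((f (n + 1)).f s x) = (f n).f s x := by
    rw [← hf n]
    rfl
  refine quasiIso_of_elements g (fun s x y _ hy => ?_) fun s z hz => ?_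
  · refine hinj 0 s x ((c 1).f s y) ?_
    rw [d_hom_apply, hy, hg']
  · obtain ⟨s, rfl⟩ : ∃ t, s = t + 1 := ⟨s - 1, by simp⟩
    have hz' (n : ℕ) : (J n).d (s + 1 + 1) (s + 1 + 1 + 1) ((c n).f _ z) = 0 := by
      rw [d_hom_apply, hz, map_zero]
    choose x hx w hw using fun n => himg n (s + 1) ((c (n + 1)).f _ z) (hz' _)
    simp only [hcπ] at hw
    -- Injectivity on cohomology shows that the chosen cycles of `X` are all cohomologous. The
    -- comparison starts at index `1`, since nothing is known about injectivity of `X ⟶ J 0`.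
    have hb (n : ℕ) : ∃ b, x (n + 1) = x 1 + X.d (s + 1) (s + 1 + 1) b := by
      induction n with
      | zero => exact ⟨0, by simp⟩
      | succ n ih =>
        obtain ⟨b, hb⟩ := ih
        obtain ⟨b', hb'⟩ := hinj n (s + 1) (x (n + 1 + 1) - x (n + 1))
          (w (n + 1) - (π (n + 1)).f _ (w (n + 1 + 1))) (by
            rw [map_sub, map_sub, d_hom_apply, sub_eq_sub_iff_add_eq_add]
            have e₁ := hw (n + 1)
            have e₂ := congrArg ((π (n + 1)).f (s + 1 + 1)) (hw (n + 1 + 1))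
            rw [hcπ, map_add, hfπ, e₁] at e₂
            exact (add_comm _ _).trans e₂)
        exact ⟨b + b', by rw [map_add, hb', ← add_assoc, ← hb, add_sub_cancel]⟩
    have hy (n : ℕ) : ∃ y, (J n).d (s + 1) (s + 1 + 1) y =
        (c n).f (s + 1 + 1) (z - g.f (s + 1 + 1) (x 1)) := by
      have key (n : ℕ) : ∃ y, (J (n + 1)).d (s + 1) (s + 1 + 1) y =
          (c (n + 1)).f (s + 1 + 1) (z - g.f (s + 1 + 1) (x 1)) := by
        obtain ⟨b, hb⟩ := hb n
        refine ⟨(f (n + 1)).f _ b + w (n + 1), ?_⟩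
        rw [map_add, d_hom_apply, map_sub, hg', hw, hb, map_add]
        abel
      obtain ⟨y, hy⟩ := key n
      exact ⟨(π n).f _ y, by rw [d_hom_apply, hy, hcπ]⟩
    suffices h : ∃ y, T.d (s + 1) (s + 1 + 1) y = z - g.f (s + 1 + 1) (x 1) by
      obtain ⟨y, hy⟩ := h
      exact ⟨x 1, hx 1, y, by rw [hy, add_sub_cancel]⟩
    generalize z - g.f (s + 1 + 1) (x 1) = v at hy
    obtain ⟨y₀, hy₀⟩ := hy 1
    -- A Mittag-Leffler argument. Two bounding elements differ by a cycle of `J (n + 1)` that, after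
    -- projection to `J n`, comes from `X` up to a boundary, and both parts lift to the next stage.
    -- Compatibility therefore holds one stage down, for the images of `y n` in `J n`.
    obtain ⟨y, -, hyr⟩ := exists_dependent_sequence
      (S := fun n => { y : (J (n + 1)).X (s + 1) //
        (J (n + 1)).d (s + 1) (s + 1 + 1) y = (c (n + 1)).f (s + 1 + 1) v }) ⟨y₀, hy₀⟩
      (r := fun n y y' => (π n).f _ ((π (n + 1)).f _ y'.1) = (π n).f _ y.1) fun n y => by
        obtain ⟨y', hy'⟩ := hy (n + 1 + 1)
        obtain ⟨x, hx, w, hw⟩ := himg n s ((π (n + 1)).f _ y' - y.1) (by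
          rw [map_sub, d_hom_apply, hy', hcπ, y.2, sub_self])
        obtain ⟨w', rfl⟩ := hπ n _ w
        obtain ⟨w', rfl⟩ := hπ (n + 1) _ w'
        refine ⟨⟨y' - (f (n + 1 + 1)).f _ x - (J (n + 1 + 1)).d _ _ w', ?_⟩, ?_⟩
        · rw [map_sub, map_sub, d_apply_d_apply, sub_zero, d_hom_apply, hx, map_zero, sub_zero, hy']
        · rw [d_hom_apply, d_hom_apply, map_sub, sub_eq_iff_eq_add] at hw
          dsimp only
          rw [map_sub, map_sub, map_sub, map_sub, hfπ, hfπ, hw]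
          abel
    obtain ⟨b, hb⟩ := hc.exists_element (fun n => (π n).f _ (y n).1) hyr
    refine ⟨b, hc.element_ext fun n => ?_⟩
    rw [← d_hom_apply, hb, d_hom_apply, (y n).2, hcπ]

end Tower

theorem CocellAttachment.surjective {J' J : CochainComplex (ModuleCat.{u} R) ℤ} {π : J' ⟶ J}
    {E : ℤ → ModuleCat.{u} R} {θ : ∀ s, J.X s ⟶ E (s + 1)} (c : CocellAttachment π E θ) (s : ℤ) :
    Function.Surjective (π.f s) := fun x => by
  refine ⟨c.i s x, ?_⟩
  rw [← ConcreteCategory.comp_apply, c.i_π]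
  rfl

/-- Limits of modules are not exact, so cohomology is not read off stage by stage as for colimits.
The tower is built to have images in cohomology controlled by `X`, which is what
`IsSequentialLimit.quasiIso` needs. -/
theorem exists_semiInjective_resolution (X : CochainComplex (ModuleCat.{u} R) ℤ) :
    ∃ (I : CochainComplex (ModuleCat.{u} R) ℤ) (f : X ⟶ I),
      DerivedMod.IsSemiInjective I ∧ QuasiIso f := by
  obtain ⟨x, hx₀, hx⟩ := exists_dependent_sequence
    (S := fun _ => Σ J : CochainComplex (ModuleCat.{u} R) ℤ, X ⟶ J) ⟨0, 0⟩
    (r := fun _ a b => ∃ π : b.1 ⟶ a.1, b.2 ≫ π = a.2 ∧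
      (∃ E θ, Nonempty (CocellAttachment π E θ)) ∧
      (∀ s (z : b.1.X (s + 1)), b.1.d (s + 1) (s + 1 + 1) z = 0 →
        ∃ x, X.d (s + 1) (s + 1 + 1) x = 0 ∧
          ∃ w, π.f (s + 1) z = a.2.f (s + 1) x + a.1.d s (s + 1) w) ∧
      ∀ s (x : X.X (s + 1)) (y : b.1.X s), b.1.d s (s + 1) y = b.2.f (s + 1) x →
        ∃ x', X.d s (s + 1) x' = x)
    fun _ a => by
      obtain ⟨J', π, f', h⟩ := exists_cocellAttachment_under a.2
      exact ⟨⟨J', f'⟩, π, h⟩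
  choose π hπ hcell himg hinj using hx
  have h₀ (s : ℤ) : IsZero ((x 0).1.X s) := by
    rw [hx₀]
    exact (HomologicalComplex.eval _ _ s).map_isZero (isZero_zero _)
  obtain ⟨T, c, hc⟩ := exists_isSequentialLimit (J := fun n => (x n).1) π
  obtain ⟨f, hf⟩ := hc.exists_hom (fun n => (x n).2) hπ
  refine ⟨T, f, ⟨hc.injective hcell h₀, hc.isKInjective hcell h₀⟩,
    hc.quasiIso (fun n => (x n).2) hπ (fun n s => ?_) himg hinj f hf⟩
  obtain ⟨E, θ, ⟨k⟩⟩ := hcell n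
  exact k.surjective s

end CochainComplex

/-! ### Comparison of `projLift` and `injLift` with cohomology -/

namespace CochainComplex

variable {C : Type*} [Category* C] [Abelian C]

/-- The opcycles of a cochain complex as a cokernel. -/
def opcyclesIsoCokernel (K : CochainComplex C ℤ) {i j : ℤ} (h : i + 1 = j) :
    K.opcycles j ≅ cokernel (K.d i j) :=
  IsColimit.coconePointUniqueUpToIso (K.opcyclesIsCokernel i j ((ComplexShape.up ℤ).prev_eq' h))
    (colimit.isColimit _)

/-- The cycles of a cochain complex as a kernel. -/
def cyclesIsoKernel (K : CochainComplex C ℤ) {i j : ℤ} (h : i + 1 = j) :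
    K.cycles i ≅ kernel (K.d i j) :=
  IsLimit.conePointUniqueUpToIso (K.cyclesIsKernel i j ((ComplexShape.up ℤ).next_eq' h))
    (limit.isLimit _)

variable [HasDerivedCategory.{w} C]

open DerivedCategory

theorem IsKProjective.exists_Q_map_eq {P L : CochainComplex C ℤ} [P.IsKProjective]
    (φ : Q.obj P ⟶ Q.obj L) : ∃ f : P ⟶ L, Q.map f = φ := by
  obtain ⟨g, hg⟩ := (IsKProjective.Qh_map_bijective P ((HomotopyCategory.quotient C _).obj L)).2
    ((quotientCompQhIso C).hom.app P ≫ φ ≫ (quotientCompQhIso C).inv.app L)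
  obtain ⟨f, rfl⟩ := (HomotopyCategory.quotient C _).map_surjective g
  refine ⟨f, ?_⟩
  rw [← cancel_epi ((quotientCompQhIso C).hom.app P),
    ← cancel_mono ((quotientCompQhIso C).inv.app L), Category.assoc _ φ, ← hg,
    ← (quotientCompQhIso C).hom.naturality, Category.assoc, Iso.hom_inv_id_app, Category.comp_id]
  rfl

theorem IsKInjective.exists_Q_map_eq {K I : CochainComplex C ℤ} [I.IsKInjective]
    (φ : Q.obj K ⟶ Q.obj I) : ∃ f : K ⟶ I, Q.map f = φ := by
  obtain ⟨g, hg⟩ := (IsKInjective.Qh_map_bijective ((HomotopyCategory.quotient C _).obj K) I).2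
    ((quotientCompQhIso C).hom.app K ≫ φ ≫ (quotientCompQhIso C).inv.app I)
  obtain ⟨f, rfl⟩ := (HomotopyCategory.quotient C _).map_surjective g
  refine ⟨f, ?_⟩
  rw [← cancel_epi ((quotientCompQhIso C).hom.app K),
    ← cancel_mono ((quotientCompQhIso C).inv.app I), Category.assoc _ φ, ← hg,
    ← (quotientCompQhIso C).hom.naturality, Category.assoc, Iso.hom_inv_id_app, Category.comp_id]
  rfl

end CochainComplex

namespace DerivedMod

open DerivedCategory RelTriangulated CochainComplex

variable {R : Type u} [Ring R] [HasDerivedCategory.{w} (ModuleCat.{u} R)]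

/-- The `s`-th cohomology functor on `D(R)`. -/
local notation "H" => DerivedCategory.homologyFunctor (ModuleCat R)

theorem projLift_eq_cohLift {A B : ObjectProperty (ModuleCat.{u} R)}
    (h : AbelianCotorsion.IsCompleteHereditary A B) : projLift A = cohLift A := by
  have := h.isClosedUnderIsomorphisms_left
  ext X
  constructor
  · rintro ⟨P, hP, ⟨e⟩, hco⟩ s
    have := hP.projective
    refine A.prop_of_iso ((homologyQIso P s).symm ≪≫ (H s).mapIso e)
      (h.homology_mem_of_opcycles_mem (fun s => ?_) s)
    exact A.prop_of_iso (opcyclesIsoCokernel P (by simp)).symm (hco s)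
  · intro hX
    obtain ⟨K, ⟨e⟩⟩ : ∃ K, Nonempty (Q.obj K ≅ X) := ⟨_, ⟨Q.objObjPreimageIso X⟩⟩
    obtain ⟨P, f, hP, hf⟩ := exists_semiProjective_resolution K
    have := hP.projective
    have := hP.isKProjective
    have := (isIso_Q_map_iff_quasiIso _ f).2 hf
    refine ⟨P, hP, ⟨asIso (Q.map f) ≪≫ e⟩, fun s => ?_⟩
    refine A.prop_of_iso (opcyclesIsoCokernel P (by simp))
      (h.opcycles_mem_of_isKProjective (fun s => ?_) s)
    exact A.prop_of_iso ((H s).mapIso (asIso (Q.map f) ≪≫ e).symm ≪≫ homologyQIso P s) (hX s)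

theorem injLift_eq_cohLift {A B : ObjectProperty (ModuleCat.{u} R)}
    (h : AbelianCotorsion.IsCompleteHereditary A B) : injLift B = cohLift B := by
  have := h.isClosedUnderIsomorphisms_right
  ext X
  constructor
  · rintro ⟨I, hI, ⟨e⟩, hker⟩ s
    have := hI.injective
    refine B.prop_of_iso ((homologyQIso I s).symm ≪≫ (H s).mapIso e.symm)
      (h.homology_mem_of_cycles_mem (fun s => ?_) s)
    exact B.prop_of_iso (cyclesIsoKernel I rfl).symm (hker s)
  · intro hX
    obtain ⟨K, ⟨e⟩⟩ : ∃ K, Nonempty (Q.obj K ≅ X) := ⟨_, ⟨Q.objObjPreimageIso X⟩⟩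
    obtain ⟨I, f, hI, hf⟩ := exists_semiInjective_resolution K
    have := hI.injective
    have := hI.isKInjective
    have := (isIso_Q_map_iff_quasiIso _ f).2 hf
    refine ⟨I, hI, ⟨e.symm ≪≫ asIso (Q.map f)⟩, fun s => ?_⟩
    refine B.prop_of_iso (cyclesIsoKernel I rfl)
      (h.cycles_mem_of_isKInjective (fun s => ?_) s)
    exact B.prop_of_iso ((H s).mapIso (e.symm ≪≫ asIso (Q.map f)) ≪≫ homologyQIso I s) (hX s)

/-- A quasi-isomorphism from `P` to the stalk induces a map of opcycles that splits the inclusion of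
cohomology, because cohomology and opcycles of a stalk agree. So `M` is a retract of a cokernel,
with no cotorsion hypothesis used. -/
theorem mem_of_projLift_single {A : ObjectProperty (ModuleCat.{u} R)} [A.IsStableUnderRetracts]
    {M : ModuleCat.{u} R} {s : ℤ}
    (h : projLift A ((DerivedCategory.singleFunctor (ModuleCat.{u} R) s).obj M)) : A M := by
  obtain ⟨P, hP, ⟨e⟩, hco⟩ := h
  let L : CochainComplex (ModuleCat.{u} R) ℤ := (HomologicalComplex.single _ _ s).obj M
  have hL : IsIso (L.homologyι s) := L.isIso_homologyι s (s + 1) (by simp)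
    (HomologicalComplex.single_obj_d ..)
  have := hP.isKProjective
  obtain ⟨f, hf⟩ := IsKProjective.exists_Q_map_eq (L := L) (show Q.obj P ⟶ Q.obj L from e.hom)
  have : QuasiIso f := by
    rw [← isIso_Q_map_iff_quasiIso, hf]
    exact inferInstanceAs (IsIso e.hom)
  have hι : P.homologyι s ≫ HomologicalComplex.opcyclesMap f s =
    HomologicalComplex.homologyMap f s ≫ L.homologyι s := by simp
  have : IsIso (P.homologyι s ≫ HomologicalComplex.opcyclesMap f s) := by
    rw [hι]
    infer_instance
  have r : Retract (P.homology s) (P.opcycles s) :=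
    { i := P.homologyι s
      r := HomologicalComplex.opcyclesMap f s ≫
        inv (P.homologyι s ≫ HomologicalComplex.opcyclesMap f s)
      retract := by rw [← Category.assoc, IsIso.hom_inv_id] }
  have e' : P.homology s ≅ M :=
    (homologyQIso P s).symm ≪≫ (H s).mapIso e ≪≫ homologySingleIso M s
  exact A.prop_of_iso e' (A.prop_of_retract r
    (A.prop_of_iso (opcyclesIsoCokernel P (by simp)).symm (hco s)))

theorem mem_of_injLift_single {B : ObjectProperty (ModuleCat.{u} R)} [B.IsStableUnderRetracts]
    {M : ModuleCat.{u} R} {s : ℤ}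
    (h : injLift B ((DerivedCategory.singleFunctor (ModuleCat.{u} R) s).obj M)) : B M := by
  obtain ⟨I, hI, ⟨e⟩, hker⟩ := h
  let L : CochainComplex (ModuleCat.{u} R) ℤ := (HomologicalComplex.single _ _ s).obj M
  have hL : IsIso (L.homologyπ s) := L.isIso_homologyπ (s - 1) s (by simp)
    (HomologicalComplex.single_obj_d ..)
  have := hI.isKInjective
  obtain ⟨f, hf⟩ := IsKInjective.exists_Q_map_eq (K := L) (show Q.obj L ⟶ Q.obj I from e.hom)
  have : QuasiIso f := by
    rw [← isIso_Q_map_iff_quasiIso, hf]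
    exact inferInstanceAs (IsIso e.hom)
  have hπ : HomologicalComplex.cyclesMap f s ≫ I.homologyπ s =
    L.homologyπ s ≫ HomologicalComplex.homologyMap f s := by simp
  have : IsIso (HomologicalComplex.cyclesMap f s ≫ I.homologyπ s) := by
    rw [hπ]
    infer_instance
  have r : Retract (I.homology s) (I.cycles s) :=
    { i := inv (HomologicalComplex.cyclesMap f s ≫ I.homologyπ s) ≫
        HomologicalComplex.cyclesMap f s
      r := I.homologyπ s
      retract := by rw [Category.assoc, IsIso.inv_hom_id] }
  have e' : I.homology s ≅ M :=
    (homologyQIso I s).symm ≪≫ (H s).mapIso e.symm ≪≫ homologySingleIso M s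
  exact B.prop_of_iso e' (B.prop_of_retract r
    (B.prop_of_iso (cyclesIsoKernel I rfl).symm (hker s)))

/-- Use a two-term projective presentation of `M` in degrees `s - 1` and `s`. One cokernel is `M`
and the others are terms of the complex, hence projective. The cohomology in degree `s - 1` is
uncontrolled, but only `Hˢ` is needed. -/
theorem exists_projLift_of_mem {A : ObjectProperty (ModuleCat.{u} R)}
    [A.IsClosedUnderIsomorphisms] (hA : ∀ M : ModuleCat.{u} R, Projective M → A M)
    {M : ModuleCat.{u} R} (hM : A M) (s : ℤ) :
    ∃ X, projLift A X ∧ Nonempty ((H s).obj X ≅ M) := by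
  obtain ⟨r, rfl⟩ : ∃ r, s = r + 1 := ⟨s - 1, by simp⟩
  let f := Projective.π (kernel (Projective.π M)) ≫ kernel.ι (Projective.π M)
  have hr : (ComplexShape.up ℤ).Rel r (r + 1) := by simp
  let K : CochainComplex (ModuleCat.{u} R) ℤ := HomologicalComplex.double f hr
  have hne : r ≠ r + 1 := by lia
  have hK (s : ℤ) : Projective (K.X s) := by
    by_cases h₀ : s = r
    · subst h₀
      exact Projective.of_iso (HomologicalComplex.doubleXIso₀ f hr).symm inferInstance
    by_cases h₁ : s = r + 1
    · subst h₁
      exact Projective.of_iso (HomologicalComplex.doubleXIso₁ f hr hne).symm inferInstance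
    · have hz := HomologicalComplex.isZero_double_X f hr s h₀ h₁
      exact Projective.of_iso hz.isoZero.symm inferInstance
  have : K.IsStrictlyLE (r + 1) := by
    rw [CochainComplex.isStrictlyLE_iff]
    intro i hi
    exact HomologicalComplex.isZero_double_X f hr i (by lia) (by lia)
  have e : cokernel (K.d r (r + 1)) ≅ M :=
    cokernelIsoOfEq (HomologicalComplex.double_d f hr hne) ≪≫ cokernelEpiComp _ _ ≪≫
      cokernelCompIsIso _ _ ≪≫ cokernelEpiComp _ _ ≪≫
      IsColimit.coconePointUniqueUpToIso (cokernelIsCokernel _)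
        (ShortComplex.exact_kernel (Projective.π M)).gIsCokernel
  have : IsIso (K.homologyι (r + 1)) := K.isIso_homologyι _ (r + 1 + 1) (by simp)
    (HomologicalComplex.double_d_eq_zero₀ f hr _ _ hne.symm)
  have hco {a b : ℤ} (hab : a + 1 = b) : A (cokernel (K.d a b)) := by
    by_cases h : a = r
    · subst h hab
      exact A.prop_of_iso e.symm hM
    · exact A.prop_of_iso (cokernelZeroIsoTarget.symm ≪≫ cokernelIsoOfEq
        (HomologicalComplex.double_d_eq_zero₀ f hr a b h).symm) (hA _ (hK b))
  refine ⟨Q.obj K, ⟨K, ⟨hK, isKProjective_of_projective K (r + 1)⟩, ⟨Iso.refl _⟩,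
    fun s => hco (by simp)⟩, ⟨?_⟩⟩
  exact homologyQIso K (r + 1) ≪≫ asIso (K.homologyι (r + 1)) ≪≫ opcyclesIsoCokernel K rfl ≪≫ e

theorem exists_injLift_of_mem {B : ObjectProperty (ModuleCat.{u} R)}
    [B.IsClosedUnderIsomorphisms] (hB : ∀ M : ModuleCat.{u} R, Injective M → B M)
    {M : ModuleCat.{u} R} (hM : B M) (s : ℤ) :
    ∃ X, injLift B X ∧ Nonempty ((H s).obj X ≅ M) := by
  let f := cokernel.π (Injective.ι M) ≫ Injective.ι (cokernel (Injective.ι M))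
  have hs : (ComplexShape.up ℤ).Rel s (s + 1) := by simp
  let K : CochainComplex (ModuleCat.{u} R) ℤ := HomologicalComplex.double f hs
  have hne : s ≠ s + 1 := by lia
  have hK (r : ℤ) : Injective (K.X r) := by
    by_cases h₀ : r = s
    · subst h₀
      exact Injective.of_iso (HomologicalComplex.doubleXIso₀ f hs).symm inferInstance
    by_cases h₁ : r = s + 1
    · subst h₁
      exact Injective.of_iso (HomologicalComplex.doubleXIso₁ f hs hne).symm inferInstance
    · have hz := HomologicalComplex.isZero_double_X f hs r h₀ h₁
      exact Injective.of_iso hz.isoZero.symm inferInstance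
  have : K.IsStrictlyGE s := by
    rw [CochainComplex.isStrictlyGE_iff]
    intro i hi
    exact HomologicalComplex.isZero_double_X f hs i (by lia) (by lia)
  have e : kernel (K.d s (s + 1)) ≅ M :=
    kernelIsoOfEq (HomologicalComplex.double_d f hs hne) ≪≫ kernelIsIsoComp _ _ ≪≫
      kernelCompMono _ _ ≪≫ kernelCompMono _ _ ≪≫
      IsLimit.conePointUniqueUpToIso (kernelIsKernel _)
        (ShortComplex.exact_cokernel (Injective.ι M)).fIsKernel
  have : IsIso (K.homologyπ s) := K.isIso_homologyπ (s - 1) s (by simp)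
    (HomologicalComplex.double_d_eq_zero₁ f hs _ _ hne)
  have hker (a : ℤ) : B (kernel (K.d a (a + 1))) := by
    by_cases h : a = s
    · subst h
      exact B.prop_of_iso e.symm hM
    · exact B.prop_of_iso (kernelZeroIsoSource.symm ≪≫ kernelIsoOfEq
        (HomologicalComplex.double_d_eq_zero₀ f hs a (a + 1) h).symm) (hB _ (hK a))
  refine ⟨Q.obj K, ⟨K, ⟨hK, isKInjective_of_injective K s⟩, ⟨Iso.refl _⟩, hker⟩, ⟨?_⟩⟩
  exact homologyQIso K s ≪≫ (asIso (K.homologyπ s)).symm ≪≫ cyclesIsoKernel K rfl ≪≫ e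

end DerivedMod

/-! ### Cotorsion pairs in `D(R)` -/

namespace DerivedMod

open DerivedCategory RelTriangulated

variable {R : Type u} [Ring R] [HasDerivedCategory.{w} (ModuleCat.{u} R)]

/-- The `s`-th cohomology functor on `D(R)`. -/
local notation "H" => DerivedCategory.homologyFunctor (ModuleCat R)

theorem xiExtOneVanishes_single_left_iff (M : ModuleCat.{u} R) (s : ℤ)
    (Y : DerivedCategory (ModuleCat.{u} R)) :
    XiExtOneVanishes (xi R) ((singleFunctor (ModuleCat.{u} R) s).obj M) Y ↔
      Subsingleton (Abelian.Ext M ((H s).obj Y) 1) := by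
  rw [xiExtOneVanishes_iff]
  refine ⟨fun h => ?_, fun h j => ?_⟩
  · have := h s
    exact AbelianCotorsion.subsingleton_ext_of_iso (homologySingleIso M s) (Iso.refl _)
  · by_cases hj : j = s
    · subst hj
      exact AbelianCotorsion.subsingleton_ext_of_iso (homologySingleIso M j).symm (Iso.refl _)
    · have := (isZero_homology_single M hj).projective
      exact Abelian.Ext.subsingleton_of_projective _ _ 0

theorem xiExtOneVanishes_single_right_iff (X : DerivedCategory (ModuleCat.{u} R))
    (M : ModuleCat.{u} R) (s : ℤ) :
    XiExtOneVanishes (xi R) X ((singleFunctor (ModuleCat.{u} R) s).obj M) ↔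
      Subsingleton (Abelian.Ext ((H s).obj X) M 1) := by
  rw [xiExtOneVanishes_iff]
  refine ⟨fun h => ?_, fun h j => ?_⟩
  · have := h s
    exact AbelianCotorsion.subsingleton_ext_of_iso (Iso.refl _) (homologySingleIso M s)
  · by_cases hj : j = s
    · subst hj
      exact AbelianCotorsion.subsingleton_ext_of_iso (Iso.refl _) (homologySingleIso M j).symm
    · have := (isZero_homology_single M hj).injective
      exact Abelian.Ext.subsingleton_of_injective _ _ 0

section

variable {𝒜 ℬ : ObjectProperty (DerivedCategory (ModuleCat.{u} R))}

/-- Membership is orthogonality to `ℬ`, and orthogonality is a condition on each cohomology module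
separately. -/
theorem left_mem_iff_single (h : RelTriangulated.IsCompleteHereditary (xi R) 𝒜 ℬ)
    (X : DerivedCategory (ModuleCat.{u} R)) :
    𝒜 X ↔ ∀ s, 𝒜 ((singleFunctor (ModuleCat.{u} R) s).obj ((H s).obj X)) := by
  simp only [← h.left_eq, RelTriangulated.leftPerp, xiExtOneVanishes_single_left_iff,
    xiExtOneVanishes_iff X]
  exact ⟨fun h s Y hY => h Y hY s, fun h Y hY s => h s Y hY⟩

theorem right_mem_iff_single (h : RelTriangulated.IsCompleteHereditary (xi R) 𝒜 ℬ)
    (Y : DerivedCategory (ModuleCat.{u} R)) :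
    ℬ Y ↔ ∀ s, ℬ ((singleFunctor (ModuleCat.{u} R) s).obj ((H s).obj Y)) := by
  simp only [← h.right_eq, RelTriangulated.rightPerp, xiExtOneVanishes_single_right_iff,
    xiExtOneVanishes_iff _ Y]
  exact ⟨fun h s X hX => h X hX s, fun h X hX s => h s X hX⟩

theorem single_left_mem_of_iso (h : RelTriangulated.IsCompleteHereditary (xi R) 𝒜 ℬ)
    {M N : ModuleCat.{u} R} (e : M ≅ N) {s : ℤ}
    (hM : 𝒜 ((singleFunctor (ModuleCat.{u} R) s).obj M)) :
    𝒜 ((singleFunctor (ModuleCat.{u} R) s).obj N) := by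
  simp only [← h.left_eq, RelTriangulated.leftPerp, xiExtOneVanishes_single_left_iff] at hM ⊢
  intro Y hY
  have := hM Y hY
  exact AbelianCotorsion.subsingleton_ext_of_iso e (Iso.refl _)

theorem single_right_mem_of_iso (h : RelTriangulated.IsCompleteHereditary (xi R) 𝒜 ℬ)
    {M N : ModuleCat.{u} R} (e : M ≅ N) {s : ℤ}
    (hM : ℬ ((singleFunctor (ModuleCat.{u} R) s).obj M)) :
    ℬ ((singleFunctor (ModuleCat.{u} R) s).obj N) := by
  simp only [← h.right_eq, RelTriangulated.rightPerp, xiExtOneVanishes_single_right_iff] at hM ⊢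
  intro X hX
  have := hM X hX
  exact AbelianCotorsion.subsingleton_ext_of_iso (Iso.refl _) e

theorem mem_of_projective {A : ObjectProperty (ModuleCat.{u} R)} [A.IsStableUnderRetracts]
    (h : RelTriangulated.IsCompleteHereditary (xi R) (projLift A) ℬ) (M : ModuleCat.{u} R)
    (_ : Projective M) : A M := by
  refine mem_of_projLift_single (s := 0) ?_
  rw [← h.left_eq]
  intro Y _
  rw [xiExtOneVanishes_single_left_iff]
  exact Abelian.Ext.subsingleton_of_projective _ _ 0

theorem mem_of_injective {B : ObjectProperty (ModuleCat.{u} R)} [B.IsStableUnderRetracts]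
    (h : RelTriangulated.IsCompleteHereditary (xi R) 𝒜 (injLift B)) (M : ModuleCat.{u} R)
    (_ : Injective M) : B M := by
  refine mem_of_injLift_single (s := 0) ?_
  rw [← h.right_eq]
  intro X _
  rw [xiExtOneVanishes_single_right_iff]
  exact Abelian.Ext.subsingleton_of_injective _ _ 0

/-- Reduced to stalks, one inclusion is the retract argument. For the other, a module of `A` is `Hˢ`
of some member of `projLift A`, and the detection principle returns its stalk to the class. -/
theorem projLift_eq_cohLift_of_isCompleteHereditary {A : ObjectProperty (ModuleCat.{u} R)}
    [A.IsStableUnderRetracts]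
    (h : RelTriangulated.IsCompleteHereditary (xi R) (projLift A) ℬ) :
    projLift A = cohLift A := by
  ext X
  rw [left_mem_iff_single h]
  refine forall_congr' fun s => ⟨mem_of_projLift_single, fun hX => ?_⟩
  obtain ⟨Y, hY, ⟨e⟩⟩ := exists_projLift_of_mem (mem_of_projective h) hX s
  exact single_left_mem_of_iso h e ((left_mem_iff_single h Y).1 hY s)

theorem injLift_eq_cohLift_of_isCompleteHereditary {B : ObjectProperty (ModuleCat.{u} R)}
    [B.IsStableUnderRetracts]
    (h : RelTriangulated.IsCompleteHereditary (xi R) 𝒜 (injLift B)) :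
    injLift B = cohLift B := by
  ext Y
  rw [right_mem_iff_single h]
  refine forall_congr' fun s => ⟨mem_of_injLift_single, fun hY => ?_⟩
  obtain ⟨X, hX, ⟨e⟩⟩ := exists_injLift_of_mem (mem_of_injective h) hY s
  exact single_right_mem_of_iso h e ((right_mem_iff_single h X).1 hX s)

end

end DerivedMod

end

theorem mainTheorem4 {R : Type u} [Ring R] [HasDerivedCategory.{w} (ModuleCat.{u} R)]
    (A B C : ObjectProperty (ModuleCat.{u} R))
    [A.IsStableUnderRetracts] [B.IsStableUnderRetracts] [C.IsStableUnderRetracts] :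
    ((AbelianCotorsion.IsCompleteHereditary A C ∧ AbelianCotorsion.IsCompleteHereditary C B) ↔
      (RelTriangulated.IsCompleteHereditary (DerivedMod.xi R)
          (DerivedMod.projLift A) (DerivedMod.injLift C) ∧
        RelTriangulated.IsCompleteHereditary (DerivedMod.xi R)
          (DerivedMod.injLift C) (DerivedMod.injLift B))) ∧
    (AbelianCotorsion.IsCompleteHereditary A C ∧ AbelianCotorsion.IsCompleteHereditary C B →
      DerivedMod.projLift C = DerivedMod.injLift C) := by
  refine ⟨⟨fun ⟨h₁, h₂⟩ => ?_, fun ⟨h₁, h₂⟩ => ?_⟩, fun ⟨h₁, h₂⟩ => ?_⟩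
  · rw [DerivedMod.projLift_eq_cohLift h₁, DerivedMod.injLift_eq_cohLift h₁,
      DerivedMod.injLift_eq_cohLift h₂]
    exact ⟨DerivedMod.isCompleteHereditary_cohLift h₁, DerivedMod.isCompleteHereditary_cohLift h₂⟩
  · have hA (M : ModuleCat.{u} R) (hM : IsZero M) : A M :=
      DerivedMod.mem_of_projective h₁ M hM.projective
    have hB (M : ModuleCat.{u} R) (hM : IsZero M) : B M :=
      DerivedMod.mem_of_injective h₂ M hM.injective
    have hC (M : ModuleCat.{u} R) (hM : IsZero M) : C M :=
      DerivedMod.mem_of_injective h₁ M hM.injective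
    have eA := DerivedMod.projLift_eq_cohLift_of_isCompleteHereditary h₁
    have eC := DerivedMod.injLift_eq_cohLift_of_isCompleteHereditary h₁
    have eB := DerivedMod.injLift_eq_cohLift_of_isCompleteHereditary h₂
    rw [eA, eC] at h₁
    rw [eC, eB] at h₂
    exact ⟨DerivedMod.isCompleteHereditary_of_cohLift hA hC h₁,
      DerivedMod.isCompleteHereditary_of_cohLift hC hB h₂⟩
  -- `C` is the left class of the second pair and the right class of the first, so both lifts are
  -- `cohLift C`.
  · rw [DerivedMod.projLift_eq_cohLift h₂, DerivedMod.injLift_eq_cohLift h₁]
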